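/- Let $\mathbb K$ be a field of characteristic zero and $n\in\mathbb Z$. The hairy graph complex $\mathrm{HGC}_{-1,n}$ is, in each cohomological degree, the space of (possibly infinite) $\mathbb K$-linear combinations of finite connected graphs (multiple edges and tadpoles allowed) with at least one univalent vertex (hair) and without bivalent vertices. Univalent vertices have degree $-1$, all other (internal) vertices degree $n$, edges degree $1-n$, and the total degree is shifted up by $1$; graphs are taken up to isomorphism, with Koszul signs for reordering vertices and edges, and with the sign $(-1)^n$ for reversing an edge. The differential $\delta$ is the sum over all splittings of an internal vertex into two vertices of valence at least $3$ joined by a new edge. The operation $\Delta$ is zero on graphs with exactly one hair, and otherwise is the signed sum over all ways of choosing one hair and reconnecting it to an internal vertex other than the one it originates from. Then $\delta$ and $\Delta$ have degree $1$, $\delta$ preserves the loop order (first Betti number) and $\Delta$ raises it by one, and $\delta^2=0$, $\Delta^2=0$, $\delta\Delta+\Delta\delta=0$. Hence $(\mathrm{HGC}_{-1,n},\delta+\Delta)$ is a complex, with a descending filtration $F^p$ given by the combinations of graphs of loop order at least $p$. The associated spectral sequence $$E_r^p=Z_r^p/(Z_{r-1}^{p+1}+d Z_{r-1}^{p-r+1}),\qquad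 Z_r^p=\{x\in F^p: dx\in F^{p+r}\},\qquad d=\delta+\Delta,$$ has the following properties. 1. Its first page (the associated graded complex) is the hairy graph complex: sending a combination of graphs of loop order $p$ to its class is an isomorphism from the part of loop order $p$ of $\mathrm{HGC}_{-1,n}$ to $E_0^p$ that identifies $\delta$ with the page differential $d_0$. In the same way $E_1^p$ is the cohomology of the part of loop order $p$ of $(\mathrm{HGC}_{-1,n},\delta)$. 2. The spectral sequence converges to $H(\mathrm{HGC}_{-1,n},\delta+\Delta)$: the induced filtration on cohomology is exhaustive, Hausdorff and complete, and its associated graded space is isomorphic to $E_\infty$. In particular, if $H^k(\mathrm{HGC}_{-1,n},\delta+\Delta)=0$ for some $k$, then $E_\infty$ vanishes in total degree $k$; and if $H(\mathrm{HGC}_{-1,n},\delta+\Delta)=0$ (the assertion of the vanishing conjecture for this $n$), then the spectral sequence converges to $0$. -/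

import Mathlib

/-! ### Filtered cochain complexes and their spectral sequences -/

section FilteredComplexes

/-- The subquotient `Z / (Z ∩ N)` of a module. -/
abbrev SubQuot {K A : Type*} [Field K] [AddCommGroup A] [Module K A] (Z N : Submodule K A) :=
  ↥Z ⧸ N.submoduleOf Z

/-- The class in `Z / (Z ∩ N)` of an element of `Z`. -/
abbrev SubQuot.mk {K A : Type*} [Field K] [AddCommGroup A] [Module K A] {Z : Submodule K A}
    (N : Submodule K A) (z : Z) : SubQuot Z N :=
  (N.submoduleOf Z).mkQ z

section Cohomology

variable {K A : Type*} [Field K] [AddCommGroup A] [Module K A]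

/-- Degree `k` cocycles of the graded subspace `C` with differential `d`. -/
def cocycles (C : ℤ → Submodule K A) (d : A →ₗ[K] A) (k : ℤ) : Submodule K A :=
  C k ⊓ LinearMap.ker d

/-- Degree `k` coboundaries of the graded subspace `C` with differential `d`. -/
def coboundaries (C : ℤ → Submodule K A) (d : A →ₗ[K] A) (k : ℤ) : Submodule K A :=
  (C (k - 1)).map d

/-- Degree `k` cohomology of the graded subspace `C` with differential `d`. -/
abbrev Cohomology (C : ℤ → Submodule K A) (d : A →ₗ[K] A) (k : ℤ) :=
  SubQuot (cocycles C d k) (coboundaries C d k)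

end Cohomology

/-- A cochain complex of `K`-vector spaces with a descending filtration. The homogeneous pieces
`C k` are subspaces of one ambient space `A`; the filtration of `C k` consists of the
`C k ⊓ F p`. -/
structure FilteredComplex (K A : Type*) [Field K] [AddCommGroup A] [Module K A] where
  C : ℤ → Submodule K A
  d : A →ₗ[K] A
  F : ℤ → Submodule K A
  d_mem : ∀ k, ∀ x ∈ C k, d x ∈ C (k + 1)
  d_sq : ∀ k, ∀ x ∈ C k, d (d x) = 0
  F_anti : Antitone F
  d_F : ∀ p k, ∀ x ∈ C k, x ∈ F p → d x ∈ F p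

namespace FilteredComplex

variable {K A : Type*} [Field K] [AddCommGroup A] [Module K A] (X : FilteredComplex K A)

/-- `Z_r^p` in total degree `k`: the `x ∈ F^p C^k` with `d x ∈ F^(p+r) C^(k+1)`. -/
def Z (r p k : ℤ) : Submodule K A :=
  X.C k ⊓ X.F p ⊓ (X.F (p + r)).comap X.d

/-- The denominator `Z_(r-1)^(p+1) + d Z_(r-1)^(p-r+1)` of the page `r`, in total degree `k`. -/
def N (r p k : ℤ) : Submodule K A :=
  X.Z (r - 1) (p + 1) k ⊔ (X.Z (r - 1) (p - r + 1) (k - 1)).map X.d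

/-- The page `E_r^p` in filtration degree `p` and total degree `k`
(so `E_r^(p,k-p)` in the usual bigrading). -/
abbrev E (r : ℕ) (p k : ℤ) :=
  SubQuot (X.Z r p k) (X.N r p k)

theorem d_mem_Z {r p q k : ℤ} (h : q = p + r) (x : A) (hx : x ∈ X.Z r p k) :
    X.d x ∈ X.Z r q (k + 1) := by
  subst h
  obtain ⟨⟨hC, -⟩, hF⟩ := hx
  refine ⟨⟨X.d_mem k x hC, hF⟩, ?_⟩
  simp [X.d_sq k x hC]

theorem d_mem_N {r p q k : ℤ} (h : q = p + r) (x : A) (hx : x ∈ X.N r p k) :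
    X.d x ∈ X.N r q (k + 1) := by
  subst h
  obtain ⟨y, hy, w, ⟨z, hz, rfl⟩, rfl⟩ := Submodule.mem_sup.1 hx
  refine Submodule.mem_sup_right ⟨y, ?_, ?_⟩
  · have h1 : p + r - r + 1 = p + 1 := by ring
    have h2 : k + 1 - 1 = k := by ring
    rw [h1, h2]
    exact hy
  · simp [X.d_sq (k - 1) z hz.1.1]

/-- The differential `d_r : E_r^p → E_r^(p+r)` of the page `r`, induced by `d`. -/
def dE (r : ℕ) {p q : ℤ} (h : q = p + r) (k : ℤ) : X.E r p k →ₗ[K] X.E r q (k + 1) :=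
  Submodule.mapQ _ _ (X.d.restrict (X.d_mem_Z (r := r) (k := k) h))
    (fun x hx => X.d_mem_N h x.1 hx)

/-- The numerator of the limit page: the elements of `F^p C^k` that survive to every page,
up to `F^(p+1) C^k`. -/
def ZInf (p k : ℤ) : Submodule K A :=
  ⨅ r : ℕ, X.Z r p k ⊔ (X.C k ⊓ X.F (p + 1))

/-- The denominator of the limit page: the boundaries on some page, up to `F^(p+1) C^k`. -/
def BInf (p k : ℤ) : Submodule K A :=
  (⨆ r : ℕ, (X.Z ((r : ℤ) - 1) (p - r + 1) (k - 1)).map X.d) ⊔ (X.C k ⊓ X.F (p + 1))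

/-- The limit page `E_∞^p` in total degree `k`. -/
abbrev EInf (p k : ℤ) :=
  SubQuot (X.ZInf p k) (X.BInf p k)

/-- The cohomology of the filtered complex. -/
abbrev H (k : ℤ) := Cohomology X.C X.d k

/-- The induced filtration on cohomology: the classes with a representative in `F^p`. -/
def FH (p k : ℤ) : Submodule K (X.H k) :=
  ((X.F p).submoduleOf (cocycles X.C X.d k)).map
    ((coboundaries X.C X.d k).submoduleOf (cocycles X.C X.d k)).mkQ

/-- The spectral sequence of `X` converges to the graded vector space `M` with descending
filtration `G`: the filtration is exhaustive, Hausdorff and complete, and its associated graded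
space is the limit page. -/
structure ConvergesTo (M : ℤ → Type*) [∀ k, AddCommGroup (M k)] [∀ k, Module K (M k)]
    (G : ℤ → (k : ℤ) → Submodule K (M k)) : Prop where
  anti : ∀ p k, G (p + 1) k ≤ G p k
  exhaustive : ∀ k (x : M k), ∃ p, x ∈ G p k
  hausdorff : ∀ k (x : M k), (∀ p, x ∈ G p k) → x = 0
  complete : ∀ k (x : ℤ → M k), (∀ p, x (p + 1) - x p ∈ G p k) → ∃ y, ∀ p, y - x p ∈ G p k
  gr : ∀ p k, Nonempty (SubQuot (G p k) (G (p + 1) k) ≃ₗ[K] X.EInf p k)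

/-- The spectral sequence of `X` converges to zero. -/
def ConvergesToZero : Prop :=
  X.ConvergesTo (fun _ => PUnit.{1}) (fun _ _ => ⊤)

end FilteredComplex

end FilteredComplexes

/-! ### Labelled graphs -/

/-- A finite graph with an ordered list of vertices (labelled by natural numbers) and an ordered
list of directed edges. Multiple edges and tadpoles are allowed. -/
@[ext]
structure LGraph where
  verts : List ℕ
  edges : List (ℕ × ℕ)

namespace LGraph

/-- The valence of a vertex; a tadpole contributes two. -/
def valence (Γ : LGraph) (v : ℕ) : ℕ :=
  (Γ.edges.map Prod.fst).count v + (Γ.edges.map Prod.snd).count v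

/-- `Γ` is a connected hairy graph: there are no bivalent vertices, and there is at least one
univalent vertex. The hairs are the univalent vertices (with their edges), all other vertices are
internal. -/
structure IsHairy (Γ : LGraph) : Prop where
  nodup : Γ.verts.Nodup
  mem : ∀ e ∈ Γ.edges, e.1 ∈ Γ.verts ∧ e.2 ∈ Γ.verts
  connected : ∀ a ∈ Γ.verts, ∀ b ∈ Γ.verts, Relation.EqvGen (fun x y => (x, y) ∈ Γ.edges) a b
  no_bivalent : ∀ v ∈ Γ.verts, Γ.valence v ≠ 2
  exists_hair : ∃ v ∈ Γ.verts, Γ.valence v = 1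

/-- The loop order (first Betti number) of a connected graph. -/
def loopOrder (Γ : LGraph) : ℤ := (Γ.edges.length : ℤ) - Γ.verts.length + 1

/-- Univalent vertices have degree `m`, all others degree `n`. -/
def vdeg (m n : ℤ) (Γ : LGraph) (v : ℕ) : ℤ := if Γ.valence v = 1 then m else n

/-- The total degree of a list of vertices of `Γ`. -/
def vdegs (m n : ℤ) (Γ : LGraph) (l : List ℕ) : ℤ := (l.map (Γ.vdeg m n)).sum

/-- The cohomological degree of `Γ` in the `(m,n)`-hairy graph complex: edges have degree `1 - n`,
and the complex is shifted by `m` as a whole. -/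
def degree (m n : ℤ) (Γ : LGraph) : ℤ :=
  Γ.vdegs m n Γ.verts + (1 - n) * Γ.edges.length - m

/-- Renaming the vertices. -/
def relabel (σ : Equiv.Perm ℕ) (Γ : LGraph) : LGraph :=
  ⟨Γ.verts.map σ, Γ.edges.map (Prod.map σ σ)⟩

/-- The edge `i` can arise by splitting an internal vertex: it is not a tadpole, and both its ends
are internal. -/
def Contractible (Γ : LGraph) (i : Fin Γ.edges.length) : Prop :=
  (Γ.edges.get i).1 ≠ (Γ.edges.get i).2 ∧
    Γ.valence (Γ.edges.get i).1 ≠ 1 ∧ Γ.valence (Γ.edges.get i).2 ≠ 1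

/-- The contraction of the edge `i`, from `a` to `b`: the edge and the vertex `b` are removed, and
what was attached to `b` is attached to `a`. -/
def contract (Γ : LGraph) (i : Fin Γ.edges.length) : LGraph :=
  let a := (Γ.edges.get i).1
  let b := (Γ.edges.get i).2
  let g : ℕ → ℕ := fun x => if x = b then a else x
  ⟨Γ.verts.erase b, (Γ.edges.eraseIdx i).map (Prod.map g g)⟩

/-- The Koszul sign of moving first the edge `i` and then its second end `b` to the front of the
word formed by the vertices followed by the edges. -/
def contractSign (m n : ℤ) (Γ : LGraph) (i : Fin Γ.edges.length) : ℤˣ :=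
  ((1 - n) * (Γ.vdegs m n Γ.verts + (1 - n) * (i : ℕ)) +
    n * Γ.vdegs m n (Γ.verts.takeWhile (fun v => v ≠ (Γ.edges.get i).2))).negOnePow

/-- A label that is not used by any vertex. -/
def fresh (Γ : LGraph) : ℕ := Γ.verts.sum + 1

/-- The edge `i` is detached from its second end and becomes a hair at its first end; the new
univalent vertex is put in front of the other vertices. -/
def detachSnd (Γ : LGraph) (i : Fin Γ.edges.length) : LGraph :=
  ⟨Γ.fresh :: Γ.verts, Γ.edges.set i ((Γ.edges.get i).1, Γ.fresh)⟩

/-- The edge `i` is detached from its first end and becomes a hair at its second end; the new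
univalent vertex is put in front of the other vertices. -/
def detachFst (Γ : LGraph) (i : Fin Γ.edges.length) : LGraph :=
  ⟨Γ.fresh :: Γ.verts, Γ.edges.set i (Γ.fresh, (Γ.edges.get i).2)⟩

end LGraph

/-! ### The hairy graph complex -/

section Hairy

variable (K : Type*) [Field K]

/-- The functions on labelled graphs that vanish outside of `P`. -/
def supportedOn (P : LGraph → Prop) : Submodule K (LGraph → K) where
  carrier := {f | ∀ Γ, ¬ P Γ → f Γ = 0}
  zero_mem' := fun _ _ => rfl
  add_mem' := fun {f g} hf hg Γ h => by simp [hf Γ h, hg Γ h]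
  smul_mem' := fun c f hf Γ h => by simp [hf Γ h]

/-- The underlying space of the hairy graph complex. An element is a (possibly infinite) linear
combination of hairy graphs, given by its coefficients: the function `f` stands for the series
`∑ f(Γ)/|Aut Γ| • Γ` over isomorphism classes of hairy graphs. The coefficients do not depend on
the names of the vertices, and they change by the Koszul sign when vertices or edges are
reordered (univalent vertices have degree `m`, the others `n`, edges `1 - n`) and by `(-1)^n` when
the direction of an edge is reversed. -/
def hairyGraphs (m n : ℤ) : Submodule K (LGraph → K) where
  carrier := {f |
    (∀ Γ, ¬ Γ.IsHairy → f Γ = 0) ∧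
    (∀ (σ : Equiv.Perm ℕ) Γ, f (Γ.relabel σ) = f Γ) ∧
    (∀ (l l' : List ℕ) (a b : ℕ) (es : List (ℕ × ℕ)),
      f ⟨l ++ b :: a :: l', es⟩ =
        (LGraph.vdeg m n ⟨l ++ a :: b :: l', es⟩ a *
          LGraph.vdeg m n ⟨l ++ a :: b :: l', es⟩ b).negOnePow • f ⟨l ++ a :: b :: l', es⟩) ∧
    (∀ (vs : List ℕ) (l l' : List (ℕ × ℕ)) (e e' : ℕ × ℕ),
      f ⟨vs, l ++ e' :: e :: l'⟩ = ((1 - n) * (1 - n)).negOnePow • f ⟨vs, l ++ e :: e' :: l'⟩) ∧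
    (∀ (vs : List ℕ) (l l' : List (ℕ × ℕ)) (a b : ℕ),
      f ⟨vs, l ++ (b, a) :: l'⟩ = n.negOnePow • f ⟨vs, l ++ (a, b) :: l'⟩)}
  zero_mem' := by simp
  add_mem' := by
    rintro f g ⟨h1, h2, h3, h4, h5⟩ ⟨h1', h2', h3', h4', h5'⟩
    refine ⟨fun Γ h => ?_, fun σ Γ => ?_, fun l l' a b es => ?_, fun vs l l' e e' => ?_,
      fun vs l l' a b => ?_⟩
    · simp [h1 Γ h, h1' Γ h]
    · simp [h2 σ Γ, h2' σ Γ]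
    · simp only [Pi.add_apply, smul_add, ← h3, ← h3']
    · simp only [Pi.add_apply, smul_add, ← h4, ← h4']
    · simp only [Pi.add_apply, smul_add, ← h5, ← h5']
  smul_mem' := by
    rintro c f ⟨h1, h2, h3, h4, h5⟩
    refine ⟨fun Γ h => ?_, fun σ Γ => ?_, fun l l' a b es => ?_, fun vs l l' e e' => ?_,
      fun vs l l' a b => ?_⟩
    · simp [h1 Γ h]
    · simp [h2 σ Γ]
    · simp only [Pi.smul_apply, smul_comm _ c, ← h3]
    · simp only [Pi.smul_apply, smul_comm _ c, ← h4]
    · simp only [Pi.smul_apply, smul_comm _ c, ← h5]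

/-- The hairy graph complex `HGC_{m,n}` in cohomological degree `k`. -/
def HGC (m n k : ℤ) : Submodule K (LGraph → K) :=
  hairyGraphs K m n ⊓ supportedOn K (fun Γ => Γ.degree m n = k)

/-- The part of loop order `p` of `HGC_{m,n}` in cohomological degree `k`. -/
def HGCLoop (m n p k : ℤ) : Submodule K (LGraph → K) :=
  HGC K m n k ⊓ supportedOn K (fun Γ => Γ.loopOrder = p)

/-- The descending filtration by loop order: combinations of graphs of loop order at least `p`. -/
def loopFiltration (p : ℤ) : Submodule K (LGraph → K) :=
  supportedOn K (fun Γ => p ≤ Γ.loopOrder)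

open Classical in
/-- The vertex splitting differential `δ`. The coefficient of `Γ` in `δ f` is a sum over the edges
of `Γ` which can be the new edge of a splitting, the graph before splitting being the contraction.
Only splittings that produce hairy graphs (so without new vertices of valence one or two) count. -/
noncomputable def splitDiff (m n : ℤ) : (LGraph → K) →ₗ[K] (LGraph → K) where
  toFun f := fun Γ =>
    if Γ.IsHairy then
      ∑ i : Fin Γ.edges.length,
        if Γ.Contractible i then Γ.contractSign m n i • f (Γ.contract i) else 0
    else 0
  map_add' f g := by
    funext Γ
    by_cases h : Γ.IsHairy
    · simp only [h, if_true, Pi.add_apply, ← Finset.sum_add_distrib]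
      refine Finset.sum_congr rfl fun i _ => ?_
      split_ifs <;> simp
    · simp [h]
  map_smul' c f := by
    funext Γ
    by_cases h : Γ.IsHairy
    · simp only [h, if_true, Pi.smul_apply, Finset.smul_sum, RingHom.id_apply]
      refine Finset.sum_congr rfl fun i _ => ?_
      split_ifs
      · exact smul_comm _ _ _
      · simp
    · simp [h]

open Classical in
/-- The operation `Δ` (for `m = -1`) that reconnects one hair to a vertex other than the one it
originates from, in all possible ways; the univalent vertex at the end of the hair, in front of the
other vertices, is removed. The coefficient of `Γ` in `Δ f` is a sum over the edges of `Γ` (tadpoles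
excluded) which can be the reconnected hair, and over the end of the edge to which it was
reconnected. Graphs without hairs are not hairy, so `Δ` is zero on graphs with one hair. -/
noncomputable def hairDiff : (LGraph → K) →ₗ[K] (LGraph → K) where
  toFun f := fun Γ =>
    if Γ.IsHairy then
      ∑ i : Fin Γ.edges.length,
        if (Γ.edges.get i).1 ≠ (Γ.edges.get i).2 then
          f (Γ.detachSnd i) + f (Γ.detachFst i) else 0
    else 0
  map_add' f g := by
    funext Γ
    by_cases h : Γ.IsHairy
    · simp only [h, if_true, Pi.add_apply, ← Finset.sum_add_distrib]
      refine Finset.sum_congr rfl fun i _ => ?_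
      split_ifs
      · abel
      · simp
    · simp [h]
  map_smul' c f := by
    funext Γ
    by_cases h : Γ.IsHairy
    · simp only [h, if_true, Pi.smul_apply, Finset.smul_sum, RingHom.id_apply]
      refine Finset.sum_congr rfl fun i _ => ?_
      split_ifs <;> simp [mul_add]
    · simp [h]

end Hairy

/-! An element of the complex is its function of coefficients on labelled graphs, and a coefficient
of `δ x` or `Δ x` at `Γ` is a finite sum over the edges of `Γ`: contract an edge, or detach one of
its ends into a new hair. Because coefficients obey the Koszul rules, each sum can be written as a
`pickSum`: an edge is moved to the front with the sign `edgeSign`, and the operation is performed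
there. The identities between `δ` and `Δ` become cancellations in sums over ordered pairs of
distinct edges (`pickSum_pickSum_eq_zero`). The recurring sign fact is that exchanging two edges and
reversing an edge have opposite signs (`edgeSign_mul_negOnePow`).

For `δ² = 0`, contracting two edges in the two possible orders gives opposite terms
(`con_con_antisymm`); a pair with the same ends does not occur, since the second edge becomes a
tadpole. For `Δ² = 0`, the two new hairs are odd, so detaching in the other order changes the sign
(`coeff_det_det`). For `δΔ + Δδ = 0`, both composites are sums of the same terms `recTerm` (contract
`e`, detach `e'`), with opposite signs but over different pairs: one composite omits parallel pairs,
where `e'` becomes a tadpole, the other omits detachments at a trivalent vertex, where the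
intermediate graph has a bivalent vertex. The omitted terms sum to zero separately: the parallel
ones by exchanging `e` and `e'`, the trivalent ones by a cancellation among the six ordered pairs of
edges at one vertex (`tripleTerm_eq_zero`).

The first two pages are identified by splitting off the part of lowest loop order, since `Δ` raises
the loop order. The filtration starts at loop order zero, is Hausdorff and complete, but is
infinite, so convergence also needs images of filtered pieces under `d` to be closed. This is linear
compactness (`exists_solution_of_finite`): the complex is cut out by finitely supported relations
and each coefficient of `d w` involves finitely many coefficients of `w`, so `d w = x` is solvable
as soon as its finite subsystems are. Then surviving to every page means being a cocycle modulo
higher filtration (`mem_ZInf_iff`), and `convergesTo_cohomology` applies. -/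

section FilteredComplexes

/-! ### Subquotients and their comparison -/

section SubQuot

variable {K A : Type*} [Field K] [AddCommGroup A] [Module K A]

theorem SubQuot.mk_eq_zero {Z N : Submodule K A} (z : Z) :
    SubQuot.mk N z = 0 ↔ (z : A) ∈ N := by
  exact (Submodule.Quotient.mk_eq_zero _).trans Iff.rfl

theorem SubQuot.mk_surjective {Z : Submodule K A} (N : Submodule K A) :
    Function.Surjective (SubQuot.mk N : Z → SubQuot Z N) :=
  Submodule.mkQ_surjective _

/-- An inclusion of numerators which is compatible with the denominators induces an isomorphism of
subquotients. -/
noncomputable def subQuotEquivOfLE {Z Z' N N' : Submodule K A} (hZ : Z ≤ Z')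
    (hN : ∀ z ∈ Z, z ∈ N ↔ z ∈ N') (hs : ∀ z' ∈ Z', ∃ z ∈ Z, z' - z ∈ N') :
    SubQuot Z N ≃ₗ[K] SubQuot Z' N' :=
  LinearEquiv.ofBijective
    (Submodule.mapQ (N.submoduleOf Z) (N'.submoduleOf Z') (Submodule.inclusion hZ)
      fun z hz => (hN z.1 z.2).1 hz) <| by
    constructor
    · rw [injective_iff_map_eq_zero]
      intro q hq
      obtain ⟨z, rfl⟩ := SubQuot.mk_surjective N q
      exact (SubQuot.mk_eq_zero z).2 ((hN _ z.2).2
        ((SubQuot.mk_eq_zero (Submodule.inclusion hZ z)).1 hq))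
    · intro q
      obtain ⟨z', rfl⟩ := SubQuot.mk_surjective N' q
      obtain ⟨z, hz, h⟩ := hs z'.1 z'.2
      refine ⟨SubQuot.mk N ⟨z, hz⟩, ?_⟩
      refine (sub_eq_zero.1 ?_).symm
      exact (SubQuot.mk_eq_zero (z' - Submodule.inclusion hZ ⟨z, hz⟩)).2 h

/-- A complement of the denominator in the numerator is isomorphic to the subquotient. -/
noncomputable def equivSubQuotOfLE {Z Z' N' : Submodule K A} (hZ : Z ≤ Z')
    (hN : ∀ z ∈ Z, z ∈ N' → z = 0) (hs : ∀ z' ∈ Z', ∃ z ∈ Z, z' - z ∈ N') :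
    Z ≃ₗ[K] SubQuot Z' N' :=
  LinearEquiv.ofBijective ((N'.submoduleOf Z').mkQ ∘ₗ Submodule.inclusion hZ) <| by
    constructor
    · rw [injective_iff_map_eq_zero]
      intro z hz
      exact Subtype.ext (hN z.1 z.2 ((SubQuot.mk_eq_zero (Submodule.inclusion hZ z)).1 hz))
    · intro q
      obtain ⟨z', rfl⟩ := SubQuot.mk_surjective N' q
      obtain ⟨z, hz, h⟩ := hs z'.1 z'.2
      refine ⟨⟨z, hz⟩, ?_⟩
      refine (sub_eq_zero.1 ?_).symm
      exact (SubQuot.mk_eq_zero (z' - Submodule.inclusion hZ ⟨z, hz⟩)).2 h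

end SubQuot

/-! ### The first two pages of a split filtration -/

namespace FilteredComplex

variable {K A : Type*} [Field K] [AddCommGroup A] [Module K A] (X : FilteredComplex K A)

theorem mem_FH {p k : ℤ} (z : cocycles X.C X.d k) :
    SubQuot.mk (coboundaries X.C X.d k) z ∈ X.FH p k ↔
      ∃ w ∈ X.C (k - 1), (z : A) - X.d w ∈ X.F p := by
  constructor
  · rintro ⟨y, hy, h⟩
    have h' := (SubQuot.mk_eq_zero (N := coboundaries X.C X.d k) (z - y)).1 (by
      rw [SubQuot.mk, map_sub, sub_eq_zero]; exact h.symm)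
    obtain ⟨w, hw, h2⟩ := h'
    refine ⟨w, hw, ?_⟩
    rw [h2]
    have h3 : (z : A) - (z - y : cocycles X.C X.d k) = y := by simp
    exact h3 ▸ hy
  · rintro ⟨w, hw, h⟩
    have hc : X.d w ∈ cocycles X.C X.d k := by
      refine ⟨?_, X.d_sq _ _ hw⟩
      have := X.d_mem _ _ hw
      rwa [sub_add_cancel] at this
    refine ⟨z - ⟨X.d w, hc⟩, h, ?_⟩
    rw [map_sub, sub_eq_self]
    exact (SubQuot.mk_eq_zero _).2 ⟨w, hw, rfl⟩

/-- Splittings of the filtration identify the page `0` with the graded pieces. -/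
noncomputable def pageZeroEquiv (G : ℤ → ℤ → Submodule K A)
    (hG : ∀ p k, ∀ x ∈ G p k, x ∈ X.C k ∧ x ∈ X.F p)
    (hG0 : ∀ p k, ∀ x ∈ G p k, x ∈ X.F (p + 1) → x = 0)
    (hGs : ∀ p k, ∀ x ∈ X.C k, x ∈ X.F p → ∃ y ∈ G p k, x - y ∈ X.F (p + 1)) (p k : ℤ) :
    G p k ≃ₗ[K] X.E 0 p k :=
  equivSubQuotOfLE
    (fun x hx => ⟨hG p k x hx, by
      simpa using X.d_F p k x (hG p k x hx).1 (hG p k x hx).2⟩)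
    -- For `r = 0` the denominator is `Z_(-1)^(p+1) + d Z_(-1)^(p+1)`, which lies in `F^(p+1)`.
    (fun x hx hN => by
      refine hG0 p k x hx ?_
      obtain ⟨y, hy, w, ⟨z, hz, rfl⟩, rfl⟩ := Submodule.mem_sup.1 hN
      refine add_mem hy.1.2 (X.d_F _ _ _ hz.1.1 ?_)
      simpa using hz.1.2)
    (fun x hx => by
      obtain ⟨y, hy, h⟩ := hGs p k x hx.1.1 hx.1.2
      refine ⟨y, hy, Submodule.mem_sup_left ⟨⟨sub_mem hx.1.1 (hG p k y hy).1, h⟩, ?_⟩⟩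
      have := X.d_F p k _ (sub_mem hx.1.1 (hG p k y hy).1)
        (sub_mem hx.1.2 (hG p k y hy).2)
      simpa using this)

/-- The page `1` is the cohomology of the graded pieces. -/
noncomputable def pageOneEquiv (G : ℤ → ℤ → Submodule K A) (δ : A →ₗ[K] A)
    (hG : ∀ p k, ∀ x ∈ G p k, x ∈ X.C k ∧ x ∈ X.F p)
    (hG0 : ∀ p k, ∀ x ∈ G p k, x ∈ X.F (p + 1) → x = 0)
    (hGs : ∀ p k, ∀ x ∈ X.C k, x ∈ X.F p → ∃ y ∈ G p k, x - y ∈ X.F (p + 1))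
    (hδ : ∀ p k, ∀ x ∈ G p k, δ x ∈ G p (k + 1))
    (hd : ∀ p k, ∀ x ∈ G p k, X.d x - δ x ∈ X.F (p + 1)) (p k : ℤ) :
    Cohomology (G p) δ k ≃ₗ[K] X.E 1 p k :=
  subQuotEquivOfLE
    (fun x hx => ⟨hG p k x hx.1, by
      have := hd p k x hx.1
      rw [LinearMap.mem_ker.1 hx.2, sub_zero] at this
      simpa using this⟩)
    (fun x hx => by
      constructor
      · rintro ⟨w, hw, rfl⟩
        have h1 := hd p (k - 1) w hw
        have h2 := hδ p (k - 1) w hw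
        have h3 := X.d_mem _ w (hG _ _ w hw).1
        rw [sub_add_cancel] at h2 h3
        rw [N, Submodule.mem_sup]
        -- The decomposition `δ w = -(d w - δ w) + d w` has its first term in `Z_0^(p+1)` and its
        -- second in `d Z_0^p`.
        refine ⟨-(X.d w - δ w), ?_, X.d w, ⟨w, ?_, rfl⟩, by abel⟩
        · refine neg_mem ⟨⟨sub_mem h3 (hG _ _ _ h2).1, h1⟩, ?_⟩
          have := X.d_F _ _ _ (sub_mem h3 (hG _ _ _ h2).1) h1
          simpa using this
        · refine ⟨⟨(hG _ _ w hw).1, ?_⟩, ?_⟩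
          · simpa using (hG _ _ w hw).2
          · have := X.d_F _ _ _ (hG _ _ w hw).1 (hG _ _ w hw).2
            simpa using this
      · intro hN
        obtain ⟨y, hy, w, ⟨z, hz, rfl⟩, rfl⟩ := Submodule.mem_sup.1 hN
        have hzF : z ∈ X.F p := by simpa using hz.1.2
        -- Only the leading part `z'` of `z` matters: the given element minus `δ z'` lies in `G p k`
        -- and in `F^(p+1)`, hence is zero.
        obtain ⟨z', hz', h⟩ := hGs p (k - 1) z hz.1.1 hzF
        refine ⟨z', hz', ?_⟩
        have h2 := hδ p (k - 1) z' hz'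
        rw [sub_add_cancel] at h2
        have h4 : y + X.d z - δ z' ∈ G p k := sub_mem hx.1 h2
        have h5 : y + X.d z - δ z' = y + X.d (z - z') + (X.d z' - δ z') := by
          rw [map_sub]; abel
        refine (sub_eq_zero.1 (hG0 p k _ h4 ?_)).symm
        rw [h5]
        exact add_mem (add_mem hy.1.2 (X.d_F _ _ _ (sub_mem hz.1.1 (hG _ _ _ hz').1) h))
          (hd _ _ _ hz'))
    (fun x hx => by
      obtain ⟨y, hy, h⟩ := hGs p k x hx.1.1 hx.1.2
      have hC := sub_mem hx.1.1 (hG p k y hy).1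
      have h1 := X.d_F _ _ _ hC h
      refine ⟨y, ⟨hy, ?_⟩, Submodule.mem_sup_left ⟨⟨hC, h⟩, by simpa using h1⟩⟩
      -- The leading part `y` is a `δ`-cocycle, since `δ y` is homogeneous and agrees with `d x`
      -- modulo `F^(p+1)`.
      refine hG0 p (k + 1) _ (hδ p k y hy) ?_
      have h2 : δ y = X.d x - X.d (x - y) - (X.d y - δ y) := by rw [map_sub]; abel
      rw [h2]
      exact sub_mem (sub_mem (by simpa using hx.2) h1) (hd _ _ _ hy))

/-! ### Convergence of the spectral sequence -/

section Convergence

variable (h0 : ∀ k, X.C k ≤ X.F 0) (hF : ∀ x, (∀ p, x ∈ X.F p) → x = 0)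
  (hcomp : ∀ k (x : ℤ → A), (∀ p, x p ∈ X.C k) → (∀ p, x (p + 1) - x p ∈ X.F p) →
    ∃ y ∈ X.C k, ∀ p, y - x p ∈ X.F p)
  (hclosed : ∀ k q x, (∀ p, ∃ w ∈ X.C k, w ∈ X.F q ∧ x - X.d w ∈ X.F p) →
    ∃ w ∈ X.C k, w ∈ X.F q ∧ X.d w = x)

include hclosed

/-- Surviving to every page means that `d x` is approximated arbitrarily well by `d y` with `y` in
`F^(p+1)`. Closedness of `d (F^(p+1))` turns this into an exact solution `d w = d x`, and `x - w` is
the cocycle. -/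
theorem mem_ZInf_iff {p k : ℤ} {x : A} :
    x ∈ X.ZInf p k ↔ ∃ z ∈ cocycles X.C X.d k ⊓ X.F p, ∃ y ∈ X.C k ⊓ X.F (p + 1), z + y = x := by
  constructor
  · intro hx
    rw [ZInf, Submodule.mem_iInf] at hx
    obtain ⟨w, hw, hwF, h⟩ := hclosed k (p + 1) (X.d x) (fun q => by
      obtain ⟨z, hz, y, hy, h⟩ := Submodule.mem_sup.1 (hx (q - p).toNat)
      refine ⟨y, hy.1, hy.2, ?_⟩
      rw [← h, map_add, add_sub_cancel_right]
      exact X.F_anti (by have := Int.self_le_toNat (q - p); omega) hz.2)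
    obtain ⟨z, hz, y, hy, hxz⟩ := Submodule.mem_sup.1 (hx 0)
    have hxC : x ∈ X.C k := hxz ▸ add_mem hz.1.1 hy.1
    have hxF : x ∈ X.F p := hxz ▸ add_mem hz.1.2 (X.F_anti (by omega) hy.2)
    refine ⟨x - w, ⟨⟨sub_mem hxC hw, ?_⟩, sub_mem hxF (X.F_anti (by omega) hwF)⟩, w, ⟨hw, hwF⟩,
      sub_add_cancel _ _⟩
    simp [h]
  · rintro ⟨z, hz, y, hy, rfl⟩
    rw [ZInf, Submodule.mem_iInf]
    intro r
    refine Submodule.add_mem_sup ⟨⟨hz.1.1, hz.2⟩, ?_⟩ hy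
    simp [LinearMap.mem_ker.1 hz.1.2]

omit hclosed
include h0

/-- The boundaries of the successive pages increase, and since `F^0` is everything, the filtration
condition on the primitive becomes void once `p - r + 1 ≤ 0`. -/
theorem mem_BInf_iff {p k : ℤ} {x : A} :
    x ∈ X.BInf p k ↔ ∃ w ∈ X.C (k - 1), X.d w ∈ X.F p ∧ x - X.d w ∈ X.C k ⊓ X.F (p + 1) := by
  have hdir : Directed (· ≤ ·) fun r : ℕ => (X.Z ((r : ℤ) - 1) (p - r + 1) (k - 1)).map X.d := by
    refine (monotone_nat_of_le_succ fun r => Submodule.map_mono ?_).directed_le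
    rintro x ⟨⟨h1, h2⟩, h3⟩
    refine ⟨⟨h1, X.F_anti (by push_cast; omega) h2⟩, X.F_anti (by push_cast; omega) h3⟩
  rw [BInf, Submodule.mem_sup]
  constructor
  · rintro ⟨y, hy, z, hz, rfl⟩
    obtain ⟨r, w, hw, rfl⟩ := (Submodule.mem_iSup_of_directed _ hdir).1 hy
    refine ⟨w, hw.1.1, X.F_anti (by omega) hw.2, ?_⟩
    rwa [add_sub_cancel_left]
  · rintro ⟨w, hw, hwF, h⟩
    refine ⟨X.d w, ?_, _, h, add_sub_cancel _ _⟩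
    refine (Submodule.mem_iSup_of_directed _ hdir).2 ⟨(p + 1).toNat, w, ⟨⟨hw, ?_⟩, ?_⟩, rfl⟩
    · exact X.F_anti (by have := Int.self_le_toNat (p + 1); omega) (h0 _ hw)
    · exact X.F_anti (by omega) hwF

include hF hcomp hclosed

/-- Exhaustiveness comes from `h0`, the Hausdorff property from closedness of the boundaries,
completeness from completeness of the complex after correcting representatives by coboundaries. -/
theorem convergesTo_cohomology : X.ConvergesTo X.H X.FH where
  anti p k := Submodule.map_mono fun x hx => X.F_anti (by omega) hx
  exhaustive k x := by
    obtain ⟨z, rfl⟩ := SubQuot.mk_surjective _ x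
    exact ⟨0, (X.mem_FH z).2 ⟨0, zero_mem _, by simpa using h0 k z.2.1⟩⟩
  hausdorff k x hx := by
    obtain ⟨z, rfl⟩ := SubQuot.mk_surjective _ x
    obtain ⟨w, hw, -, h⟩ := hclosed (k - 1) 0 z.1 (fun p => by
      obtain ⟨w, hw, h⟩ := (X.mem_FH z).1 (hx p)
      exact ⟨w, hw, h0 _ hw, h⟩)
    exact (SubQuot.mk_eq_zero z).2 ⟨w, hw, h⟩
  complete k x hx := by
    choose z hz using fun p => SubQuot.mk_surjective (coboundaries X.C X.d k) (x p)
    have hx' : ∀ p, ∃ w ∈ X.C (k - 1), (z (p + 1) : A) - z p - X.d w ∈ X.F p := by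
      intro p
      have := hx p
      rw [← hz, ← hz, ← map_sub] at this
      exact (X.mem_FH _).1 this
    choose w hw hwF using hx'
    have hdw : ∀ v ∈ X.C (k - 1), X.d v ∈ cocycles X.C X.d k := fun v hv =>
      ⟨by simpa using X.d_mem _ _ hv, X.d_sq _ _ hv⟩
    -- Partial sums of the corrections `w`, so that the representatives `z p - d (W p)` form a
    -- Cauchy sequence.
    have hsum : ∃ W : ℤ → A, (∀ p, W p ∈ X.C (k - 1)) ∧ ∀ p, 0 ≤ p → W (p + 1) = W p + w p := by
      refine ⟨fun p => ∑ i ∈ Finset.range p.toNat, w i, fun p => sum_mem fun i _ => hw i, ?_⟩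
      intro p hp
      lift p to ℕ using hp
      have : ((p : ℤ) + 1).toNat = p + 1 := by omega
      simp [this, Finset.sum_range_succ]
    obtain ⟨W, hW, hWs⟩ := hsum
    -- For negative indices the sequence is frozen at its value at `0`; nothing is lost because
    -- `F^p` contains the whole complex there.
    obtain ⟨y, hyC, hy⟩ := hcomp k
      (fun p => if 0 ≤ p then (z p : A) - X.d (W p) else (z 0 : A) - X.d (W 0)) (fun p => by
        split_ifs
        · exact sub_mem (z p).2.1 (hdw _ (hW p)).1
        · exact sub_mem (z 0).2.1 (hdw _ (hW 0)).1) (fun p => by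
        by_cases hp : 0 ≤ p
        · rw [if_pos hp, if_pos (by omega), hWs p hp, map_add]
          convert hwF p using 1
          abel
        · refine X.F_anti (by omega : p ≤ 0) (h0 k ?_)
          split_ifs <;>
          exact sub_mem (sub_mem (z _).2.1 (hdw _ (hW _)).1) (sub_mem (z _).2.1 (hdw _ (hW _)).1))
    -- The approximants are cocycles, so `d y = d (y - approximant)` lies in every `F^p`.
    have hyd : X.d y = 0 := by
      refine hF _ fun p => ?_
      have h1 := hy p
      have h2 : ∀ q, X.d (y - ((z q : A) - X.d (W q))) = X.d y := by
        intro q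
        rw [map_sub, map_sub, LinearMap.mem_ker.1 (z q).2.2, X.d_sq _ _ (hW q)]
        simp
      have h3 : ∀ q, y - ((z q : A) - X.d (W q)) ∈ X.C k := fun q =>
        sub_mem hyC (sub_mem (z q).2.1 (hdw _ (hW q)).1)
      split_ifs at h1
      · rw [← h2 p]
        exact X.d_F _ _ _ (h3 p) h1
      · rw [← h2 0]
        exact X.d_F _ _ _ (h3 0) h1
    refine ⟨SubQuot.mk _ ⟨y, hyC, LinearMap.mem_ker.2 hyd⟩, fun p => ?_⟩
    rw [← hz, ← map_sub]
    by_cases hp : 0 ≤ p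
    · refine (X.mem_FH _).2 ⟨-W p, neg_mem (hW p), ?_⟩
      have h1 := hy p
      rw [if_pos hp] at h1
      convert h1 using 1
      simp only [AddSubgroupClass.coe_sub, map_neg]
      abel
    · refine (X.mem_FH _).2 ⟨0, zero_mem _, ?_⟩
      refine X.F_anti (by omega : p ≤ 0) (h0 k ?_)
      simpa using sub_mem hyC (z p).2.1
  gr p k := by
    -- Both graded pieces are quotients of the cocycles in `F^p`; it suffices that the two
    -- surjections have the same kernel.
    let Zc := cocycles X.C X.d k ⊓ X.F p
    have hFH : ∀ z : Zc, SubQuot.mk (coboundaries X.C X.d k) ⟨z.1, z.2.1⟩ ∈ X.FH p k := fun z =>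
      ⟨⟨z.1, z.2.1⟩, z.2.2, rfl⟩
    let f : Zc →ₗ[K] X.FH p k := LinearMap.codRestrict _
      ((Submodule.mkQ _) ∘ₗ Submodule.inclusion (inf_le_left : Zc ≤ cocycles X.C X.d k)) hFH
    let F : Zc →ₗ[K] SubQuot (X.FH p k) (X.FH (p + 1) k) := Submodule.mkQ _ ∘ₗ f
    have hZ : ∀ z : Zc, z.1 ∈ X.ZInf p k := fun z =>
      (X.mem_ZInf_iff hclosed).2 ⟨z, z.2, 0, zero_mem _, add_zero _⟩
    let G : Zc →ₗ[K] X.EInf p k := Submodule.mkQ _ ∘ₗ LinearMap.codRestrict _ Zc.subtype hZ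
    have hFs : Function.Surjective F := by
      intro q
      obtain ⟨⟨q, y, hy, rfl⟩, rfl⟩ := SubQuot.mk_surjective _ q
      exact ⟨⟨y.1, y.2, hy⟩, rfl⟩
    have hGs : Function.Surjective G := by
      intro q
      obtain ⟨⟨x, hx⟩, rfl⟩ := SubQuot.mk_surjective _ q
      obtain ⟨z, hz, y, hy, h⟩ := (X.mem_ZInf_iff hclosed).1 hx
      refine ⟨⟨z, hz⟩, (sub_eq_zero.1 ?_).symm⟩
      refine (SubQuot.mk_eq_zero ((⟨x, hx⟩ : X.ZInf p k) - ⟨z, hZ ⟨z, hz⟩⟩)).2 ?_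
      refine Submodule.mem_sup_right ?_
      simpa [← h] using hy
    have hker : LinearMap.ker F = LinearMap.ker G := by
      ext z
      rw [LinearMap.mem_ker, LinearMap.mem_ker]
      have h1 : F z = 0 ↔ SubQuot.mk (coboundaries X.C X.d k) ⟨z.1, z.2.1⟩ ∈ X.FH (p + 1) k :=
        SubQuot.mk_eq_zero (f z)
      have h2 : G z = 0 ↔ z.1 ∈ X.BInf p k := SubQuot.mk_eq_zero (Z := X.ZInf p k) ⟨z.1, hZ z⟩
      rw [h1, h2, X.mem_BInf_iff h0, X.mem_FH]
      refine exists_congr fun w => and_congr_right fun hw => ?_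
      constructor
      · intro h
        refine ⟨?_, sub_mem z.2.1.1 ?_, h⟩
        · have := sub_mem z.2.2 (X.F_anti (by omega : p ≤ p + 1) h)
          simpa using this
        · simpa using X.d_mem _ _ hw
      · exact fun h => h.2.2
    exact ⟨(F.quotKerEquivOfSurjective hFs).symm ≪≫ₗ Submodule.quotEquivOfEq _ _ hker ≪≫ₗ
      G.quotKerEquivOfSurjective hGs⟩

omit h0 hF hcomp hclosed

theorem subsingleton_EInf (h : X.ConvergesTo X.H X.FH) (k : ℤ) (hk : Subsingleton (X.H k))
    (p : ℤ) : Subsingleton (X.EInf p k) := by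
  obtain ⟨e⟩ := h.gr p k
  have : Subsingleton (SubQuot (X.FH p k) (X.FH (p + 1) k)) :=
    (SubQuot.mk_surjective _).subsingleton
  exact e.symm.injective.subsingleton

theorem convergesToZero (h : X.ConvergesTo X.H X.FH) (hk : ∀ k, Subsingleton (X.H k)) :
    X.ConvergesToZero where
  anti _ _ := le_rfl
  exhaustive _ _ := ⟨0, trivial⟩
  hausdorff _ _ _ := rfl
  complete _ _ _ := ⟨0, fun _ => trivial⟩
  gr p k := by
    have h1 := X.subsingleton_EInf h k (hk k) p
    have h2 : Subsingleton (SubQuot (⊤ : Submodule K PUnit.{1}) ⊤) :=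
      (SubQuot.mk_surjective _).subsingleton
    exact ⟨0, 0, fun _ => Subsingleton.elim _ _, fun _ => Subsingleton.elim _ _⟩

end Convergence

end FilteredComplex

end FilteredComplexes

/-! ### Solvability of infinite linear systems -/

section LinearCompactness

open Finsupp

variable {K α β : Type*} [Field K]

/-- Linear compactness: a system of linear equations in a subspace cut out by finitely supported
functionals, each equation involving finitely many unknowns, is solvable if all of its finite
subsystems are. -/
theorem exists_solution_of_finite (W : Submodule K (α → K))
    (hW : ∀ w : α → K, (∀ f : α →₀ K, (∀ w' ∈ W, linearCombination K w' f = 0) →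
      linearCombination K w f = 0) → w ∈ W)
    (D : β → α →₀ K) (x : β → K)
    (h : ∀ T : Finset β, ∃ w ∈ W, ∀ b ∈ T, linearCombination K w (D b) = x b) :
    ∃ w ∈ W, ∀ b, linearCombination K w (D b) = x b := by
  -- `N` is the space of relations satisfied by `W`; by `hW`, the functionals on its quotient are
  -- elements of `W`.
  let N : Submodule K (α →₀ K) := ⨅ w : W, LinearMap.ker (linearCombination K (w : α → K))
  have hN : ∀ f, f ∈ N ↔ ∀ w ∈ W, linearCombination K w f = 0 := by
    intro f
    simp [N, Submodule.mem_iInf]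
  let D' : (β →₀ K) →ₗ[K] (α →₀ K) ⧸ N := N.mkQ ∘ₗ linearCombination K D
  -- The right-hand side respects every linear dependency among the equations: a dependency involves
  -- finitely many of them, and these have a common solution in `W`.
  have hx : linearCombination K x ∈ (LinearMap.ker D').dualAnnihilator := by
    rw [Submodule.mem_dualAnnihilator]
    intro c hc
    have hc' : linearCombination K D c ∈ N := by simpa [D'] using hc
    obtain ⟨w, hw, hwx⟩ := h c.support
    have h1 := (hN _).1 hc' w hw
    rw [linearCombination_apply K (v := D), Finsupp.sum, map_sum] at h1
    rw [linearCombination_apply, Finsupp.sum, ← h1]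
    refine Finset.sum_congr rfl fun b hb => ?_
    rw [map_smul, hwx b hb]
  -- Over a field, a functional that kills the kernel of `D'` factors through `D'`; the factor `Φ`,
  -- evaluated on the basis, is the solution.
  rw [← LinearMap.range_dualMap_eq_dualAnnihilator_ker] at hx
  obtain ⟨Φ, hΦ⟩ := hx
  have key : ∀ f, linearCombination K (fun a => Φ (N.mkQ (single a 1))) f = Φ (N.mkQ f) := by
    intro f
    have : linearCombination K (fun a => Φ (N.mkQ (single a 1))) = Φ ∘ₗ N.mkQ := by
      ext a
      simp
    rw [this]
    rfl
  refine ⟨fun a => Φ (N.mkQ (single a 1)), hW _ fun f hf => ?_, fun b => ?_⟩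
  · have : N.mkQ f = 0 := by simpa using (hN f).2 hf
    rw [key, this, map_zero]
  · have h1 := LinearMap.congr_fun hΦ (single b 1)
    rw [key]
    simpa [D'] using h1

end LinearCompactness

/-! ### Signed sums over the positions of a list -/

section PickSum

variable {α β M : Type*} [AddCommGroup M]

/-- The signed sum of the values of `G` at the pairs formed by an entry of a list and the list of
the remaining entries, with the sign of moving the entry to the front. -/
def pickSum (ε : ℤˣ) : (α → List α → M) → List α → M
  | _, [] => 0
  | G, a :: l => G a l + ε • pickSum ε (fun e R => G e (a :: R)) l

/-- A function of lists that changes by the sign `ε` when two adjacent entries are exchanged. -/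
def Koszul (ε : ℤˣ) (φ : List α → M) : Prop :=
  ∀ l l' a b, φ (l ++ b :: a :: l') = ε • φ (l ++ a :: b :: l')

/-- A function of lists that changes by the sign `η` when the involution `τ` is applied to one
of the entries. -/
def FlipEq (τ : α → α) (η : ℤˣ) (φ : List α → M) : Prop :=
  ∀ l l' a, φ (l ++ τ a :: l') = η • φ (l ++ a :: l')

variable {ε η : ℤˣ} {τ : α → α}

theorem units_smul_smul_self (ε : ℤˣ) (x : M) : ε • ε • x = x := by
  rw [smul_smul, Int.units_mul_self, one_smul]

theorem Koszul.cons {φ : List α → M} (h : Koszul ε φ) (a : α) : Koszul ε fun l => φ (a :: l) :=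
  fun l l' b c => h (a :: l) l' b c

theorem Koszul.smul {φ : List α → M} (h : Koszul ε φ) (s : ℤˣ) : Koszul ε fun l => s • φ l :=
  fun l l' b c => by simp only [h l l' b c]; rw [smul_comm]

theorem Koszul.add {φ ψ : List α → M} (h : Koszul ε φ) (h' : Koszul ε ψ) :
    Koszul ε fun l => φ l + ψ l :=
  fun l l' b c => by simp only [h l l' b c, h' l l' b c, smul_add]

theorem koszul_zero : Koszul ε fun _ : List α => (0 : M) :=
  fun l l' b c => by simp

theorem Koszul.ite {φ ψ : List α → M} (p : Prop) [Decidable p] (h : Koszul ε φ)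
    (h' : Koszul ε ψ) : Koszul ε fun l => if p then φ l else ψ l := by
  by_cases hp : p <;> simpa [hp]

theorem Koszul.map {φ : List β → M} (h : Koszul ε φ) (g : α → β) :
    Koszul ε fun l => φ (l.map g) :=
  fun l l' b c => by simpa using h (l.map g) (l'.map g) (g b) (g c)

theorem Koszul.exists_perm {φ : List α → M} (h : Koszul ε φ) {l l' : List α} (p : l.Perm l') :
    ∃ s : ℤˣ, φ l' = s • φ l := by
  induction p generalizing φ with
  | nil => exact ⟨1, (one_smul _ _).symm⟩
  | cons a _ ih => exact ih (h.cons a)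
  | swap a b l => exact ⟨ε, h [] l b a⟩
  | trans _ _ ih1 ih2 =>
    obtain ⟨s, hs⟩ := ih1 h
    obtain ⟨t, ht⟩ := ih2 h
    exact ⟨t * s, by rw [ht, hs, smul_smul]⟩

/-- Reordering costs only a sign, so vanishing may be tested on a convenient order. -/
theorem Koszul.eq_zero_of_perm {φ : List α → M} (h : Koszul ε φ) {l l' : List α}
    (p : l.Perm l') (h0 : φ l' = 0) : φ l = 0 := by
  obtain ⟨s, hs⟩ := h.exists_perm p.symm
  rw [hs, h0, smul_zero]

theorem Koszul.middle {φ : List α → M} (h : Koszul ε φ) (l l' : List α) (a : α) :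
    φ (l ++ a :: l') = ε ^ l.length • φ (a :: (l ++ l')) := by
  induction l generalizing φ with
  | nil => simp
  | cons b l ih =>
    rw [List.cons_append, ih (h.cons b), List.length_cons, pow_succ, mul_smul]
    exact congrArg _ (h [] (l ++ l') a b)

/-- The permutation hypothesis keeps the link to `L`, so that facts about the whole graph are
available when a summand is rewritten. -/
theorem pickSum_congr {G G' : α → List α → M} {L : List α}
    (h : ∀ e R, (e :: R).Perm L → G e R = G' e R) : pickSum ε G L = pickSum ε G' L := by
  induction L generalizing G G' with
  | nil => rfl
  | cons a l ih =>
    rw [pickSum, pickSum, h a l (List.Perm.refl _), ih]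
    exact fun e R p => h _ _ ((List.Perm.swap _ _ _).trans (p.cons a))

theorem pickSum_zero (L : List α) : pickSum ε (fun _ _ => (0 : M)) L = 0 := by
  induction L with
  | nil => rfl
  | cons a l ih => rw [pickSum, ih, smul_zero, add_zero]

theorem pickSum_eq_zero {G : α → List α → M} {L : List α}
    (h : ∀ e R, (e :: R).Perm L → G e R = 0) : pickSum ε G L = 0 :=
  (pickSum_congr h).trans (pickSum_zero L)

theorem pickSum_add (G G' : α → List α → M) (L : List α) :
    pickSum ε (fun e R => G e R + G' e R) L = pickSum ε G L + pickSum ε G' L := by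
  induction L generalizing G G' with
  | nil => simp [pickSum]
  | cons a l ih => rw [pickSum, pickSum, pickSum, ih, smul_add]; abel

theorem pickSum_smul (s : ℤˣ) (G : α → List α → M) (L : List α) :
    pickSum ε (fun e R => s • G e R) L = s • pickSum ε G L := by
  induction L generalizing G with
  | nil => simp [pickSum]
  | cons a l ih => rw [pickSum, pickSum, ih, smul_add, smul_comm]

theorem pickSum_sum {ι : Type*} (S : Finset ι) (G : ι → α → List α → M) (L : List α) :
    pickSum ε (fun e R => ∑ i ∈ S, G i e R) L = ∑ i ∈ S, pickSum ε (G i) L := by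
  classical
  induction S using Finset.induction_on with
  | empty => simp [pickSum_zero]
  | insert i S hi ih => simp only [Finset.sum_insert hi, pickSum_add, ih]

theorem pickSum_map (g : α → β) (G : β → List β → M) (L : List α) :
    pickSum ε G (L.map g) = pickSum ε (fun e R => G (g e) (R.map g)) L := by
  induction L generalizing G with
  | nil => rfl
  | cons a l ih => rw [List.map_cons, pickSum, ih]; rfl

theorem pickSum_ite (p : Prop) [Decidable p] (G : α → List α → M) (L : List α) :
    (if p then pickSum ε G L else 0) = pickSum ε (fun e R => if p then G e R else 0) L := by
  by_cases hp : p <;> simp [hp, pickSum_zero]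

theorem pickSum_eq_sum (G : α → List α → M) (L : List α) :
    pickSum ε G L = ∑ i : Fin L.length, ε ^ (i : ℕ) • G (L.get i) (L.eraseIdx i) := by
  induction L generalizing G with
  | nil => simp [pickSum]
  | cons a l ih =>
    rw [pickSum, ih, Finset.smul_sum]
    simp only [List.length_cons]
    rw [Fin.sum_univ_succ]
    simp [pow_succ', mul_smul]

/-- When neither exchanged entry is picked, the rule for `G` gives the sign; when one of them is,
its position shifts by one, which changes the prefactor by `ε`. -/
theorem Koszul.pickSum {G : α → List α → M} (h : ∀ e, Koszul ε (G e)) :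
    Koszul ε (pickSum ε G) := by
  intro l l' a b
  induction l generalizing G with
  | nil =>
    have h1 : _root_.pickSum ε (fun e R => G e (b :: a :: R)) l' =
        ε • _root_.pickSum ε (fun e R => G e (a :: b :: R)) l' := by
      rw [← pickSum_smul]
      exact pickSum_congr fun e R _ => h e [] R a b
    simp only [List.nil_append, _root_.pickSum, h1, smul_add, units_smul_smul_self]
    abel
  | cons c l ih =>
    simp only [List.cons_append, _root_.pickSum]
    rw [h c l l' a b, ih (fun e => (h e).cons c), smul_add]

theorem FlipEq.cons {φ : List α → M} (h : FlipEq τ η φ) (a : α) :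
    FlipEq τ η fun l => φ (a :: l) :=
  fun l l' b => h (a :: l) l' b

theorem FlipEq.smul {φ : List α → M} (h : FlipEq τ η φ) (s : ℤˣ) :
    FlipEq τ η fun l => s • φ l :=
  fun l l' b => by simp only [h l l' b]; rw [smul_comm]

theorem FlipEq.add {φ ψ : List α → M} (h : FlipEq τ η φ) (h' : FlipEq τ η ψ) :
    FlipEq τ η fun l => φ l + ψ l :=
  fun l l' b => by simp only [h l l' b, h' l l' b, smul_add]

theorem flipEq_zero : FlipEq τ η fun _ : List α => (0 : M) :=
  fun l l' b => by simp

theorem FlipEq.ite {φ ψ : List α → M} (p : Prop) [Decidable p] (h : FlipEq τ η φ)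
    (h' : FlipEq τ η ψ) : FlipEq τ η fun l => if p then φ l else ψ l := by
  by_cases hp : p <;> simpa [hp]

theorem FlipEq.map {φ : List α → M} (h : FlipEq τ η φ) (g : α → α) (hg : ∀ a, g (τ a) = τ (g a)) :
    FlipEq τ η fun l => φ (l.map g) :=
  fun l l' b => by simpa [hg] using h (l.map g) (l'.map g) (g b)

/-- A signed sum changes by a sign under the flip of one entry if the summands do so. -/
theorem pickSum_flip {G : α → List α → M} {l l' : List α} {a : α}
    (h1 : ∀ R, R.Perm (l ++ l') → G (τ a) R = η • G a R)
    (h2 : ∀ e m m', (e :: (m ++ a :: m')).Perm (l ++ a :: l') →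
      G e (m ++ τ a :: m') = η • G e (m ++ a :: m')) :
    pickSum ε G (l ++ τ a :: l') = η • pickSum ε G (l ++ a :: l') := by
  induction l generalizing G with
  | nil =>
    simp only [List.nil_append, pickSum, smul_add]
    rw [h1 l' (List.Perm.refl _), smul_comm η ε, ← pickSum_smul η]
    congr 2
    exact pickSum_congr fun e R p => h2 e [] R ((List.Perm.swap _ _ _).trans (p.cons a))
  | cons c l ih =>
    simp only [List.cons_append, pickSum, smul_add]
    rw [h2 c l l' (List.Perm.refl _), smul_comm η ε]
    congr 2
    exact ih (fun R p => h1 _ (p.cons c)) fun e m m' p => h2 e (c :: m) m' <| by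
      exact (List.Perm.swap _ _ _).trans (p.cons c)

/-- The sum over ordered pairs of distinct positions of an antisymmetric function is zero. -/
theorem pickSum_pickSum_eq_zero {G : α → α → List α → M} {L : List α}
    (h : ∀ e e' R, (e :: e' :: R).Perm L → G e e' R + ε • G e' e R = 0) :
    pickSum ε (fun e R => pickSum ε (G e) R) L = 0 := by
  induction L generalizing G with
  | nil => rfl
  | cons a l ih =>
    simp only [pickSum, pickSum_add, smul_add, pickSum_smul, units_smul_smul_self]
    -- The pairs avoiding the head cancel by induction; the pairs `(a, e)` and `(e, a)` are matched
    -- directly.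
    rw [ih, add_zero, ← pickSum_smul, ← pickSum_add]
    · refine pickSum_eq_zero fun e R p => ?_
      exact h a e R (p.cons a)
    · intro e e' R p
      refine h e e' (a :: R) ?_
      refine List.Perm.trans ?_ (p.cons a)
      exact ((List.Perm.swap _ _ _).cons e).trans (List.Perm.swap _ _ _)

/-- Exchanging the order of summation in a sum over ordered pairs of distinct positions. -/
theorem pickSum_pickSum_comm (G : α → α → List α → M) (L : List α) :
    pickSum ε (fun e R => pickSum ε (G e) R) L =
      ε • pickSum ε (fun e R => pickSum ε (fun e' R => G e' e R) R) L := by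
  -- The difference `G e e' - ε G e' e` is antisymmetric by construction, so no division by two is
  -- needed.
  have h := pickSum_pickSum_eq_zero (ε := ε) (L := L)
    (G := fun e e' R => G e e' R - ε • G e' e R) (fun e e' R _ => by
      simp only [smul_sub, units_smul_smul_self]; abel)
  have h2 : ∀ (F F' : α → List α → M) (L : List α),
      pickSum ε (fun e R => F e R - F' e R) L = pickSum ε F L - pickSum ε F' L := by
    intro F F' L
    rw [eq_sub_iff_add_eq, ← pickSum_add]
    simp
  simp only [h2, pickSum_smul] at h
  exact sub_eq_zero.1 h

end PickSum

/-! ### Valences and connectedness -/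

namespace LGraph

/-- The valence of a vertex in a list of edges. -/
def val (L : List (ℕ × ℕ)) (v : ℕ) : ℕ := (L.map Prod.fst).count v + (L.map Prod.snd).count v

theorem valence_eq (Γ : LGraph) (v : ℕ) : Γ.valence v = val Γ.edges v := rfl

/-- The degree of a vertex in a list of edges. -/
def hdeg (m n : ℤ) (L : List (ℕ × ℕ)) (v : ℕ) : ℤ := if val L v = 1 then m else n

theorem vdeg_eq (m n : ℤ) (Γ : LGraph) (v : ℕ) : Γ.vdeg m n v = hdeg m n Γ.edges v := rfl

theorem hdeg_congr {m n : ℤ} {L L' : List (ℕ × ℕ)} {v w : ℕ} (h : val L v = val L' w) :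
    hdeg m n L v = hdeg m n L' w := by
  rw [hdeg, hdeg, h]

@[simp] theorem val_nil (v : ℕ) : val [] v = 0 := rfl

theorem val_cons (e : ℕ × ℕ) (L : List (ℕ × ℕ)) (v : ℕ) :
    val (e :: L) v = val L v + (if e.1 = v then 1 else 0) + (if e.2 = v then 1 else 0) := by
  simp only [val, List.map_cons, List.count_cons, beq_iff_eq]
  omega

theorem val_perm {L L' : List (ℕ × ℕ)} (h : L.Perm L') (v : ℕ) : val L v = val L' v := by
  rw [val, val, (h.map _).count_eq, (h.map _).count_eq]

theorem hdeg_perm {m n : ℤ} {L L' : List (ℕ × ℕ)} (h : L.Perm L') : hdeg m n L = hdeg m n L' :=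
  funext fun v => hdeg_congr (val_perm h v)

theorem val_swap (l l' : List (ℕ × ℕ)) (e : ℕ × ℕ) (v : ℕ) :
    val (l ++ e.swap :: l') v = val (l ++ e :: l') v := by
  have h : ∀ e : ℕ × ℕ, val (l ++ e :: l') v = val (e :: (l ++ l')) v := fun e =>
    val_perm List.perm_middle v
  rw [h, h, val_cons, val_cons]
  simp only [Prod.fst_swap, Prod.snd_swap]
  omega

theorem val_relabel (σ : Equiv.Perm ℕ) (L : List (ℕ × ℕ)) (v : ℕ) :
    val (L.map (Prod.map σ σ)) (σ v) = val L v := by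
  induction L with
  | nil => rfl
  | cons e L ih => simp [val_cons, ih]

theorem val_eq_zero {L : List (ℕ × ℕ)} {v : ℕ} : val L v = 0 ↔ ∀ e ∈ L, e.1 ≠ v ∧ e.2 ≠ v := by
  induction L with
  | nil => simp
  | cons e L ih =>
    rw [val_cons, List.forall_mem_cons, ← ih]
    split_ifs <;> simp_all

/-- The map that renames `b` to `a`. -/
def merge (a b x : ℕ) : ℕ := if x = b then a else x

theorem merge_self (a b : ℕ) : merge a b b = a := by simp [merge]

theorem merge_of_ne {a b x : ℕ} (h : x ≠ b) : merge a b x = x := by simp [merge, h]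

/-- The edges after the contraction of an edge from `a` to `b`. -/
abbrev mergeE (a b : ℕ) : ℕ × ℕ → ℕ × ℕ := Prod.map (merge a b) (merge a b)

theorem val_mergeE {a b : ℕ} (hab : a ≠ b) (L : List (ℕ × ℕ)) (v : ℕ) :
    val (L.map (mergeE a b)) v =
      if v = b then 0 else if v = a then val L a + val L b else val L v := by
  induction L with
  | nil => simp
  | cons e L ih =>
    rw [List.map_cons, val_cons, ih]
    simp only [Prod.map_fst, Prod.map_snd, merge, val_cons]
    split_ifs <;> omega

theorem mergeE_of_val_eq_zero {a b : ℕ} {L : List (ℕ × ℕ)} (h : val L b = 0) :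
    L.map (mergeE a b) = L := by
  conv_rhs => rw [← List.map_id L]
  refine List.map_congr_left fun e he => ?_
  have := val_eq_zero.1 h e he
  exact Prod.ext (merge_of_ne this.1) (merge_of_ne this.2)

/-- Being connected by a list of edges. -/
def Conn (L : List (ℕ × ℕ)) : ℕ → ℕ → Prop := Relation.EqvGen fun x y => (x, y) ∈ L

theorem Conn.of_mem {L : List (ℕ × ℕ)} {e : ℕ × ℕ} (h : e ∈ L) : Conn L e.1 e.2 :=
  Relation.EqvGen.rel _ _ h

theorem Conn.refl {L : List (ℕ × ℕ)} (a : ℕ) : Conn L a a := Relation.EqvGen.refl _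

theorem Conn.symm {L : List (ℕ × ℕ)} {a b : ℕ} (h : Conn L a b) : Conn L b a :=
  Relation.EqvGen.symm _ _ h

theorem Conn.trans {L : List (ℕ × ℕ)} {a b c : ℕ} (h : Conn L a b) (h' : Conn L b c) :
    Conn L a c :=
  Relation.EqvGen.trans _ _ _ h h'

theorem Conn.map {L L' : List (ℕ × ℕ)} {g : ℕ → ℕ} (hg : ∀ e ∈ L, Conn L' (g e.1) (g e.2))
    {a b : ℕ} (h : Conn L a b) : Conn L' (g a) (g b) := by
  induction h with
  | rel x y h => exact hg (x, y) h
  | refl x => exact Conn.refl _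
  | symm x y _ ih => exact ih.symm
  | trans x y z _ _ ih1 ih2 => exact ih1.trans ih2

theorem Conn.mem_iff {L : List (ℕ × ℕ)} {S : Set ℕ} (hS : ∀ e ∈ L, e.1 ∈ S ↔ e.2 ∈ S)
    {a b : ℕ} (h : Conn L a b) : a ∈ S ↔ b ∈ S := by
  induction h with
  | rel x y h => exact hS (x, y) h
  | refl x => exact Iff.rfl
  | symm x y _ ih => exact ih.symm
  | trans x y z _ _ ih1 ih2 => exact ih1.trans ih2

namespace IsHairy

variable {Γ : LGraph} {vs vs' : List ℕ} {L L' : List (ℕ × ℕ)}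

theorem edges_perm (h : IsHairy ⟨vs, L⟩) (p : L.Perm L') : IsHairy ⟨vs, L'⟩ where
  nodup := h.nodup
  mem e he := h.mem e (p.mem_iff.2 he)
  connected a ha b hb :=
    Conn.map (g := id) (fun _ he => Conn.of_mem (p.mem_iff.1 he)) (h.connected a ha b hb)
  no_bivalent v hv := by
    have := h.no_bivalent v hv
    rwa [valence_eq, val_perm p] at this
  exists_hair := by
    obtain ⟨v, hv, h1⟩ := h.exists_hair
    rw [valence_eq, val_perm p] at h1
    exact ⟨v, hv, h1⟩

theorem verts_perm (h : IsHairy ⟨vs, L⟩) (p : vs.Perm vs') : IsHairy ⟨vs', L⟩ where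
  nodup := p.nodup_iff.1 h.nodup
  mem e he := ⟨p.mem_iff.1 (h.mem e he).1, p.mem_iff.1 (h.mem e he).2⟩
  connected a ha b hb := h.connected a (p.mem_iff.2 ha) b (p.mem_iff.2 hb)
  no_bivalent v hv := h.no_bivalent v (p.mem_iff.2 hv)
  exists_hair := by
    obtain ⟨v, hv, h1⟩ := h.exists_hair
    exact ⟨v, p.mem_iff.1 hv, h1⟩

theorem flip {l l' : List (ℕ × ℕ)} {e : ℕ × ℕ} (h : IsHairy ⟨vs, l ++ e :: l'⟩) :
    IsHairy ⟨vs, l ++ e.swap :: l'⟩ where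
  nodup := h.nodup
  mem f hf := by
    have h1 := h.mem
    simp only [List.mem_append, List.mem_cons] at h1 hf
    rcases hf with hf | rfl | hf
    · exact h1 f (Or.inl hf)
    · exact (h1 e (Or.inr (Or.inl rfl))).symm
    · exact h1 f (Or.inr (Or.inr hf))
  connected a ha b hb := by
    refine Conn.map (g := id) (fun f hf => ?_) (h.connected a ha b hb)
    simp only [List.mem_append, List.mem_cons] at hf
    rcases hf with hf | rfl | hf
    · exact Conn.of_mem (by simp [hf])
    · exact (Conn.of_mem (e := f.swap) (by simp)).symm
    · exact Conn.of_mem (by simp [hf])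
  no_bivalent v hv := by
    have := h.no_bivalent v hv
    rwa [valence_eq, ← val_swap] at this
  exists_hair := by
    obtain ⟨v, hv, h1⟩ := h.exists_hair
    rw [valence_eq, ← val_swap] at h1
    exact ⟨v, hv, h1⟩

theorem relabel (σ : Equiv.Perm ℕ) (h : IsHairy ⟨vs, L⟩) :
    IsHairy ⟨vs.map σ, L.map (Prod.map σ σ)⟩ where
  nodup := h.nodup.map σ.injective
  mem f hf := by
    obtain ⟨e, he, rfl⟩ := List.mem_map.1 hf
    exact ⟨List.mem_map_of_mem (h.mem e he).1, List.mem_map_of_mem (h.mem e he).2⟩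
  connected a ha b hb := by
    obtain ⟨a', ha', rfl⟩ := List.mem_map.1 ha
    obtain ⟨b', hb', rfl⟩ := List.mem_map.1 hb
    exact Conn.map (g := σ)
      (fun e he => Conn.of_mem (e := Prod.map σ σ e) (List.mem_map_of_mem he))
      (h.connected a' ha' b' hb')
  no_bivalent v hv := by
    obtain ⟨w, hw, rfl⟩ := List.mem_map.1 hv
    rw [valence_eq, val_relabel]
    exact h.no_bivalent w hw
  exists_hair := by
    obtain ⟨v, hv, h1⟩ := h.exists_hair
    exact ⟨σ v, List.mem_map_of_mem hv, by rw [valence_eq, val_relabel]; exact h1⟩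

theorem mem_of_closed (h : Γ.IsHairy) {S : Set ℕ} (hS : ∀ e ∈ Γ.edges, e.1 ∈ S ↔ e.2 ∈ S)
    {a b : ℕ} (ha : a ∈ Γ.verts) (haS : a ∈ S) (hb : b ∈ Γ.verts) : b ∈ S :=
  (Conn.mem_iff hS (h.connected a ha b hb)).1 haS

/-- By connectedness an isolated vertex would be the only one, leaving no room for a hair. -/
theorem val_ne_zero (h : IsHairy ⟨vs, L⟩) {v : ℕ} (hv : v ∈ vs) : val L v ≠ 0 := by
  intro h0
  obtain ⟨w, hw, h1⟩ := h.exists_hair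
  have : w ∈ ({v} : Set ℕ) := h.mem_of_closed (S := {v}) (fun e he => by
    have := val_eq_zero.1 h0 e he
    simp [this.1, this.2]) hv rfl hw
  rw [Set.mem_singleton_iff] at this
  rw [valence_eq, this] at h1
  exact absurd (h0.symm.trans h1) (by simp)

theorem three_le_val (h : IsHairy ⟨vs, L⟩) {v : ℕ} (hv : v ∈ vs) (h1 : val L v ≠ 1) :
    3 ≤ val L v := by
  have h2 := h.val_ne_zero hv
  have h3 : val L v ≠ 2 := h.no_bivalent v hv
  omega

end IsHairy

/-! ### Lists of vertices -/

theorem exists_append_of_mem {α : Type*} {l : List α} (hl : l.Nodup) {a : α} (ha : a ∈ l) :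
    ∃ l₁ l₂, l = l₁ ++ a :: l₂ ∧ a ∉ l₁ ∧ a ∉ l₂ := by
  obtain ⟨l₁, l₂, rfl⟩ := List.append_of_mem ha
  refine ⟨l₁, l₂, rfl, ?_⟩
  rw [List.nodup_middle, List.nodup_cons, List.mem_append, not_or] at hl
  exact hl.1

theorem exists_append_append_of_mem {α : Type*} {l : List α} (hl : l.Nodup) {a b : α} (ha : a ∈ l)
    (hb : b ∈ l) (hab : a ≠ b) :
    ∃ l₁ l₂ l₃, (a ∉ l₁ ∧ a ∉ l₂ ∧ a ∉ l₃) ∧ (b ∉ l₁ ∧ b ∉ l₂ ∧ b ∉ l₃) ∧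
      (l = l₁ ++ a :: (l₂ ++ b :: l₃) ∨ l = l₁ ++ b :: (l₂ ++ a :: l₃)) := by
  obtain ⟨l₁, l₂, rfl, h1, h2⟩ := exists_append_of_mem hl ha
  rw [List.nodup_append] at hl
  rcases List.mem_append.1 hb with hb | hb
  · obtain ⟨k₁, k₂, rfl, h3, h4⟩ := exists_append_of_mem hl.1 hb
    refine ⟨k₁, k₂, l₂, ?_, ⟨h3, h4, fun h => ?_⟩, Or.inr (by simp)⟩
    · simp only [List.mem_append, List.mem_cons, not_or] at h1
      exact ⟨h1.1, h1.2.2, h2⟩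
    · exact hl.2.2 b (by simp) b (by simp [h]) rfl
  · have hb' : b ∈ l₂ := by
      rcases List.mem_cons.1 hb with h | h
      · exact absurd h.symm hab
      · exact h
    obtain ⟨k₁, k₂, rfl, h3, h4⟩ := exists_append_of_mem (List.nodup_cons.1 hl.2.1).2 hb'
    refine ⟨l₁, k₁, k₂, ?_, ⟨fun h => ?_, h3, h4⟩, Or.inl rfl⟩
    · simp only [List.mem_append, List.mem_cons, not_or] at h2
      exact ⟨h1, h2.1, h2.2.2⟩
    · exact hl.2.2 b h b (by simp) rfl

theorem map_swap_of_not_mem {l : List ℕ} {a b : ℕ} (ha : a ∉ l) (hb : b ∉ l) :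
    l.map (Equiv.swap a b) = l := by
  conv_rhs => rw [← List.map_id l]
  exact List.map_congr_left fun x hx =>
    Equiv.swap_apply_of_ne_of_ne (ne_of_mem_of_not_mem hx ha) (ne_of_mem_of_not_mem hx hb)

theorem mapE_swap_of_val {L : List (ℕ × ℕ)} {a b : ℕ} (ha : val L a = 0) (hb : val L b = 0) :
    L.map (Prod.map (Equiv.swap a b) (Equiv.swap a b)) = L := by
  conv_rhs => rw [← List.map_id L]
  refine List.map_congr_left fun e he => ?_
  have h1 := val_eq_zero.1 ha e he
  have h2 := val_eq_zero.1 hb e he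
  exact Prod.ext (Equiv.swap_apply_of_ne_of_ne h1.1 h2.1)
    (Equiv.swap_apply_of_ne_of_ne h1.2 h2.2)

theorem takeWhile_ne_append {b : ℕ} {l₁ : List ℕ} (h : b ∉ l₁) (l₂ : List ℕ) :
    (l₁ ++ b :: l₂).takeWhile (fun v => v ≠ b) = l₁ := by
  induction l₁ with
  | nil => simp
  | cons c l ih =>
    rw [List.mem_cons, not_or] at h
    rw [List.cons_append, List.takeWhile_cons_of_pos (by simpa using Ne.symm h.1), ih h.2]

theorem erase_append_middle {b : ℕ} {l₁ : List ℕ} (h : b ∉ l₁) (l₂ : List ℕ) :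
    (l₁ ++ b :: l₂).erase b = l₁ ++ l₂ := by
  rw [List.erase_append_right _ h, List.erase_cons_head]

end LGraph

open LGraph

/-! ### Coefficients of hairy graphs -/

section Coefficients

variable {K : Type*} [Field K] {m n : ℤ} {x : LGraph → K}

/-- The sign of exchanging two edges. -/
abbrev edgeSign (n : ℤ) : ℤˣ := ((1 - n) * (1 - n)).negOnePow

/-- The integers `(1 - n)^2` and `n` have opposite parity. This is the sign behind most of the
cancellations below. -/
theorem edgeSign_mul_negOnePow (n : ℤ) : edgeSign n * n.negOnePow = -1 := by
  rw [edgeSign, ← Int.negOnePow_add, Int.negOnePow_eq_neg_one_iff]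
  rw [Int.odd_add, Int.odd_mul, Int.odd_sub]
  simp [parity_simps]

theorem coeff_eq_zero (hx : x ∈ hairyGraphs K m n) {Γ : LGraph} (h : ¬ Γ.IsHairy) : x Γ = 0 :=
  hx.1 Γ h

theorem coeff_relabel (hx : x ∈ hairyGraphs K m n) (σ : Equiv.Perm ℕ) (vs : List ℕ)
    (L : List (ℕ × ℕ)) : x ⟨vs.map σ, L.map (Prod.map σ σ)⟩ = x ⟨vs, L⟩ :=
  hx.2.1 σ ⟨vs, L⟩

theorem coeff_koszul (hx : x ∈ hairyGraphs K m n) (vs : List ℕ) :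
    Koszul (edgeSign n) fun L => x ⟨vs, L⟩ :=
  fun l l' a b => hx.2.2.2.1 vs l l' a b

theorem coeff_flip (hx : x ∈ hairyGraphs K m n) (vs : List ℕ) :
    FlipEq Prod.swap n.negOnePow fun L => x ⟨vs, L⟩ :=
  fun l l' e => hx.2.2.2.2 vs l l' e.1 e.2

theorem coeff_flip_head (hx : x ∈ hairyGraphs K m n) (vs : List ℕ) (a b : ℕ) (L : List (ℕ × ℕ)) :
    x ⟨vs, (b, a) :: L⟩ = n.negOnePow • x ⟨vs, (a, b) :: L⟩ :=
  coeff_flip hx vs [] L (a, b)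

theorem coeff_swap_head (hx : x ∈ hairyGraphs K m n) (vs : List ℕ) (e e' : ℕ × ℕ)
    (L : List (ℕ × ℕ)) : x ⟨vs, e' :: e :: L⟩ = edgeSign n • x ⟨vs, e :: e' :: L⟩ :=
  coeff_koszul hx vs [] L e e'

/-- The degrees are supplied by a table `d`, so that those of an original graph can be used for a
contracted one. -/
theorem coeff_move (hx : x ∈ hairyGraphs K m n) {d : ℕ → ℤ} {L : List (ℕ × ℕ)} {a : ℕ}
    {l₂ : List ℕ} (ha : hdeg m n L a = d a) (hd : ∀ v ∈ l₂, hdeg m n L v = d v)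
    (l₁ l₃ : List ℕ) :
    x ⟨l₁ ++ (l₂ ++ a :: l₃), L⟩ =
      (d a * (l₂.map d).sum).negOnePow • x ⟨l₁ ++ a :: (l₂ ++ l₃), L⟩ := by
  induction l₂ generalizing l₁ with
  | nil => simp
  | cons c l₂ ih =>
    have h1 := ih (fun v hv => hd v (List.mem_cons_of_mem _ hv)) (l₁ ++ [c])
    have h2 := hx.2.2.1 l₁ (l₂ ++ l₃) a c L
    rw [vdeg_eq, vdeg_eq] at h2
    change _ = (hdeg m n L a * hdeg m n L c).negOnePow • _ at h2
    rw [ha, hd c List.mem_cons_self] at h2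
    simp only [List.append_assoc, List.cons_append, List.nil_append] at h1 ⊢
    rw [h1, h2, smul_smul, ← Int.negOnePow_add, List.map_cons, List.sum_cons, mul_add, add_comm]

theorem coeff_fresh (hx : x ∈ hairyGraphs K m n) {u w : ℕ} {vs : List ℕ} {L : List (ℕ × ℕ)}
    (hu : u ∉ vs) (hw : w ∉ vs) (hLu : val L u = 0) (hLw : val L w = 0) {a : ℕ}
    (hau : a ≠ u) (haw : a ≠ w) :
    x ⟨u :: vs, (a, u) :: L⟩ = x ⟨w :: vs, (a, w) :: L⟩ ∧
      x ⟨u :: vs, (u, a) :: L⟩ = x ⟨w :: vs, (w, a) :: L⟩ := by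
  constructor <;>
  · rw [← coeff_relabel hx (Equiv.swap u w)]
    simp only [List.map_cons, Prod.map_apply, Equiv.swap_apply_left, map_swap_of_not_mem hu hw,
      mapE_swap_of_val hLu hLw, Equiv.swap_apply_of_ne_of_ne hau haw]

end Coefficients

/-! ### Contractions -/

namespace LGraph

/-- The edge `e` is contractible in a graph with edges `L`. -/
abbrev Contr (L : List (ℕ × ℕ)) (e : ℕ × ℕ) : Prop := e.1 ≠ e.2 ∧ val L e.1 ≠ 1 ∧ val L e.2 ≠ 1

/-- The sign of moving an edge from the front of the edges and then the vertex `b` to the front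
of the vertices `vs` of degrees `d`. -/
def conSign (n : ℤ) (d : ℕ → ℤ) (vs : List ℕ) (b : ℕ) : ℤˣ :=
  ((1 - n) * (vs.map d).sum + n * ((vs.takeWhile (fun v => v ≠ b)).map d).sum).negOnePow

theorem conSign_append {n : ℤ} {d : ℕ → ℤ} {l₁ : List ℕ} {b : ℕ} (h : b ∉ l₁) (l₂ : List ℕ) :
    conSign n d (l₁ ++ b :: l₂) b =
      ((1 - n) * ((l₁.map d).sum + (d b + (l₂.map d).sum)) + n * (l₁.map d).sum).negOnePow := by
  rw [conSign, takeWhile_ne_append h]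
  simp

theorem conSign_congr {n : ℤ} {d d' : ℕ → ℤ} {vs : List ℕ} (h : ∀ v ∈ vs, d v = d' v) (b : ℕ) :
    conSign n d vs b = conSign n d' vs b := by
  rw [conSign, conSign, List.map_congr_left h, List.map_congr_left fun v hv =>
    h v (List.takeWhile_subset _ hv)]

/-- The edge passes `u` with exponent `(1 - n) d(u)` and the vertex `b` passes it with exponent `n
d(u)`; the sum is `d(u)`, which is odd. -/
theorem conSign_cons {n : ℤ} {d : ℕ → ℤ} {vs : List ℕ} {u b : ℕ} (hu : u ≠ b) (hd : Odd (d u)) :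
    conSign n d (u :: vs) b = -conSign n d vs b := by
  have h : List.takeWhile (fun v => v ≠ b) (u :: vs) =
      u :: List.takeWhile (fun v => v ≠ b) vs :=
    List.takeWhile_cons_of_pos (by simpa using hu)
  rw [conSign, conSign, h, List.map_cons, List.map_cons, List.sum_cons, List.sum_cons,
    ← Int.negOnePow_succ, Int.negOnePow_eq_iff]
  obtain ⟨k, hk⟩ := hd
  exact ⟨k, by rw [hk]; ring⟩

/-- The coefficient of the contraction of an edge `e`, `M` being the other edges. -/
def con {K : Type*} [Field K] (n : ℤ) (x : LGraph → K) (d : ℕ → ℤ) (vs : List ℕ) (e : ℕ × ℕ)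
    (M : List (ℕ × ℕ)) : K :=
  conSign n d vs e.2 • x ⟨vs.erase e.2, M.map (mergeE e.1 e.2)⟩

end LGraph

/-! ### The differentials as signed sums over edges -/

section Formulas

variable {K : Type*} [Field K] {m n : ℤ} {x : LGraph → K}

-- The part of `contractSign` that depends on the position `i` is `edgeSign n ^ i`, the weight in
-- `pickSum`; the rest is `conSign`.
open Classical in
theorem splitDiff_apply (x : LGraph → K) {vs : List ℕ} {L : List (ℕ × ℕ)}
    (h : IsHairy ⟨vs, L⟩) :
    splitDiff K m n x ⟨vs, L⟩ = pickSum (edgeSign n)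
      (fun e R => if Contr L e then con n x (hdeg m n L) vs e R else 0) L := by
  rw [pickSum_eq_sum]
  change (if IsHairy ⟨vs, L⟩ then _ else _) = _
  rw [if_pos h]
  refine Finset.sum_congr rfl fun i _ => ?_
  rw [smul_ite, smul_zero]
  refine if_congr Iff.rfl ?_ rfl
  rw [con, smul_smul]
  congr 1
  rw [contractSign, conSign, edgeSign]
  have : ∀ (a : ℤ) (k : ℕ), a.negOnePow ^ k = (a * k).negOnePow := by
    intro a k
    induction k with
    | zero => simp
    | succ k ih => rw [pow_succ, ih, ← Int.negOnePow_add]; congr 1; push_cast; ring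
  rw [this, ← Int.negOnePow_add]
  congr 1
  have hv : vdeg m n ⟨vs, L⟩ = hdeg m n L := rfl
  simp only [vdegs, hv, List.get_eq_getElem]
  ring

-- The definition of `Δ` leaves the new hair at the position of the old edge; the weight in
-- `pickSum` arises by moving it to the front.
open Classical in
theorem hairDiff_apply (hx : x ∈ hairyGraphs K m n) {vs : List ℕ} {L : List (ℕ × ℕ)} {u : ℕ}
    (h : IsHairy ⟨vs, L⟩) (hu : u = fresh ⟨vs, L⟩) :
    hairDiff K x ⟨vs, L⟩ = pickSum (edgeSign n)
      (fun e R => if e.1 ≠ e.2 then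
        x ⟨u :: vs, (e.1, u) :: R⟩ + x ⟨u :: vs, (u, e.2) :: R⟩ else 0) L := by
  subst hu
  rw [pickSum_eq_sum]
  change (if IsHairy ⟨vs, L⟩ then _ else _) = _
  rw [if_pos h]
  refine Finset.sum_congr rfl fun i _ => ?_
  rw [smul_ite, smul_zero]
  refine if_congr Iff.rfl ?_ rfl
  have key : ∀ (ws : List ℕ) (e : ℕ × ℕ),
      x ⟨ws, L.set i e⟩ = edgeSign n ^ (i : ℕ) • x ⟨ws, e :: L.eraseIdx i⟩ := by
    intro ws e
    rw [List.set_eq_take_append_cons_drop, if_pos i.2, List.eraseIdx_eq_take_drop_succ,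
      (coeff_koszul hx ws).middle, List.length_take, min_eq_left i.2.le]
  rw [smul_add, ← key, ← key]
  rfl

end Formulas

/-! ### Contractions preserve hairy graphs -/

open LGraph

namespace LGraph

theorem contr_congr {L L' : List (ℕ × ℕ)} (h : val L = val L') (e : ℕ × ℕ) :
    Contr L e = Contr L' e := by
  rw [Contr, Contr, h]

theorem contr_perm {L L' : List (ℕ × ℕ)} (p : L.Perm L') : Contr L = Contr L' :=
  funext (contr_congr (funext (val_perm p)))

theorem contr_swap {L : List (ℕ × ℕ)} {e : ℕ × ℕ} : Contr L e.swap ↔ Contr L e := by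
  simp only [Contr, Prod.fst_swap, Prod.snd_swap]
  tauto

theorem negOnePow_congr {a b : ℤ} (h : Even a ↔ Even b) : a.negOnePow = b.negOnePow := by
  rw [Int.negOnePow_eq_iff, Int.even_sub]
  exact h

variable {m n : ℤ} {vs : List ℕ} {e : ℕ × ℕ} {R : List (ℕ × ℕ)}

theorem IsHairy.two_le_val (h : IsHairy ⟨vs, e :: R⟩) (hc : Contr (e :: R) e) :
    2 ≤ val R e.1 ∧ 2 ≤ val R e.2 := by
  have h1 := h.three_le_val (h.mem e List.mem_cons_self).1 hc.2.1
  have h2 := h.three_le_val (h.mem e List.mem_cons_self).2 hc.2.2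
  rw [val_cons] at h1 h2
  rw [if_pos rfl, if_neg hc.1.symm] at h1
  rw [if_neg hc.1, if_pos rfl] at h2
  omega

/-- Both ends have valence at least three, so the merged vertex has valence at least `3 + 3 - 2 =
4`. Hence contraction neither creates nor destroys hairs and creates no bivalent vertex. -/
theorem IsHairy.val_contr (h : IsHairy ⟨vs, e :: R⟩) (hc : Contr (e :: R) e) {v : ℕ}
    (hv : v ≠ e.2) :
    val (R.map (mergeE e.1 e.2)) v = val (e :: R) v ∨
      v = e.1 ∧ 4 ≤ val (R.map (mergeE e.1 e.2)) v := by
  have h1 := h.two_le_val hc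
  rw [val_mergeE hc.1, if_neg hv]
  split_ifs with hva
  · exact Or.inr ⟨hva, by omega⟩
  · left
    rw [val_cons, if_neg (Ne.symm hva), if_neg (Ne.symm hv)]
    rfl

theorem IsHairy.val_contr_ne_one_iff (h : IsHairy ⟨vs, e :: R⟩) (hc : Contr (e :: R) e) {v : ℕ}
    (hv : v ≠ e.2) : val (R.map (mergeE e.1 e.2)) v ≠ 1 ↔ val (e :: R) v ≠ 1 := by
  rcases h.val_contr hc hv with h1 | ⟨rfl, h1⟩
  · rw [h1]
  · exact iff_of_true (by omega) hc.2.1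

theorem IsHairy.hdeg_contr (h : IsHairy ⟨vs, e :: R⟩) (hc : Contr (e :: R) e) {v : ℕ}
    (hv : v ≠ e.2) : hdeg m n (R.map (mergeE e.1 e.2)) v = hdeg m n (e :: R) v := by
  rw [hdeg, hdeg]
  have := h.val_contr_ne_one_iff hc hv
  exact if_congr (not_iff_not.1 this) rfl rfl

theorem conn_merge {e : ℕ × ℕ} {L : List (ℕ × ℕ)} (h : Conn L e.1 e.2) (v : ℕ) :
    Conn L (merge e.1 e.2 v) v := by
  rw [merge]
  split_ifs with hv
  · exact hv ▸ h
  · exact Conn.refl v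

theorem IsHairy.contr (h : IsHairy ⟨vs, e :: R⟩) (hc : Contr (e :: R) e) :
    IsHairy ⟨vs.erase e.2, R.map (mergeE e.1 e.2)⟩ where
  nodup := h.nodup.erase _
  mem f hf := by
    obtain ⟨f', hf', rfl⟩ := List.mem_map.1 hf
    have h1 := h.mem f' (List.mem_cons_of_mem _ hf')
    have h2 := h.mem e List.mem_cons_self
    have key : ∀ v ∈ vs, merge e.1 e.2 v ∈ vs.erase e.2 := by
      intro v hv
      rw [List.Nodup.mem_erase_iff h.nodup, merge]
      split_ifs with hv'
      · exact ⟨hc.1, h2.1⟩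
      · exact ⟨hv', hv⟩
    exact ⟨key _ h1.1, key _ h1.2⟩
  connected a ha b hb := by
    have ha' := (List.Nodup.mem_erase_iff h.nodup).1 ha
    have hb' := (List.Nodup.mem_erase_iff h.nodup).1 hb
    have := Conn.map (L' := R.map (mergeE e.1 e.2)) (g := merge e.1 e.2) (fun f hf => ?_)
      (h.connected a ha'.2 b hb'.2)
    · rwa [merge_of_ne ha'.1, merge_of_ne hb'.1] at this
    · rcases List.mem_cons.1 hf with rfl | hf
      · rw [merge_self, merge_of_ne hc.1]
        exact Conn.refl _
      · exact Conn.of_mem (e := mergeE e.1 e.2 f) (List.mem_map_of_mem hf)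
  no_bivalent v hv := by
    have hv' := (List.Nodup.mem_erase_iff h.nodup).1 hv
    rw [valence_eq]
    rcases h.val_contr hc hv'.1 with h1 | ⟨rfl, h1⟩
    · rw [h1]
      exact h.no_bivalent v hv'.2
    · change val (R.map (mergeE e.1 e.2)) e.1 ≠ 2
      omega
  exists_hair := by
    obtain ⟨v, hv, h1⟩ := h.exists_hair
    have h1' : val (e :: R) v = 1 := h1
    have h2 : v ≠ e.2 := fun h2 => hc.2.2 (h2 ▸ h1')
    refine ⟨v, (List.Nodup.mem_erase_iff h.nodup).2 ⟨h2, hv⟩, ?_⟩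
    by_contra h3
    exact (h.val_contr_ne_one_iff hc h2).1 h3 h1'

end LGraph

/-! ### The splitting differential respects the Koszul rules -/

section Split

variable {K : Type*} [Field K] {m n : ℤ} {x : LGraph → K}

theorem con_koszul (hx : x ∈ hairyGraphs K m n) (d : ℕ → ℤ) (vs : List ℕ) (e : ℕ × ℕ) :
    Koszul (edgeSign n) (con n x d vs e) :=
  ((coeff_koszul hx (vs.erase e.2)).map (mergeE e.1 e.2)).smul _

theorem con_flipEq (hx : x ∈ hairyGraphs K m n) (d : ℕ → ℤ) (vs : List ℕ) (e : ℕ × ℕ) :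
    FlipEq Prod.swap n.negOnePow (con n x d vs e) :=
  ((coeff_flip hx (vs.erase e.2)).map (mergeE e.1 e.2) fun _ => rfl).smul _

/-- Contracting an edge in the opposite direction changes the sign by `(-1)^n`. -/
theorem con_swap (hx : x ∈ hairyGraphs K m n) {d : ℕ → ℤ} {vs : List ℕ} (hvs : vs.Nodup)
    {a b : ℕ} (ha : a ∈ vs) (hb : b ∈ vs) (hab : a ≠ b) (hda : d a = n) (hdb : d b = n)
    {M : List (ℕ × ℕ)} (hM : ∀ v ∈ vs, v ≠ b → hdeg m n (M.map (mergeE a b)) v = d v) :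
    con n x d vs (b, a) M = n.negOnePow • con n x d vs (a, b) M := by
  -- The two contractions differ by the name of the merged vertex. After renaming, that vertex
  -- stands at the place of `b` instead of `a`, and moving it back gives the sign.
  have hMM : (M.map (mergeE b a)).map (Prod.map (Equiv.swap a b) (Equiv.swap a b)) =
      M.map (mergeE a b) := by
    rw [List.map_map]
    have key : ∀ v, Equiv.swap a b (merge b a v) = merge a b v := by
      intro v
      by_cases h1 : v = a
      · subst h1; rw [merge_self, merge_of_ne hab, Equiv.swap_apply_right]
      · rw [merge_of_ne h1]
        by_cases h2 : v = b
        · subst h2; rw [merge_self, Equiv.swap_apply_right]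
        · rw [merge_of_ne h2, Equiv.swap_apply_of_ne_of_ne h1 h2]
    refine List.map_congr_left fun f _ => Prod.ext (key _) (key _)
  have h1 := coeff_relabel hx (Equiv.swap a b) (vs.erase a) (M.map (mergeE b a))
  rw [hMM] at h1
  rw [con, con, ← h1]
  obtain ⟨l₁, l₂, l₃, ⟨ha1, ha2, ha3⟩, ⟨hb1, hb2, hb3⟩, rfl | rfl⟩ :=
    exists_append_append_of_mem hvs ha hb hab
  · have e1 : (l₁ ++ a :: (l₂ ++ b :: l₃)).erase b = l₁ ++ a :: (l₂ ++ l₃) := by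
      rw [← List.cons_append, ← List.append_assoc, erase_append_middle (by simp [hb1, hb2, hab.symm])]
      simp
    have e2 := conSign_append (n := n) (d := d) (b := b) (l₁ := l₁ ++ a :: l₂)
      (by simp [hb1, hb2, hab.symm]) l₃
    simp only [List.append_assoc, List.cons_append] at e2
    have h2 := coeff_move hx (L := M.map (mergeE a b)) (hM a ha hab)
      (fun v hv => hM v (by simp [hv]) (ne_of_mem_of_not_mem hv hb2)) l₁ l₃
    rw [e1, erase_append_middle ha1, conSign_append ha1, e2]
    simp only [List.map_append, List.map_cons, map_swap_of_not_mem ha1 hb1,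
      map_swap_of_not_mem ha2 hb2, map_swap_of_not_mem ha3 hb3, Equiv.swap_apply_right, h2,
      smul_smul, ← Int.negOnePow_add, List.sum_append, List.sum_cons, hda, hdb]
    congr 1
    refine negOnePow_congr ?_
    generalize (l₁.map d).sum = s₁, (l₂.map d).sum = s₂, (l₃.map d).sum = s₃
    by_cases h0 : Even n <;> by_cases h1 : Even s₁ <;> by_cases h2 : Even s₂ <;>
      simp [Int.even_add, Int.even_mul, Int.even_sub, h0, h1, h2]
  · have e1 : (l₁ ++ b :: (l₂ ++ a :: l₃)).erase a = l₁ ++ b :: (l₂ ++ l₃) := by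
      rw [← List.cons_append, ← List.append_assoc, erase_append_middle (by simp [ha1, ha2, hab])]
      simp
    have e2 := conSign_append (n := n) (d := d) (b := a) (l₁ := l₁ ++ b :: l₂)
      (by simp [ha1, ha2, hab]) l₃
    simp only [List.append_assoc, List.cons_append] at e2
    have h2 := coeff_move hx (L := M.map (mergeE a b)) (hM a ha hab)
      (fun v hv => hM v (by simp [hv]) (ne_of_mem_of_not_mem hv hb2)) l₁ l₃
    rw [e1, erase_append_middle hb1, conSign_append hb1, e2]
    simp only [List.map_append, List.map_cons, map_swap_of_not_mem ha1 hb1,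
      map_swap_of_not_mem ha2 hb2, map_swap_of_not_mem ha3 hb3, Equiv.swap_apply_right, h2,
      smul_smul, ← Int.negOnePow_add, List.sum_append, List.sum_cons, hda, hdb]
    congr 1
    refine negOnePow_congr ?_
    generalize (l₁.map d).sum = s₁, (l₂.map d).sum = s₂, (l₃.map d).sum = s₃
    by_cases h0 : Even n <;> by_cases h1 : Even s₁ <;> by_cases h2 : Even s₂ <;>
      simp [Int.even_add, Int.even_mul, Int.even_sub, h0, h1, h2]

theorem con_relabel (hx : x ∈ hairyGraphs K m n) (σ : Equiv.Perm ℕ) {d d' : ℕ → ℤ}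
    (hd : ∀ v, d' (σ v) = d v) (vs : List ℕ) (e : ℕ × ℕ) (M : List (ℕ × ℕ)) :
    con n x d' (vs.map σ) (Prod.map σ σ e) (M.map (Prod.map σ σ)) = con n x d vs e M := by
  have key : ∀ v, merge (σ e.1) (σ e.2) (σ v) = σ (merge e.1 e.2 v) := by
    intro v
    simp only [merge, σ.injective.eq_iff]
    split_ifs <;> rfl
  have h1 : (M.map (Prod.map σ σ)).map (mergeE (σ e.1) (σ e.2)) =
      (M.map (mergeE e.1 e.2)).map (Prod.map σ σ) := by
    rw [List.map_map, List.map_map]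
    exact List.map_congr_left fun f _ => Prod.ext (key _) (key _)
  have h2 : (vs.map σ).takeWhile (fun v => v ≠ σ e.2) =
      (vs.takeWhile (fun v => v ≠ e.2)).map σ := by
    rw [List.takeWhile_map]
    congr 2
    funext v
    simp [σ.injective.eq_iff]
  rw [con, con, Prod.map_fst, Prod.map_snd, h1, ← List.map_erase σ.injective, coeff_relabel hx,
    conSign, conSign, h2, List.map_map, List.map_map]
  have h3 : d' ∘ σ = d := funext hd
  rw [h3]

/-- If the removed vertex is neither `a` nor `b`, the exchange happens in the contracted graph. If
it is one of them, the contracted graphs agree and the sign comes from `conSign`, using that the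
removed vertex has degree `n`. -/
theorem con_adjacent (hx : x ∈ hairyGraphs K m n) {d : ℕ → ℤ} {l l' : List ℕ} {a b : ℕ}
    (hvs : (l ++ a :: b :: l').Nodup) {e : ℕ × ℕ} (he : e.2 ∈ l ++ a :: b :: l') (hde : d e.2 = n)
    {M : List (ℕ × ℕ)}
    (hM : ∀ v ∈ l ++ a :: b :: l', v ≠ e.2 → hdeg m n (M.map (mergeE e.1 e.2)) v = d v) :
    con n x d (l ++ b :: a :: l') e M = (d a * d b).negOnePow • con n x d (l ++ a :: b :: l') e M := by
  have hperm : (l ++ b :: a :: l').Perm (l ++ a :: b :: l') :=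
    (List.Perm.swap _ _ _).append_left _
  have hsum : ((l ++ b :: a :: l').map d).sum = ((l ++ a :: b :: l').map d).sum :=
    (hperm.map d).sum_eq
  have hswap : ∀ k k' : List ℕ, a ≠ e.2 → b ≠ e.2 →
      x ⟨k ++ b :: a :: k', M.map (mergeE e.1 e.2)⟩ =
        (d a * d b).negOnePow • x ⟨k ++ a :: b :: k', M.map (mergeE e.1 e.2)⟩ := by
    intro k k' h1 h2
    rw [hx.2.2.1, vdeg_eq, vdeg_eq, ← hM a (by simp) h1, ← hM b (by simp) h2]
  have hab : a ≠ b := by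
    rw [List.nodup_append] at hvs
    exact fun h => (List.nodup_cons.1 hvs.2.1).1 (by simp [h])
  obtain ⟨a', b'⟩ := e
  simp only at he hde hM hswap ⊢
  by_cases hl : b' ∈ l
  · obtain ⟨k₁, k₂, rfl, h1, h2⟩ := exists_append_of_mem (List.nodup_append.1 hvs).1 hl
    have hne : ∀ c ∈ a :: b :: l', c ≠ b' := fun c hc h =>
      (List.nodup_append.1 hvs).2.2 b' (by simp) c hc h.symm
    simp only [con, List.append_assoc, List.cons_append, erase_append_middle h1,
      conSign_append h1] at hsum ⊢
    rw [← List.append_assoc k₁, hswap (k₁ ++ k₂) l' (hne a (by simp)) (hne b (by simp)), smul_comm,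
      List.append_assoc]
    congr 3
    have h5 : ∀ y z : ℕ, (List.map d (k₂ ++ y :: z :: l')).sum =
        (List.map d k₂).sum + (d y + (d z + (List.map d l').sum)) := by intro y z; simp
    rw [h5, h5]
    ring
  · by_cases hb : b' = b
    · subst hb
      have e1 : (l ++ a :: b' :: l').erase b' = l ++ a :: l' := by
        rw [List.append_cons, erase_append_middle (by simp [hl, hab.symm])]
        simp
      have e2 := conSign_append (n := n) (d := d) (b := b') (l₁ := l ++ [a])
        (by simp [hl, hab.symm]) l'
      simp only [List.append_assoc, List.cons_append, List.nil_append] at e2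
      rw [con, con]
      simp only
      rw [e1, erase_append_middle hl, e2, conSign_append hl]
      simp only [smul_smul, ← Int.negOnePow_add, List.map_append, List.map_cons, List.map_nil,
        List.sum_append, List.sum_cons, List.sum_nil, hde]
      congr 1
      refine negOnePow_congr ?_
      generalize (l.map d).sum = s₁, (l'.map d).sum = s₂, d a = t
      by_cases h0 : Even n <;> by_cases h1 : Even s₁ <;> by_cases h2 : Even s₂ <;>
        by_cases h3 : Even t <;> simp [Int.even_add, Int.even_mul, Int.even_sub, h0, h1, h2, h3]
    · by_cases ha : b' = a
      · subst ha
        have e1 : (l ++ b :: b' :: l').erase b' = l ++ b :: l' := by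
          rw [List.append_cons, erase_append_middle (by simp [hl, hab])]
          simp
        have e2 := conSign_append (n := n) (d := d) (b := b') (l₁ := l ++ [b])
          (by simp [hl, hab]) l'
        simp only [List.append_assoc, List.cons_append, List.nil_append] at e2
        rw [con, con]
        simp only
        rw [e1, erase_append_middle hl, e2, conSign_append hl]
        simp only [smul_smul, ← Int.negOnePow_add, List.map_append, List.map_cons, List.map_nil,
          List.sum_append, List.sum_cons, List.sum_nil, hde]
        congr 1
        refine negOnePow_congr ?_
        generalize (l.map d).sum = s₁, (l'.map d).sum = s₂, d b = t
        by_cases h0 : Even n <;> by_cases h1 : Even s₁ <;> by_cases h2 : Even s₂ <;>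
          by_cases h3 : Even t <;> simp [Int.even_add, Int.even_mul, Int.even_sub, h0, h1, h2, h3]
      · have hl' : b' ∈ l' := by
          simpa [hl, ha, hb] using he
        obtain ⟨k₁, k₂, rfl⟩ := List.append_of_mem hl'
        have hk : b' ∉ k₁ := by
          intro h
          rw [List.nodup_append] at hvs
          have h1 := (List.nodup_cons.1 (List.nodup_cons.1 hvs.2.1).2).2
          rw [List.nodup_append] at h1
          exact h1.2.2 b' h b' (by simp) rfl
        have e1 : ∀ y z : ℕ, b' ≠ y → b' ≠ z → (l ++ y :: z :: (k₁ ++ b' :: k₂)).erase b' =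
            l ++ y :: z :: (k₁ ++ k₂) := by
          intro y z h1 h2
          have := erase_append_middle (b := b') (l₁ := l ++ y :: z :: k₁)
            (by simp [hl, h1, h2, hk]) k₂
          simpa using this
        have e2 : ∀ y z : ℕ, b' ≠ y → b' ≠ z →
            (l ++ y :: z :: (k₁ ++ b' :: k₂)).takeWhile (fun v => v ≠ b') = l ++ y :: z :: k₁ := by
          intro y z h1 h2
          have := takeWhile_ne_append (b := b') (l₁ := l ++ y :: z :: k₁)
            (by simp [hl, h1, h2, hk]) k₂
          simpa using this
        rw [con, con]
        simp only
        rw [e1 a b ha hb, e1 b a hb ha, hswap _ _ (Ne.symm ha) (Ne.symm hb), smul_comm, conSign,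
          conSign, hsum, e2 a b ha hb, e2 b a hb ha]
        congr 5
        simp only [List.map_append, List.map_cons, List.sum_append, List.sum_cons]
        ring

theorem splitDiff_of_not_hairy {Γ : LGraph} (h : ¬ Γ.IsHairy) : splitDiff K m n x Γ = 0 :=
  if_neg h

theorem hairDiff_of_not_hairy {Γ : LGraph} (h : ¬ Γ.IsHairy) : hairDiff K x Γ = 0 :=
  if_neg h

theorem hdeg_of_ne_one {L : List (ℕ × ℕ)} {v : ℕ} (h : val L v ≠ 1) : hdeg m n L v = n :=
  if_neg h

open Classical in
-- Valences and degrees are read off from a fixed list `L'`, so that the summand stays the same when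
-- the edges of `L` are reordered or reversed.
theorem splitDiff_apply_of_val (x : LGraph → K) {vs : List ℕ} {L L' : List (ℕ × ℕ)}
    (h : IsHairy ⟨vs, L⟩) (hv : val L' = val L) :
    splitDiff K m n x ⟨vs, L⟩ = pickSum (edgeSign n)
      (fun e R => if Contr L' e then con n x (hdeg m n L') vs e R else 0) L := by
  have hd : hdeg m n L' = hdeg m n L := funext fun v => hdeg_congr (congrFun hv v)
  rw [splitDiff_apply x h, hd]
  exact pickSum_congr fun e R _ => if_congr (by rw [contr_congr hv]) rfl rfl

theorem splitDiff_mem (hx : x ∈ hairyGraphs K m n) : splitDiff K m n x ∈ hairyGraphs K m n := by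
  classical
  refine ⟨fun Γ h => splitDiff_of_not_hairy h, fun σ Γ => ?_, fun l l' a b es => ?_,
    fun vs l l' e e' => ?_, fun vs l l' a b => ?_⟩
  · obtain ⟨vs, L⟩ := Γ
    change splitDiff K m n x ⟨vs.map σ, L.map (Prod.map σ σ)⟩ = _
    by_cases h : IsHairy ⟨vs, L⟩
    · rw [splitDiff_apply x h, splitDiff_apply x (h.relabel σ), pickSum_map]
      refine pickSum_congr fun e R _ => if_congr ?_ ?_ rfl
      · simp only [Contr, Prod.map_fst, Prod.map_snd, val_relabel, ne_eq, σ.injective.eq_iff]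
      · exact con_relabel hx σ (fun v => hdeg_congr (val_relabel σ L v)) vs e R
    · rw [splitDiff_of_not_hairy h, splitDiff_of_not_hairy]
      intro h'
      have := h'.relabel σ.symm
      simp only [List.map_map, Prod.map_comp_map, Equiv.symm_comp_self, List.map_id,
        Prod.map_id] at this
      exact h this
  · have p : (l ++ a :: b :: l').Perm (l ++ b :: a :: l') :=
      (List.Perm.swap _ _ _).append_left _
    by_cases h : IsHairy ⟨l ++ a :: b :: l', es⟩
    · rw [splitDiff_apply x h, splitDiff_apply x (h.verts_perm p), ← pickSum_smul]
      refine pickSum_congr fun e R pe => ?_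
      rw [smul_ite, smul_zero]
      by_cases hc : Contr es e
      · have h' := h.edges_perm pe.symm
        rw [if_pos hc, if_pos hc]
        refine con_adjacent hx h.nodup (h.mem e (pe.mem_iff.1 List.mem_cons_self)).2
          (hdeg_of_ne_one hc.2.2) fun v _ hv => ?_
        rw [← hdeg_perm pe]
        rw [← contr_perm pe] at hc
        exact h'.hdeg_contr hc hv
      · rw [if_neg hc, if_neg hc]
    · rw [splitDiff_of_not_hairy h, splitDiff_of_not_hairy fun h' => h (h'.verts_perm p.symm),
        smul_zero]
  · have p : (l ++ e :: e' :: l').Perm (l ++ e' :: e :: l') :=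
      (List.Perm.swap _ _ _).append_left _
    by_cases h : IsHairy ⟨vs, l ++ e :: e' :: l'⟩
    · rw [splitDiff_apply x h, splitDiff_apply_of_val x (h.edges_perm p) (funext (val_perm p))]
      refine Koszul.pickSum (fun f => Koszul.ite _ (con_koszul hx _ _ _) koszul_zero) l l' e e'
    · rw [splitDiff_of_not_hairy h, splitDiff_of_not_hairy fun h' => h (h'.edges_perm p.symm),
        smul_zero]
  · change splitDiff K m n x ⟨vs, l ++ (a, b).swap :: l'⟩ = _
    have hv : val (l ++ (a, b).swap :: l') = val (l ++ (a, b) :: l') := funext (val_swap l l' _)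
    by_cases h : IsHairy ⟨vs, l ++ (a, b) :: l'⟩
    · rw [splitDiff_apply x h, splitDiff_apply_of_val x h.flip hv.symm]
      refine pickSum_flip (fun R pR => ?_) fun f k k' _ => ?_
      · have pe : ((a, b) :: R).Perm (l ++ (a, b) :: l') :=
          (pR.cons _).trans List.perm_middle.symm
        have h' := h.edges_perm pe.symm
        rw [smul_ite, smul_zero]
        by_cases hc : Contr (l ++ (a, b) :: l') (a, b)
        · rw [if_pos hc, if_pos (contr_swap.2 hc)]
          have hm := h'.mem (a, b) List.mem_cons_self
          refine con_swap hx h.nodup hm.1 hm.2 hc.1 (hdeg_of_ne_one hc.2.1)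
            (hdeg_of_ne_one hc.2.2) fun v _ hv => ?_
          rw [← hdeg_perm pe]
          rw [← contr_perm pe] at hc
          exact h'.hdeg_contr hc hv
        · rw [if_neg hc, if_neg fun hc' => hc (contr_swap.1 hc')]
      · exact FlipEq.ite _ (con_flipEq hx _ _ _) flipEq_zero k k' (a, b)
    · rw [splitDiff_of_not_hairy h, splitDiff_of_not_hairy fun h' => h ?_, smul_zero]
      simpa using h'.flip

end Split

/-! ### The splitting differential squares to zero -/

open LGraph

namespace LGraph

/-- The edges `e` and `e'` have the same ends, if `e'` is not a tadpole. -/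
abbrev Parallel (e e' : ℕ × ℕ) : Prop := merge e.1 e.2 e'.1 = merge e.1 e.2 e'.2

theorem parallel_comm {e e' : ℕ × ℕ} (h : e.1 ≠ e.2) (h' : e'.1 ≠ e'.2) :
    Parallel e e' ↔ Parallel e' e := by
  simp only [Parallel, merge]
  split_ifs <;> omega

theorem parallel_iff {e e' : ℕ × ℕ} (h' : e'.1 ≠ e'.2) :
    Parallel e e' ↔ e' = e ∨ e' = e.swap := by
  simp only [Parallel, merge, Prod.ext_iff, Prod.fst_swap, Prod.snd_swap]
  split_ifs <;> omega

/-- Removing `a` and `b` in the other order exchanges two vertices of degree `n`, and `n^2` has the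
parity of `n`. -/
theorem conSign_mul_conSign {n : ℤ} {d : ℕ → ℤ} {vs : List ℕ} (hvs : vs.Nodup) {a b : ℕ}
    (ha : a ∈ vs) (hb : b ∈ vs) (hab : a ≠ b) (hda : d a = n) (hdb : d b = n) :
    conSign n d vs a * conSign n d (vs.erase a) b =
      n.negOnePow * (conSign n d vs b * conSign n d (vs.erase b) a) := by
  have key : ∀ (l₁ l₂ l₃ : List ℕ) (a b : ℕ), (a ∉ l₁ ∧ a ∉ l₂) → (b ∉ l₁ ∧ b ∉ l₂) → a ≠ b →
      d a = n → d b = n → vs = l₁ ++ a :: (l₂ ++ b :: l₃) →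
      conSign n d vs a * conSign n d (vs.erase a) b =
      n.negOnePow * (conSign n d vs b * conSign n d (vs.erase b) a) := by
    rintro l₁ l₂ l₃ a b ⟨ha1, ha2⟩ ⟨hb1, hb2⟩ hab hda hdb rfl
    have e1 : (l₁ ++ a :: (l₂ ++ b :: l₃)).erase b = l₁ ++ a :: (l₂ ++ l₃) := by
      rw [← List.cons_append, ← List.append_assoc,
        erase_append_middle (by simp [hb1, hb2, hab.symm])]
      simp
    have e2 := conSign_append (n := n) (d := d) (b := b) (l₁ := l₁ ++ a :: l₂)
      (by simp [hb1, hb2, hab.symm]) l₃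
    have e3 := conSign_append (n := n) (d := d) (b := b) (l₁ := l₁ ++ l₂)
      (by simp [hb1, hb2]) l₃
    simp only [List.append_assoc, List.cons_append] at e2 e3
    rw [erase_append_middle ha1, e1, conSign_append ha1, conSign_append ha1, e2, e3]
    simp only [List.map_append, List.map_cons, ← Int.negOnePow_add, List.sum_append,
      List.sum_cons, hda, hdb]
    refine negOnePow_congr ?_
    generalize (l₁.map d).sum = s₁, (l₂.map d).sum = s₂, (l₃.map d).sum = s₃
    by_cases h0 : Even n <;> by_cases h1 : Even s₁ <;> by_cases h2 : Even s₂ <;>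
      simp [Int.even_add, Int.even_mul, Int.even_sub, h0, h1, h2]
  obtain ⟨l₁, l₂, l₃, ⟨ha1, ha2, -⟩, ⟨hb1, hb2, -⟩, h | h⟩ :=
    exists_append_append_of_mem hvs ha hb hab
  · exact key l₁ l₂ l₃ a b ⟨ha1, ha2⟩ ⟨hb1, hb2⟩ hab hda hdb h
  · rw [key l₁ l₂ l₃ b a ⟨hb1, hb2⟩ ⟨ha1, ha2⟩ hab.symm hdb hda h, ← mul_assoc,
      Int.units_mul_self, one_mul]

end LGraph

section SplitSq

variable {K : Type*} [Field K] {m n : ℤ} {x : LGraph → K}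

theorem edgeSign_smul_negOnePow_smul (n : ℤ) (y : K) :
    edgeSign n • n.negOnePow • y = -y := by
  rw [smul_smul, edgeSign_mul_negOnePow, Units.neg_smul, one_smul]

theorem negOnePow_eq_neg_edgeSign (n : ℤ) : n.negOnePow = -edgeSign n := by
  rw [← one_mul n.negOnePow, ← Int.units_mul_self (edgeSign n), mul_assoc,
    edgeSign_mul_negOnePow, mul_neg, mul_one]

/-- Up to names the doubly contracted graph does not depend on the order; a factor `(-1)^n` from the
vertices meets `edgeSign n` from the edges, with product `-1`. -/
theorem con_con_antisymm (hx : x ∈ hairyGraphs K m n) {vs : List ℕ} {e e' : ℕ × ℕ}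
    {R : List (ℕ × ℕ)} (h : IsHairy ⟨vs, e :: e' :: R⟩) (hc : Contr (e :: e' :: R) e)
    (hc' : Contr (e :: e' :: R) e') (hp : ¬ Parallel e e') {d : ℕ → ℤ}
    (hd : d = hdeg m n (e :: e' :: R)) :
    conSign n d vs e.2 • con n x d (vs.erase e.2) (mergeE e.1 e.2 e') (R.map (mergeE e.1 e.2)) +
      edgeSign n • conSign n d vs e'.2 •
        con n x d (vs.erase e'.2) (mergeE e'.1 e'.2 e) (R.map (mergeE e'.1 e'.2)) = 0 := by
  obtain ⟨a, b⟩ := e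
  obtain ⟨a', b'⟩ := e'
  have hm := h.mem (a, b) (by simp)
  have hm' := h.mem (a', b') (by simp)
  have hp' : ¬ Parallel (a', b') (a, b) := fun hp' => hp ((parallel_comm hc.1 hc'.1).2 hp')
  have hda : d a = n := hd ▸ hdeg_of_ne_one hc.2.1
  have hdb : d b = n := hd ▸ hdeg_of_ne_one hc.2.2
  have hdb' : d b' = n := hd ▸ hdeg_of_ne_one hc'.2.2
  have hda' : d a' = n := hd ▸ hdeg_of_ne_one hc'.2.1
  simp only [Parallel] at hm hm' hp hp'
  have hab : a ≠ b := hc.1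
  have hab' : a' ≠ b' := hc'.1
  by_cases hbb : b = b'
  -- Common second end: after the first contraction, the remaining edge joins `a` and `a'`, with
  -- opposite directions in the two orders, so `con_swap` supplies the factor `(-1)^n`.
  · subst hbb
    simp only [Prod.map_apply, merge_self, merge_of_ne hab, merge_of_ne hab'] at hp hp' ⊢
    have h1 : IsHairy ⟨vs, (a', b) :: (a, b) :: R⟩ := h.edges_perm (List.Perm.swap _ _ _)
    have hcc : Contr ((a', b) :: (a, b) :: R) (a', b) := by
      rwa [contr_perm (List.Perm.swap _ _ _)]
    have h2 := h1.contr hcc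
    simp only [List.map_cons, Prod.map_apply, merge_self, merge_of_ne hab] at h2
    have h3 := IsHairy.flip (l := []) h2
    simp only [List.nil_append, Prod.swap_prod_mk] at h3
    have hv : ∀ v, val ((a', a) :: R.map (mergeE a' b)) v =
        val (((a, b) :: R).map (mergeE a' b)) v := by
      intro v
      have := val_swap [] (R.map (mergeE a' b)) (a, a') v
      simpa [merge_self, merge_of_ne hab] using this
    have hval : ∀ v ≠ b, val ((a', a) :: R.map (mergeE a' b)) v ≠ 1 ↔
        val ((a, b) :: (a', b) :: R) v ≠ 1 := by
      intro v hvb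
      rw [hv, h1.val_contr_ne_one_iff hcc hvb, val_perm (List.Perm.swap _ _ _)]
    have hc3 : Contr ((a', a) :: R.map (mergeE a' b)) (a', a) :=
      ⟨Ne.symm hp', (hval a' hab').2 hc'.2.1, (hval a hab).2 hc.2.1⟩
    have hM : ∀ v ∈ vs.erase b, v ≠ a →
        hdeg m n ((R.map (mergeE a' b)).map (mergeE a' a)) v = d v := by
      intro v hvm hva
      rw [h3.hdeg_contr hc3 hva, hd]
      have hvb := ((List.Nodup.mem_erase_iff h.nodup).1 hvm).1
      rw [hdeg_congr (hv v), ← hdeg_perm (List.Perm.swap _ _ _)]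
      exact h1.hdeg_contr hcc hvb
    have h4 := con_swap hx (h.nodup.erase b) (a := a') (b := a)
      ((List.Nodup.mem_erase_iff h.nodup).2 ⟨hab', hm'.1⟩)
      ((List.Nodup.mem_erase_iff h.nodup).2 ⟨hab, hm.1⟩) (Ne.symm hp') hda' hda hM
    have h5 : (R.map (mergeE a' b)).map (mergeE a' a) =
        (R.map (mergeE a b)).map (mergeE a' a) := by
      have key : ∀ v, merge a' a (merge a' b v) = merge a' a (merge a b v) := by
        intro v
        simp only [merge]
        split_ifs <;> omega
      rw [List.map_map, List.map_map]
      exact List.map_congr_left fun f _ => Prod.ext (key _) (key _)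
    have h6 : con n x d (vs.erase b) (a', a) (R.map (mergeE a' b)) =
        con n x d (vs.erase b) (a', a) (R.map (mergeE a b)) := by
      rw [con, con, h5]
    rw [h4, h6, smul_comm (edgeSign n), edgeSign_smul_negOnePow_smul, smul_neg, add_neg_cancel]
  -- Different second ends: both orders remove `b` and `b'` and give literally the same graph, so
  -- only the order of the removed vertices matters.
  · simp only [Prod.map_apply, merge_of_ne (Ne.symm hbb), merge_of_ne hbb] at hp hp' ⊢
    have h5 : (R.map (mergeE a b)).map (mergeE (merge a b a') b') =
        (R.map (mergeE a' b')).map (mergeE (merge a' b' a) b) := by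
      have key : ∀ v, merge (merge a b a') b' (merge a b v) =
          merge (merge a' b' a) b (merge a' b' v) := by
        intro v
        simp only [merge] at hp hp' ⊢
        split_ifs at hp hp' ⊢ <;> omega
      rw [List.map_map, List.map_map]
      exact List.map_congr_left fun f _ => Prod.ext (key _) (key _)
    have h6 : (vs.erase b).erase b' = (vs.erase b').erase b := List.erase_comm ..
    simp only [con]
    rw [h5, h6, smul_smul (conSign n d vs b), smul_smul (conSign n d vs b'),
      conSign_mul_conSign (vs := vs) h.nodup hm.2 hm'.2 hbb hdb hdb', mul_smul n.negOnePow,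
      negOnePow_eq_neg_edgeSign, Units.neg_smul, neg_add_cancel]

theorem splitDiff_splitDiff (hx : x ∈ hairyGraphs K m n) :
    splitDiff K m n (splitDiff K m n x) = 0 := by
  classical
  funext Γ
  obtain ⟨vs, L⟩ := Γ
  by_cases h : IsHairy ⟨vs, L⟩
  swap
  · exact splitDiff_of_not_hairy h
  have h1 : splitDiff K m n (splitDiff K m n x) ⟨vs, L⟩ = pickSum (edgeSign n)
      (fun e R => pickSum (edgeSign n) (fun e' R' =>
        if Contr L e ∧ Contr L e' ∧ ¬ Parallel e e' then
          conSign n (hdeg m n L) vs e.2 • con n x (hdeg m n L) (vs.erase e.2) (mergeE e.1 e.2 e')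
            (R'.map (mergeE e.1 e.2)) else 0) R) L := by
    rw [splitDiff_apply _ h]
    refine pickSum_congr fun e R pe => ?_
    by_cases hc : Contr L e
    · have h' := h.edges_perm pe.symm
      have hc' : Contr (e :: R) e := by rwa [contr_perm pe]
      rw [if_pos hc, con, splitDiff_apply _ (h'.contr hc'), pickSum_map, ← pickSum_smul]
      refine pickSum_congr fun e' R' pe' => ?_
      have hm := h'.mem e' (List.mem_cons_of_mem _ (pe'.mem_iff.1 List.mem_cons_self))
      -- Internal vertices stay internal, so `e'` is contractible after `e` exactly if it was before
      -- and has not become a tadpole.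
      have hmerge : ∀ v, val (R.map (mergeE e.1 e.2)) (merge e.1 e.2 v) ≠ 1 ↔ val L v ≠ 1 := by
        intro v
        by_cases hv : v = e.2
        · subst hv
          rw [merge_self, h'.val_contr_ne_one_iff hc' hc.1]
          exact iff_of_true hc'.2.1 hc.2.2
        · rw [merge_of_ne hv, h'.val_contr_ne_one_iff hc' hv, val_perm pe]
      rw [smul_ite, smul_zero]
      refine if_congr ?_ ?_ rfl
      · have h2 : e'.1 = e'.2 → Parallel e e' := fun h2 => by rw [Parallel, h2]
        simp only [Contr, Prod.map_fst, Prod.map_snd, hmerge, Parallel] at h2 hc ⊢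
        tauto
      · rw [con, con]
        congr 2
        refine conSign_congr (fun v hv => ?_) _
        rw [h'.hdeg_contr hc' ((List.Nodup.mem_erase_iff h.nodup).1 hv).1, hdeg_perm pe]
    · rw [if_neg hc]
      exact (pickSum_eq_zero fun e' R' _ => if_neg fun h2 => hc h2.1).symm
  rw [h1]
  refine pickSum_pickSum_eq_zero fun e e' R p => ?_
  by_cases hc : Contr L e ∧ Contr L e' ∧ ¬ Parallel e e'
  · rw [if_pos hc, if_pos ⟨hc.2.1, hc.1, fun h2 => hc.2.2 ((parallel_comm hc.1.1 hc.2.1.1).2 h2)⟩]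
    rw [← contr_perm p] at hc
    exact con_con_antisymm hx (h.edges_perm p.symm) hc.1 hc.2.1 hc.2.2 (hdeg_perm p).symm
  · rw [if_neg hc, if_neg, smul_zero, add_zero]
    exact fun h2 => hc ⟨h2.2.1, h2.1, fun h3 => h2.2.2 ((parallel_comm h2.2.1.1 h2.1.1).1 h3)⟩

end SplitSq

/-! ### Detaching an edge -/

open LGraph

namespace LGraph

/-- The edge `e` detached from its second end (`true`) or its first end (`false`), with new
end `u`. -/
def det (u : ℕ) (e : ℕ × ℕ) : Bool → ℕ × ℕ
  | true => (e.1, u)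
  | false => (u, e.2)

/-- The end from which the edge `e` is detached. -/
def att (e : ℕ × ℕ) : Bool → ℕ
  | true => e.2
  | false => e.1

theorem det_swap (u : ℕ) (e : ℕ × ℕ) (s : Bool) : det u e.swap s = (det u e (!s)).swap := by
  cases s <;> rfl

theorem att_swap (e : ℕ × ℕ) (s : Bool) : att e.swap s = att e (!s) := by
  cases s <;> rfl

theorem val_det (u : ℕ) (e : ℕ × ℕ) (s : Bool) (R : List (ℕ × ℕ)) (v : ℕ) :
    val (det u e s :: R) v + (if att e s = v then 1 else 0) =
      val (e :: R) v + (if u = v then 1 else 0) := by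
  by_cases h1 : e.1 = v <;> by_cases h2 : e.2 = v <;> by_cases h3 : u = v <;> cases s <;>
    simp [det, att, val_cons, h1, h2, h3]

theorem det_map_of_ne {g : ℕ → ℕ} {u : ℕ} (hu : g u = u) (e : ℕ × ℕ) (s : Bool) :
    Prod.map g g (det u e s) = det u (Prod.map g g e) s := by
  cases s <;> simp [det, hu]

theorem fresh_not_mem (Γ : LGraph) : Γ.fresh ∉ Γ.verts := fun h => by
  have := List.single_le_sum (fun _ _ => Nat.zero_le _) _ h
  rw [fresh] at this
  omega

variable {m n : ℤ} {vs : List ℕ} {u w : ℕ} {e e' : ℕ × ℕ} {s t : Bool} {R L : List (ℕ × ℕ)}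

theorem IsHairy.val_of_not_mem (h : IsHairy ⟨vs, L⟩) (hu : u ∉ vs) : val L u = 0 :=
  val_eq_zero.2 fun e he =>
    ⟨ne_of_mem_of_not_mem (h.mem e he).1 hu, ne_of_mem_of_not_mem (h.mem e he).2 hu⟩

theorem IsHairy.att_mem (h : IsHairy ⟨vs, L⟩) (he : e ∈ L) : att e s ∈ vs := by
  cases s
  · exact (h.mem e he).1
  · exact (h.mem e he).2

theorem IsHairy.val_det_fresh (h : IsHairy ⟨vs, e :: R⟩) (hu : u ∉ vs) :
    val (det u e s :: R) u = 1 := by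
  have h1 := val_det u e s R u
  rwa [if_neg (ne_of_mem_of_not_mem (h.att_mem List.mem_cons_self) hu), if_pos rfl,
    h.val_of_not_mem hu] at h1

/-- Detaching lowers one valence by one; a change to or from valence one would need valence two
before or zero after, and both are excluded. -/
theorem IsHairy.val_det_eq_one_iff (h : IsHairy ⟨vs, e :: R⟩) (hu : u ∉ vs)
    (h' : IsHairy ⟨u :: vs, det u e s :: R⟩) {v : ℕ} (hv : v ∈ vs) :
    val (det u e s :: R) v = 1 ↔ val (e :: R) v = 1 := by
  have h1 := val_det u e s R v
  rw [if_neg (ne_of_mem_of_not_mem hv hu).symm] at h1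
  have h2 := h'.val_ne_zero (List.mem_cons_of_mem _ hv)
  have h3 : val (e :: R) v ≠ 2 := h.no_bivalent v hv
  split_ifs at h1 <;> omega

theorem IsHairy.hdeg_det (h : IsHairy ⟨vs, e :: R⟩) (hu : u ∉ vs)
    (h' : IsHairy ⟨u :: vs, det u e s :: R⟩) {v : ℕ} (hv : v ∈ vs) :
    hdeg m n (det u e s :: R) v = hdeg m n (e :: R) v :=
  if_congr (h.val_det_eq_one_iff hu h' hv) rfl rfl

/-- Apart from connectedness, the only obstruction is a new bivalent vertex, which can arise only
from a trivalent one. -/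
theorem IsHairy.det_iff (h : IsHairy ⟨vs, e :: R⟩) (hu : u ∉ vs)
    (hconn : ∀ a ∈ u :: vs, ∀ b ∈ u :: vs, Conn (det u e s :: R) a b) :
    IsHairy ⟨u :: vs, det u e s :: R⟩ ↔ val (e :: R) (att e s) ≠ 3 := by
  have hval : ∀ v ∈ vs, val (det u e s :: R) v + (if att e s = v then 1 else 0) =
      val (e :: R) v := by
    intro v hv
    have := val_det u e s R v
    rwa [if_neg (ne_of_mem_of_not_mem hv hu).symm] at this
  have hatt : att e s ∈ vs := h.att_mem List.mem_cons_self
  constructor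
  · intro h' h3
    have h1 := hval _ hatt
    have h2 : val (det u e s :: R) (att e s) ≠ 2 :=
      h'.no_bivalent _ (List.mem_cons_of_mem _ hatt)
    rw [if_pos rfl] at h1
    omega
  · intro h3
    refine ⟨List.nodup_cons.2 ⟨hu, h.nodup⟩, fun f hf => ?_, hconn, fun v hv => ?_,
      u, List.mem_cons_self, h.val_det_fresh hu⟩
    · rcases List.mem_cons.1 hf with rfl | hf
      · have := h.mem e List.mem_cons_self
        cases s
        · exact ⟨List.mem_cons_self, List.mem_cons_of_mem _ this.2⟩
        · exact ⟨List.mem_cons_of_mem _ this.1, List.mem_cons_self⟩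
      · have := h.mem f (List.mem_cons_of_mem _ hf)
        exact ⟨List.mem_cons_of_mem _ this.1, List.mem_cons_of_mem _ this.2⟩
    · rw [valence_eq]
      change val (det u e s :: R) v ≠ 2
      rcases List.mem_cons.1 hv with rfl | hv
      · rw [h.val_det_fresh hu]; omega
      · have h1 := hval v hv
        have h2 : val (e :: R) v ≠ 2 := h.no_bivalent v hv
        split_ifs at h1 with h4
        · subst h4; omega
        · omega

/-- Reattaching a detached edge preserves connectedness. -/
theorem Conn.of_det {L' : List (ℕ × ℕ)} (hR : ∀ f ∈ L', f ∈ L) (he : e ∈ L)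
    (hw : ∀ f ∈ L', f.1 ≠ w ∧ f.2 ≠ w) (hew : e.1 ≠ w ∧ e.2 ≠ w) {a b : ℕ} (ha : a ≠ w)
    (hb : b ≠ w) (h : Conn (det w e t :: L') a b) : Conn L a b := by
  -- Gluing `w` back to the end from which it was detached maps paths to paths.
  have := Conn.map (L' := L) (g := fun v => if v = w then att e t else v) (fun f hf => ?_) h
  · simpa [ha, hb] using this
  · rcases List.mem_cons.1 hf with rfl | hf
    · cases t <;> simpa [det, att, hew.1, hew.2] using Conn.of_mem he
    · simpa [(hw f hf).1, (hw f hf).2] using Conn.of_mem (hR f hf)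

/-- The intermediate graph is connected because the doubly detached one is, so only the valence
condition remains. -/
theorem IsHairy.det_iff_of_det_det (h : IsHairy ⟨vs, e :: e' :: R⟩) (hu : u ∉ vs)
    (hw : w ∉ u :: vs) (h2 : IsHairy ⟨w :: u :: vs, det w e' t :: det u e s :: R⟩) :
    IsHairy ⟨u :: vs, det u e s :: e' :: R⟩ ↔ val (e :: e' :: R) (att e s) ≠ 3 := by
  refine h.det_iff hu fun a ha b hb => ?_
  rw [List.mem_cons, not_or] at hw
  have hne : ∀ v ∈ vs, v ≠ w := fun v hv => ne_of_mem_of_not_mem hv hw.2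
  have he := h.mem e List.mem_cons_self
  refine Conn.of_det (L' := det u e s :: R) (t := t) (fun f hf => ?_)
    (List.mem_cons_of_mem _ List.mem_cons_self) (fun f hf => ?_) ?_
    ?_ ?_ (h2.connected a (List.mem_cons_of_mem _ ha) b (List.mem_cons_of_mem _ hb))
  · simp only [List.mem_cons] at hf ⊢
    tauto
  · rcases List.mem_cons.1 hf with rfl | hf
    · cases s
      · exact ⟨Ne.symm hw.1, hne _ he.2⟩
      · exact ⟨hne _ he.1, Ne.symm hw.1⟩
    · have := h.mem f (by simp [hf])
      exact ⟨hne _ this.1, hne _ this.2⟩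
  · have := h.mem e' (by simp)
    exact ⟨hne _ this.1, hne _ this.2⟩
  · rcases List.mem_cons.1 ha with rfl | ha
    · exact Ne.symm hw.1
    · exact hne _ ha
  · rcases List.mem_cons.1 hb with rfl | hb
    · exact Ne.symm hw.1
    · exact hne _ hb

/-- A vertex that loses exactly one edge end cannot have been trivalent, as it would end up
bivalent. -/
theorem IsHairy.val_ne_three_of_det_det
    (h2 : IsHairy ⟨w :: u :: vs, det w e' t :: det u e s :: R⟩) (hu : u ∉ vs)
    (hw : w ∉ u :: vs) {v : ℕ}
    (hv : v ∈ vs) (hvv : att e s = v ∧ att e' t ≠ v ∨ att e s ≠ v ∧ att e' t = v) :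
    val (e :: e' :: R) v ≠ 3 := by
  rw [List.mem_cons, not_or] at hw
  have h3 := val_det w e' t (det u e s :: R) v
  have h4 := val_det u e s (e' :: R) v
  rw [if_neg (ne_of_mem_of_not_mem hv hw.2).symm] at h3
  rw [if_neg (ne_of_mem_of_not_mem hv hu).symm] at h4
  have h5 : val (det w e' t :: det u e s :: R) v ≠ 2 := h2.no_bivalent v (by simp [hv])
  rw [val_perm (List.Perm.swap _ _ _)] at h4
  rcases hvv with ⟨h6, h7⟩ | ⟨h6, h7⟩
  · rw [if_neg h7] at h3
    rw [if_pos h6] at h4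
    omega
  · rw [if_pos h7] at h3
    rw [if_neg h6] at h4
    omega

end LGraph

/-! ### The operation `Δ` respects the Koszul rules and squares to zero -/

section Hair

variable {K : Type*} [Field K] {m n : ℤ} {x : LGraph → K}

theorem coeff_fresh_det (hx : x ∈ hairyGraphs K m n) {u w : ℕ} {vs : List ℕ} {e : ℕ × ℕ}
    {R : List (ℕ × ℕ)} (hu : u ∉ vs) (hw : w ∉ vs) (hLu : val (e :: R) u = 0)
    (hLw : val (e :: R) w = 0) (s : Bool) :
    x ⟨u :: vs, det u e s :: R⟩ = x ⟨w :: vs, det w e s :: R⟩ := by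
  have h1 := val_eq_zero.1 hLu e List.mem_cons_self
  have h2 := val_eq_zero.1 hLw e List.mem_cons_self
  have h3 : val R u = 0 := val_eq_zero.2 fun f hf =>
    val_eq_zero.1 hLu f (List.mem_cons_of_mem _ hf)
  have h4 : val R w = 0 := val_eq_zero.2 fun f hf =>
    val_eq_zero.1 hLw f (List.mem_cons_of_mem _ hf)
  cases s
  · exact (coeff_fresh hx hu hw h3 h4 h1.2 h2.2).2
  · exact (coeff_fresh hx hu hw h3 h4 h1.1 h2.1).1

theorem hairDiff_apply_det (hx : x ∈ hairyGraphs K m n) {vs : List ℕ} {L : List (ℕ × ℕ)} {u : ℕ}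
    (h : IsHairy ⟨vs, L⟩) (hu : u ∉ vs) :
    hairDiff K x ⟨vs, L⟩ = pickSum (edgeSign n)
      (fun e R => if e.1 ≠ e.2 then ∑ s, x ⟨u :: vs, det u e s :: R⟩ else 0) L := by
  rw [hairDiff_apply hx h rfl]
  refine pickSum_congr fun e R p => if_congr Iff.rfl ?_ rfl
  have h' := h.edges_perm p.symm
  have key := coeff_fresh_det hx hu (fresh_not_mem ⟨vs, L⟩) (h'.val_of_not_mem hu)
    (h'.val_of_not_mem (fresh_not_mem ⟨vs, L⟩))
  rw [Fintype.sum_bool, key, key]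
  rfl

theorem hairDiff_mem (hx : x ∈ hairyGraphs K m n) : hairDiff K x ∈ hairyGraphs K m n := by
  refine ⟨fun Γ h => hairDiff_of_not_hairy h, fun σ Γ => ?_, fun l l' a b es => ?_,
    fun vs l l' e e' => ?_, fun vs l l' a b => ?_⟩
  · obtain ⟨vs, L⟩ := Γ
    change hairDiff K x ⟨vs.map σ, L.map (Prod.map σ σ)⟩ = _
    by_cases h : IsHairy ⟨vs, L⟩
    · have hu := fresh_not_mem ⟨vs, L⟩
      have hu' : σ (fresh ⟨vs, L⟩) ∉ vs.map σ := fun h1 => by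
        obtain ⟨v, hv, h2⟩ := List.mem_map.1 h1
        exact hu (σ.injective h2 ▸ hv)
      rw [hairDiff_apply_det hx h hu, hairDiff_apply_det hx (h.relabel σ) hu', pickSum_map]
      refine pickSum_congr fun e R _ => if_congr ?_ (Finset.sum_congr rfl fun s _ => ?_) rfl
      · simp only [Prod.map_fst, Prod.map_snd, ne_eq, σ.injective.eq_iff]
      · rw [← coeff_relabel hx σ (_ :: vs)]
        cases s <;> rfl
    · rw [hairDiff_of_not_hairy h, hairDiff_of_not_hairy]
      intro h'
      have := h'.relabel σ.symm
      simp only [List.map_map, Prod.map_comp_map, Equiv.symm_comp_self, List.map_id,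
        Prod.map_id] at this
      exact h this
  · have p : (l ++ a :: b :: l').Perm (l ++ b :: a :: l') :=
      (List.Perm.swap _ _ _).append_left _
    by_cases h : IsHairy ⟨l ++ a :: b :: l', es⟩
    · have hu := fresh_not_mem ⟨l ++ a :: b :: l', es⟩
      set u := fresh ⟨l ++ a :: b :: l', es⟩
      rw [hairDiff_apply_det hx h hu,
        hairDiff_apply_det hx (h.verts_perm p) (fun h1 => hu (p.mem_iff.2 h1)), ← pickSum_smul]
      refine pickSum_congr fun e R pe => ?_
      rw [smul_ite, smul_zero, Finset.smul_sum]
      refine if_congr Iff.rfl (Finset.sum_congr rfl fun s _ => ?_) rfl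
      have h' := h.edges_perm pe.symm
      have h1 := hx.2.2.1 (u :: l) l' a b (det u e s :: R)
      rw [List.cons_append, List.cons_append] at h1
      rw [h1]
      -- Vertex degrees are known to be unchanged only if the detached graph is hairy; otherwise its
      -- coefficient vanishes.
      by_cases h2 : IsHairy ⟨u :: (l ++ a :: b :: l'), det u e s :: R⟩
      · rw [vdeg_eq, vdeg_eq, vdeg_eq, vdeg_eq]
        change (hdeg m n (det u e s :: R) a * hdeg m n (det u e s :: R) b).negOnePow • _ =
          (hdeg m n es a * hdeg m n es b).negOnePow • _
        rw [h'.hdeg_det hu h2 (by simp), h'.hdeg_det hu h2 (by simp), hdeg_perm pe]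
      · rw [coeff_eq_zero hx h2, smul_zero, smul_zero]
    · rw [hairDiff_of_not_hairy h, hairDiff_of_not_hairy fun h' => h (h'.verts_perm p.symm),
        smul_zero]
  · have p : (l ++ e :: e' :: l').Perm (l ++ e' :: e :: l') :=
      (List.Perm.swap _ _ _).append_left _
    by_cases h : IsHairy ⟨vs, l ++ e :: e' :: l'⟩
    · rw [hairDiff_apply hx h rfl, hairDiff_apply hx (h.edges_perm p) rfl]
      exact Koszul.pickSum (fun f => Koszul.ite _ (((coeff_koszul hx _).cons _).add
        ((coeff_koszul hx _).cons _)) koszul_zero) l l' e e'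
    · rw [hairDiff_of_not_hairy h, hairDiff_of_not_hairy fun h' => h (h'.edges_perm p.symm),
        smul_zero]
  · change hairDiff K x ⟨vs, l ++ (a, b).swap :: l'⟩ = _
    by_cases h : IsHairy ⟨vs, l ++ (a, b) :: l'⟩
    · rw [hairDiff_apply hx h rfl, hairDiff_apply hx h.flip rfl]
      refine pickSum_flip (fun R _ => ?_) fun f k k' _ => ?_
      · rw [smul_ite, smul_zero]
        refine if_congr ne_comm ?_ rfl
        rw [smul_add, add_comm]
        exact congrArg₂ _ (coeff_flip_head hx _ _ _ _) (coeff_flip_head hx _ _ _ _)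
      · exact FlipEq.ite _ (((coeff_flip hx _).cons _).add ((coeff_flip hx _).cons _))
          flipEq_zero k k' (a, b)
    · rw [hairDiff_of_not_hairy h, hairDiff_of_not_hairy fun h' => h ?_, smul_zero]
      simpa using h'.flip

/-- Exchanging two univalent vertices of odd degree. -/
theorem coeff_swap_hairs (hx : x ∈ hairyGraphs K m n) (hm : Odd m) {u w : ℕ} {vs : List ℕ}
    {L : List (ℕ × ℕ)} (hu : val L u = 1) (hw : val L w = 1) :
    x ⟨w :: u :: vs, L⟩ = -x ⟨u :: w :: vs, L⟩ := by
  have h1 := hx.2.2.1 [] vs u w L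
  simp only [List.nil_append, vdeg_eq, hdeg, hu, hw, if_true] at h1
  rw [h1, Int.negOnePow_odd _ (hm.mul hm), Units.neg_smul, one_smul]

/-- Renaming `u` and `w` into each other leaves an exchange of two edges and an exchange of two odd
hairs. -/
theorem coeff_det_det (hx : x ∈ hairyGraphs K m n) (hm : Odd m) {vs : List ℕ} {e e' : ℕ × ℕ}
    {R : List (ℕ × ℕ)} {u w : ℕ} (h : IsHairy ⟨vs, e :: e' :: R⟩) (hu : u ∉ vs)
    (hw : w ∉ u :: vs) (s t : Bool) :
    x ⟨w :: u :: vs, det w e' t :: det u e s :: R⟩ =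
      -(edgeSign n • x ⟨w :: u :: vs, det w e s :: det u e' t :: R⟩) := by
  have hwu : w ≠ u := fun h => hw (by simp [h])
  have hw' : w ∉ vs := fun h => hw (by simp [h])
  have hLu := h.val_of_not_mem hu
  have hLw := h.val_of_not_mem hw'
  have hue := val_eq_zero.1 hLu e (by simp)
  have hwe := val_eq_zero.1 hLw e (by simp)
  have hue' := val_eq_zero.1 hLu e' (by simp)
  have hwe' := val_eq_zero.1 hLw e' (by simp)
  have hRu : val R u = 0 := val_eq_zero.2 fun f hf => val_eq_zero.1 hLu f (by simp [hf])
  have hRw : val R w = 0 := val_eq_zero.2 fun f hf => val_eq_zero.1 hLw f (by simp [hf])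
  have hfix : ∀ v, v ≠ u ∧ v ≠ w → Equiv.swap u w v = v := fun v hv =>
    Equiv.swap_apply_of_ne_of_ne hv.1 hv.2
  have h1 := coeff_relabel hx (Equiv.swap u w) (w :: u :: vs) (det w e s :: det u e' t :: R)
  have hvu : val (det u e s :: det w e' t :: R) u = 1 := by
    cases s <;> cases t <;> simp [det, val_cons, hRu, hue, hue', hwu]
  have hvw : val (det u e s :: det w e' t :: R) w = 1 := by
    cases s <;> cases t <;> simp [det, val_cons, hRw, hwe, hwe', hwu.symm]
  have hd : ∀ s, Prod.map (Equiv.swap u w) (Equiv.swap u w) (det w e s) = det u e s := by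
    intro s
    cases s <;> simp [det, hfix _ ⟨hue.1, hwe.1⟩, hfix _ ⟨hue.2, hwe.2⟩]
  have hd' : ∀ s, Prod.map (Equiv.swap u w) (Equiv.swap u w) (det u e' s) = det w e' s := by
    intro s
    cases s <;> simp [det, hfix _ ⟨hue'.1, hwe'.1⟩, hfix _ ⟨hue'.2, hwe'.2⟩]
  simp only [List.map_cons, Equiv.swap_apply_left, Equiv.swap_apply_right,
    map_swap_of_not_mem hu hw', hd, hd', mapE_swap_of_val hRu hRw] at h1
  rw [← h1, coeff_swap_head hx, coeff_swap_hairs hx hm hvu hvw, smul_neg]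

/-- Detaching the new hair once more disconnects the graph: at the same end it isolates `u`, at the
other end it cuts off the component of `u` and `w`. -/
theorem coeff_det_self (hx : x ∈ hairyGraphs K m n) {vs : List ℕ} {e : ℕ × ℕ}
    {R : List (ℕ × ℕ)} {u w : ℕ} (h : IsHairy ⟨vs, e :: R⟩) (hu : u ∉ vs)
    (hw : w ∉ u :: vs) (s t : Bool) :
    x ⟨w :: u :: vs, det w (det u e s) t :: R⟩ = 0 := by
  refine coeff_eq_zero hx fun h' => ?_
  have hwu : w ≠ u := fun h => hw (by simp [h])
  have hw' : w ∉ vs := fun h => hw (by simp [h])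
  have hLu := val_eq_zero.1 (h.val_of_not_mem hu)
  have hLw := val_eq_zero.1 (h.val_of_not_mem hw')
  have he := h.mem e (by simp)
  by_cases hst : s = t
  · subst hst
    refine h'.val_ne_zero (v := u) (by simp) (val_eq_zero.2 fun f hf => ?_)
    rcases List.mem_cons.1 hf with rfl | hf
    · have := hLu e (by simp)
      cases s <;> simp [det, this, hwu]
    · exact hLu f (by simp [hf])
  · have := h'.mem_of_closed (S := {u, w}) (fun f hf => ?_) (a := u) (by simp) (by simp)
      (b := e.1) (by simp [he.1])
    · rcases this with h1 | h1
      · exact (hLu e (by simp)).1 h1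
      · exact (hLw e (by simp)).1 h1
    · rcases List.mem_cons.1 hf with rfl | hf
      · cases s <;> cases t <;> simp_all [det]
      · have h1 := hLu f (by simp [hf])
        have h2 := hLw f (by simp [hf])
        simp [h1, h2]

theorem hairDiff_hairDiff (hx : x ∈ hairyGraphs K m n) (hm : Odd m) :
    hairDiff K (hairDiff K x) = 0 := by
  classical
  funext Γ
  obtain ⟨vs, L⟩ := Γ
  by_cases h : IsHairy ⟨vs, L⟩
  swap
  · exact hairDiff_of_not_hairy h
  obtain ⟨u, hu⟩ : ∃ u, u ∉ vs := ⟨_, fresh_not_mem ⟨vs, L⟩⟩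
  obtain ⟨w, hw⟩ : ∃ w, w ∉ u :: vs := ⟨_, fresh_not_mem ⟨u :: vs, L⟩⟩
  have h1 : hairDiff K (hairDiff K x) ⟨vs, L⟩ = pickSum (edgeSign n)
      (fun e R => pickSum (edgeSign n) (fun e' R' => ∑ s, ∑ t,
        if (e.1 ≠ e.2 ∧ e'.1 ≠ e'.2) ∧ val L (att e s) ≠ 3 then
          edgeSign n • x ⟨w :: u :: vs, det w e' t :: det u e s :: R'⟩ else 0) R) L := by
    rw [hairDiff_apply_det (hairDiff_mem hx) h hu]
    refine pickSum_congr fun e R pe => ?_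
    have h' := h.edges_perm pe.symm
    rw [pickSum_sum]
    by_cases he : e.1 ≠ e.2
    · rw [if_pos he]
      refine Finset.sum_congr rfl fun s _ => ?_
      have h2 : hairDiff K x ⟨u :: vs, det u e s :: R⟩ =
          if IsHairy ⟨u :: vs, det u e s :: R⟩ then pickSum (edgeSign n)
            (fun f S => if f.1 ≠ f.2 then ∑ t, x ⟨w :: u :: vs, det w f t :: S⟩ else 0)
              (det u e s :: R) else 0 := by
        split_ifs with h3
        · exact hairDiff_apply_det hx h3 hw
        · exact hairDiff_of_not_hairy h3
      -- The head term of the inner sum picks the new hair itself and vanishes.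
      rw [h2, pickSum]
      simp only [coeff_det_self hx h' hu hw, Finset.sum_const_zero, ite_self, zero_add]
      rw [← pickSum_smul, pickSum_ite]
      refine pickSum_congr fun e' R' pe' => ?_
      have p2 : (e :: e' :: R').Perm L := (pe'.cons e).trans pe
      have h4 := h.edges_perm p2.symm
      by_cases he' : e'.1 ≠ e'.2
      · have key : ∀ t, (if IsHairy ⟨u :: vs, det u e s :: R⟩ then
            edgeSign n • x ⟨w :: u :: vs, det w e' t :: det u e s :: R'⟩ else 0) =
            if (e.1 ≠ e.2 ∧ e'.1 ≠ e'.2) ∧ val L (att e s) ≠ 3 then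
              edgeSign n • x ⟨w :: u :: vs, det w e' t :: det u e s :: R'⟩ else 0 := by
          intro t
          by_cases h5 : IsHairy ⟨w :: u :: vs, det w e' t :: det u e s :: R'⟩
          · refine if_congr ?_ rfl rfl
            rw [← val_perm p2, ← h4.det_iff_of_det_det hu hw h5]
            have p3 := pe'.cons (det u e s)
            exact ⟨fun h6 => ⟨⟨he, he'⟩, h6.edges_perm p3.symm⟩, fun h6 => h6.2.edges_perm p3⟩
          · rw [coeff_eq_zero hx h5, smul_zero, ite_self, ite_self]
        rw [if_pos he', Finset.smul_sum, ← Finset.sum_congr rfl fun t _ => key t]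
        split_ifs
        · rfl
        · exact Finset.sum_const_zero.symm
      · simp [he']
    · rw [if_neg he]
      refine (Finset.sum_eq_zero fun s _ => pickSum_eq_zero fun e' R' _ => ?_).symm
      simp [he]
  rw [h1]
  refine pickSum_pickSum_eq_zero fun e e' R p => ?_
  have h' := h.edges_perm p.symm
  rw [Finset.sum_comm, Finset.smul_sum, ← Finset.sum_add_distrib]
  refine Finset.sum_eq_zero fun t _ => ?_
  rw [Finset.smul_sum, ← Finset.sum_add_distrib]
  refine Finset.sum_eq_zero fun s _ => ?_
  have h2 := coeff_det_det hx hm h' hu hw s t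
  by_cases h5 : IsHairy ⟨w :: u :: vs, det w e' t :: det u e s :: R⟩
  -- The intermediate graphs of the two orders are admissible simultaneously: either both
  -- detachments occur at one vertex, or neither vertex can be trivalent.
  · have h3 : val L (att e s) ≠ 3 ↔ val L (att e' t) ≠ 3 := by
      rw [← val_perm p, ← val_perm p]
      by_cases h6 : att e s = att e' t
      · rw [h6]
      · exact iff_of_true
          (h5.val_ne_three_of_det_det hu hw (h'.att_mem (by simp)) (Or.inl ⟨rfl, Ne.symm h6⟩))
          (h5.val_ne_three_of_det_det hu hw (h'.att_mem (by simp)) (Or.inr ⟨h6, rfl⟩))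
    by_cases h6 : (e.1 ≠ e.2 ∧ e'.1 ≠ e'.2) ∧ val L (att e s) ≠ 3
    · rw [if_pos h6, if_pos ⟨h6.1.symm, h3.1 h6.2⟩, h2, smul_neg, neg_add_cancel]
    · rw [if_neg h6, if_neg fun h7 => h6 ⟨h7.1.symm, h3.2 h7.2⟩, smul_zero, add_zero]
  · rw [coeff_eq_zero hx h5] at h2 ⊢
    have h3 := neg_eq_zero.1 h2.symm
    rw [h3]
    simp

end Hair

/-! ### The two composites of `δ` and `Δ`, and parallel edges -/

open LGraph

namespace LGraph

variable {m n : ℤ} {vs : List ℕ} {u : ℕ} {e e' : ℕ × ℕ} {s : Bool} {R L : List (ℕ × ℕ)}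

/-- The degrees of the vertices of a graph with edges `L`, with an additional hair `u`. -/
def extDeg (m n : ℤ) (L : List (ℕ × ℕ)) (u v : ℕ) : ℤ := if v = u then m else hdeg m n L v

theorem extDeg_self : extDeg m n L u u = m := if_pos rfl

theorem extDeg_of_ne {v : ℕ} (h : v ≠ u) : extDeg m n L u v = hdeg m n L v := if_neg h

/-- The odd hair in front is the source of the relative sign between the two composites. -/
theorem conSign_extDeg (hm : Odd m) (hu : u ∉ vs) {b : ℕ} (hb : b ∈ vs) :
    conSign n (extDeg m n L u) (u :: vs) b = -conSign n (hdeg m n L) vs b := by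
  rw [conSign_cons (ne_of_mem_of_not_mem hb hu).symm (by rwa [extDeg_self])]
  congr 1
  exact conSign_congr (fun v hv => extDeg_of_ne (ne_of_mem_of_not_mem hv hu)) b

theorem erase_cons_fresh (hu : u ∉ vs) {b : ℕ} (hb : b ∈ vs) :
    (u :: vs).erase b = u :: vs.erase b :=
  List.erase_cons_tail (by simpa using (ne_of_mem_of_not_mem hb hu).symm)

theorem mergeE_det {a b : ℕ} (hu : u ≠ b) : mergeE a b (det u e s) = det u (mergeE a b e) s :=
  det_map_of_ne (merge_of_ne hu) e s

/-- A graph is connected if the contraction of one of its edges is. -/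
theorem IsHairy.conn_of_contr {ws : List ℕ} {M : List (ℕ × ℕ)} (he : e.1 ∈ ws) (hne : e.1 ≠ e.2)
    (hws : ws.Nodup) (h : IsHairy ⟨ws.erase e.2, M.map (mergeE e.1 e.2)⟩) {L' : List (ℕ × ℕ)}
    (hL' : (e :: M).Perm L') :
    ∀ a ∈ ws, ∀ b ∈ ws, Conn L' a b := by
  have hm : ∀ v, Conn L' (merge e.1 e.2 v) v :=
    conn_merge (Conn.of_mem (hL'.mem_iff.1 List.mem_cons_self))
  have hmem : ∀ a ∈ ws, merge e.1 e.2 a ∈ ws.erase e.2 := by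
    intro a ha
    rw [List.Nodup.mem_erase_iff hws, merge]
    split_ifs with h1
    · exact ⟨hne, he⟩
    · exact ⟨h1, ha⟩
  intro a ha b hb
  have h1 := h.connected _ (hmem a ha) _ (hmem b hb)
  have h2 := Conn.map (L' := L') (g := id) (fun f hf => by
    obtain ⟨f, hf', rfl⟩ := List.mem_map.1 hf
    exact (hm f.1).trans ((Conn.of_mem (hL'.mem_iff.1 (List.mem_cons_of_mem _ hf'))).trans
      (hm f.2).symm)) h1
  exact (hm a).symm.trans (h2.trans (hm b))

end LGraph

section Anticommute

variable {K : Type*} [Field K] {m n : ℤ} {x : LGraph → K}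

/-- The coefficient of the graph obtained by contracting `e` and detaching `e'`. -/
def recTerm (m n : ℤ) (x : LGraph → K) (L : List (ℕ × ℕ)) (vs : List ℕ) (u : ℕ) (e e' : ℕ × ℕ)
    (R : List (ℕ × ℕ)) (s : Bool) : K :=
  con n x (extDeg m n L u) (u :: vs) e (det u e' s :: R)

variable {vs : List ℕ} {L : List (ℕ × ℕ)} {u : ℕ}

-- Here `e` is contracted before `e'` is detached. Contraction always gives a hairy graph, so the
-- only pairs lost are those where `e'` becomes a tadpole.
open Classical in
theorem splitDiff_hairDiff_apply (hx : x ∈ hairyGraphs K m n) (hm : Odd m)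
    (h : IsHairy ⟨vs, L⟩) (hu : u ∉ vs) :
    splitDiff K m n (hairDiff K x) ⟨vs, L⟩ = -pickSum (edgeSign n) (fun e R =>
      pickSum (edgeSign n) (fun e' R' => ∑ s,
        if (Contr L e ∧ e'.1 ≠ e'.2) ∧ ¬ Parallel e e' then recTerm m n x L vs u e e' R' s
        else 0) R) L := by
  rw [splitDiff_apply _ h]
  have hneg : ∀ y : K, -y = (-1 : ℤˣ) • y := fun y => by rw [Units.neg_smul, one_smul]
  rw [hneg, ← pickSum_smul]
  refine pickSum_congr fun e R p => ?_
  by_cases hc : Contr L e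
  swap
  · rw [if_neg hc, pickSum_eq_zero, smul_zero]
    intro e' R' _
    simp [hc]
  have h' := h.edges_perm p.symm
  have hc' : Contr (e :: R) e := by rwa [contr_perm p]
  have he := h'.mem e (by simp)
  rw [if_pos hc, con, hairDiff_apply_det hx (h'.contr hc') (fun hu' => hu (List.mem_of_mem_erase hu')),
    pickSum_map, ← pickSum_smul, ← pickSum_smul]
  refine pickSum_congr fun e' R' _ => ?_
  rw [Finset.smul_sum]
  by_cases hp : Parallel e e'
  · rw [if_neg (by simpa using hp), smul_zero, Finset.sum_eq_zero]
    intro s _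
    simp [hp]
  · have hne : e'.1 ≠ e'.2 := fun h => hp (by rw [Parallel, h])
    rw [if_pos (by simpa using hp), Finset.smul_sum]
    refine Finset.sum_congr rfl fun s _ => ?_
    rw [if_pos ⟨⟨hc, hne⟩, hp⟩, recTerm, con, conSign_extDeg hm hu he.2, erase_cons_fresh hu he.2,
      List.map_cons, mergeE_det (ne_of_mem_of_not_mem he.2 hu).symm, smul_smul,
      neg_one_mul, neg_neg]

-- Here `e'` is detached before `e` is contracted, so the intermediate graph has to be hairy. The
-- double sum is then brought to the order of `splitDiff_hairDiff_apply`.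
open Classical in
theorem hairDiff_splitDiff_apply (hx : x ∈ hairyGraphs K m n) (h : IsHairy ⟨vs, L⟩)
    (hu : u ∉ vs) :
    hairDiff K (splitDiff K m n x) ⟨vs, L⟩ = pickSum (edgeSign n) (fun e R =>
      pickSum (edgeSign n) (fun e' R' => ∑ s,
        if (Contr L e ∧ e'.1 ≠ e'.2) ∧ val L (att e' s) ≠ 3 then recTerm m n x L vs u e e' R' s
        else 0) R) L := by
  rw [hairDiff_apply_det (splitDiff_mem hx) h hu]
  have h1 : ∀ e' R, (e' :: R).Perm L →
      (if e'.1 ≠ e'.2 then ∑ s, splitDiff K m n x ⟨u :: vs, det u e' s :: R⟩ else 0) =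
      edgeSign n • pickSum (edgeSign n) (fun e R' => ∑ s,
        if (Contr L e ∧ e'.1 ≠ e'.2) ∧ val L (att e' s) ≠ 3 then recTerm m n x L vs u e e' R' s
        else 0) R := by
    intro e' R p
    by_cases hne : e'.1 ≠ e'.2
    swap
    · rw [if_neg hne, pickSum_eq_zero, smul_zero]
      intro e R' _
      simp [hne]
    have h' := h.edges_perm p.symm
    rw [if_pos hne, pickSum_sum, Finset.smul_sum]
    refine Finset.sum_congr rfl fun s _ => ?_
    by_cases hh : IsHairy ⟨u :: vs, det u e' s :: R⟩
    · have hval : val L (att e' s) ≠ 3 := by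
        rw [← val_perm p]
        exact (h'.det_iff hu hh.connected).1 hh
      -- The new hair has a univalent end and is never contracted, so the head term drops out.
      have h0 : ¬ Contr (det u e' s :: R) (det u e' s) := by
        intro hc
        have := h'.val_det_fresh (s := s) hu
        cases s
        · exact hc.2.1 this
        · exact hc.2.2 this
      rw [splitDiff_apply _ hh, pickSum, if_neg h0, zero_add]
      congr 1
      refine pickSum_congr fun e R' p' => ?_
      have he := h'.mem e (List.mem_cons_of_mem _ (p'.mem_iff.1 List.mem_cons_self))
      have h1 : Contr (det u e' s :: R) e ↔ Contr L e := by
        have h2 := h'.val_det_eq_one_iff hu hh he.1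
        have h3 := h'.val_det_eq_one_iff hu hh he.2
        rw [val_perm p] at h2 h3
        simp only [Contr, ne_eq, h2, h3]
      refine if_congr (by rw [h1]; tauto) ?_ rfl
      rw [recTerm, con, con]
      congr 1
      refine conSign_congr (fun v hv => ?_) _
      rcases List.mem_cons.1 hv with rfl | hv
      · rw [extDeg_self, hdeg, if_pos (h'.val_det_fresh hu)]
      · rw [extDeg_of_ne (ne_of_mem_of_not_mem hv hu), h'.hdeg_det hu hh hv, hdeg_perm p]
    -- Without a trivalent vertex at the detached end, the intermediate graph can fail to be hairy
    -- only by being disconnected; contracting `e` does not repair this, so the extra terms are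
    -- zero.
    · rw [splitDiff_of_not_hairy hh, pickSum_eq_zero, smul_zero]
      intro e R' p'
      by_cases hc : (Contr L e ∧ e'.1 ≠ e'.2) ∧ val L (att e' s) ≠ 3
      swap
      · rw [if_neg hc]
      have he := h'.mem e (List.mem_cons_of_mem _ (p'.mem_iff.1 List.mem_cons_self))
      rw [if_pos hc, recTerm, con, coeff_eq_zero hx, smul_zero]
      intro h2
      have h3 := IsHairy.conn_of_contr (L' := det u e' s :: R) (List.mem_cons_of_mem _ he.1)
        hc.1.1.1 (List.nodup_cons.2 ⟨hu, h.nodup⟩) h2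
        ((List.Perm.swap _ _ _).trans (p'.cons _))
      exact hh ((h'.det_iff hu h3).2 (by rw [val_perm p]; exact hc.2))
  rw [pickSum_congr h1, pickSum_smul, pickSum_pickSum_comm
    (G := fun e' e R' => ∑ s, if (Contr L e ∧ e'.1 ≠ e'.2) ∧ val L (att e' s) ≠ 3 then
      recTerm m n x L vs u e e' R' s else 0), units_smul_smul_self]

/-- Contracting `e` in the opposite direction after detaching an adjacent edge. -/
theorem recTerm_swap_left (hx : x ∈ hairyGraphs K m n) (h : IsHairy ⟨vs, L⟩) (hu : u ∉ vs)
    {e e' : ℕ × ℕ} {R : List (ℕ × ℕ)} (p : (e :: e' :: R).Perm L) (hc : Contr L e) {s : Bool}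
    (hs : att e' s = e.1 ∨ att e' s = e.2) :
    recTerm m n x L vs u e.swap e' R s = n.negOnePow • recTerm m n x L vs u e e' R s := by
  have h' := h.edges_perm p.symm
  have he := h'.mem e (by simp)
  have hu1 := (ne_of_mem_of_not_mem he.1 hu)
  have hu2 := (ne_of_mem_of_not_mem he.2 hu)
  refine con_swap hx (List.nodup_cons.2 ⟨hu, h.nodup⟩) (List.mem_cons_of_mem _ he.1)
    (List.mem_cons_of_mem _ he.2) hc.1 ?_ ?_ fun v hv hv2 => ?_
  · rw [extDeg_of_ne hu1, hdeg_of_ne_one hc.2.1]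
  · rw [extDeg_of_ne hu2, hdeg_of_ne_one hc.2.2]
  · have key : ∀ w, val (det u e' s :: R) w + (if att e' s = w then 1 else 0) +
        (if e.1 = w then 1 else 0) + (if e.2 = w then 1 else 0) =
        val L w + (if u = w then 1 else 0) := by
      intro w
      rw [val_det, ← val_perm p, val_cons e]
      omega
    rcases List.mem_cons.1 hv with rfl | hv
    · have h1 := key v
      rw [h.val_of_not_mem hu, if_pos rfl, if_neg hu1, if_neg hu2, if_neg] at h1
      · rw [extDeg_self, hdeg, if_pos]
        rw [val_mergeE hc.1, if_neg hv2, if_neg hu1.symm]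
        exact h1
      · rcases hs with hs | hs <;> rwa [hs]
    · rw [extDeg_of_ne (ne_of_mem_of_not_mem hv hu)]
      by_cases hv1 : v = e.1
      · subst hv1
        -- As `e'` is detached from an end of `e`, the merged vertex has valence at least `3 + 3 - 2
        -- - 1 = 3`, and no other old vertex changes valence.
        rw [hdeg_of_ne_one hc.2.1, hdeg_of_ne_one]
        rw [val_mergeE hc.1, if_neg hv2, if_pos rfl]
        have h1 := key e.1
        have h2 := key e.2
        have h3 := h.three_le_val he.1 hc.2.1
        have h4 := h.three_le_val he.2 hc.2.2
        rw [if_neg hu1.symm, if_pos rfl, if_neg hc.1.symm] at h1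
        rw [if_neg hu2.symm, if_neg hc.1, if_pos rfl] at h2
        rcases hs with hs | hs
        · rw [hs, if_pos rfl] at h1
          rw [hs, if_neg hc.1] at h2
          omega
        · rw [hs, if_neg hc.1.symm] at h1
          rw [hs, if_pos rfl] at h2
          omega
      · refine hdeg_congr ?_
        rw [val_mergeE hc.1, if_neg hv2, if_neg hv1]
        have h1 := key v
        rw [if_neg (Ne.symm hv1), if_neg (Ne.symm hv2),
          if_neg (ne_of_mem_of_not_mem hv hu).symm, if_neg] at h1
        · exact h1
        · rcases hs with hs | hs <;> rw [hs]
          · exact Ne.symm hv1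
          · exact Ne.symm hv2

theorem recTerm_swap_right (hx : x ∈ hairyGraphs K m n) (e e' : ℕ × ℕ) (R : List (ℕ × ℕ))
    (s : Bool) :
    recTerm m n x L vs u e e'.swap R s = n.negOnePow • recTerm m n x L vs u e e' R (!s) := by
  rw [recTerm, recTerm, det_swap]
  exact con_flipEq hx _ _ _ [] R _

/-- After the contraction, `e'` is a tadpole, and detaching either of its ends gives the same hair
with opposite directions. -/
theorem recTerm_parallel (hx : x ∈ hairyGraphs K m n) {e e' : ℕ × ℕ} (hp : Parallel e e')
    (hu : u ≠ e.2) (R : List (ℕ × ℕ)) :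
    recTerm m n x L vs u e e' R false = n.negOnePow • recTerm m n x L vs u e e' R true := by
  have h1 := coeff_flip_head hx ((u :: vs).erase e.2) (merge e.1 e.2 e'.1) u
    (R.map (mergeE e.1 e.2))
  simp only [recTerm, con, List.map_cons, det, Prod.map_apply, merge_of_ne hu]
  rw [← hp, h1, smul_comm]

-- With `ε` the edge sign, the two ends of `e'` contribute a factor `1 - ε` and the exchange of `e`
-- and `e'` a factor `1 + ε`; their product is zero.
open Classical in
theorem pickSum_recTerm_parallel (hx : x ∈ hairyGraphs K m n) (h : IsHairy ⟨vs, L⟩)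
    (hu : u ∉ vs) :
    pickSum (edgeSign n) (fun e R => pickSum (edgeSign n) (fun e' R' => ∑ s,
      if (Contr L e ∧ e'.1 ≠ e'.2) ∧ Parallel e e' then recTerm m n x L vs u e e' R' s
      else 0) R) L = 0 := by
  refine pickSum_pickSum_eq_zero fun e e' R p => ?_
  have h' := h.edges_perm p.symm
  have he := h'.mem e (by simp)
  have hu2 := (ne_of_mem_of_not_mem he.2 hu).symm
  by_cases hc : (Contr L e ∧ e'.1 ≠ e'.2) ∧ Parallel e e'
  · have hc' : (Contr L e' ∧ e.1 ≠ e.2) ∧ Parallel e' e := by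
      refine ⟨⟨?_, hc.1.1.1⟩, (parallel_comm hc.1.1.1 hc.1.2).1 hc.2⟩
      rcases (parallel_iff hc.1.2).1 hc.2 with rfl | rfl
      · exact hc.1.1
      · exact contr_swap.2 hc.1.1
    simp only [if_pos hc, if_pos hc', Fintype.sum_bool]
    rcases (parallel_iff hc.1.2).1 hc.2 with rfl | rfl
    · rw [recTerm_parallel hx hc.2 hu2, negOnePow_eq_neg_edgeSign, Units.neg_smul, smul_add,
        smul_neg, units_smul_smul_self]
      abel
    -- Oppositely directed parallel edges reduce to the case of equal ones by reversals.
    · have hp : Parallel e e := by simp [Parallel, merge]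
      rw [recTerm_swap_right hx e e, recTerm_swap_right hx e e]
      have h1 : ∀ s, recTerm m n x L vs u e.swap e R s =
          n.negOnePow • recTerm m n x L vs u e e R s := by
        intro s
        have h2 := recTerm_swap_right hx (vs := vs) (L := L) (u := u) e.swap e.swap R s
        rw [Prod.swap_swap] at h2
        rw [h2, recTerm_swap_left hx h hu p hc.1.1 (by cases s <;> simp [att]),
          recTerm_swap_right hx e e, Bool.not_not, smul_smul, Int.units_mul_self, one_smul]
      rw [h1, h1, Bool.not_true, Bool.not_false, recTerm_parallel hx hp hu2,
        negOnePow_eq_neg_edgeSign]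
      simp only [Units.neg_smul, smul_add, smul_neg, units_smul_smul_self, neg_neg]
      abel
  · have hc' : ¬ ((Contr L e' ∧ e.1 ≠ e.2) ∧ Parallel e' e) := by
      intro hc'
      refine hc ⟨⟨?_, hc'.1.1.1⟩, (parallel_comm hc'.1.1.1 hc'.1.2).1 hc'.2⟩
      rcases (parallel_iff hc'.1.2).1 hc'.2 with h1 | h1
      · exact h1 ▸ hc'.1.1
      · exact h1 ▸ contr_swap.2 hc'.1.1
    simp [if_neg hc, if_neg hc']

end Anticommute

open LGraph

/-! ### Detaching at trivalent vertices, and anticommutation -/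

section Trivalent

variable {K : Type*} [Field K] {m n : ℤ} {x : LGraph → K}

theorem pickSum_exists {α M : Type*} [AddCommGroup M] {ε : ℤˣ} {G : α → List α → M} {L : List α}
    (h : pickSum ε G L ≠ 0) : ∃ e R, (e :: R).Perm L ∧ G e R ≠ 0 := by
  by_contra! h'
  exact h (pickSum_eq_zero h')

theorem Koszul.sum {ι α M : Type*} [AddCommGroup M] {ε : ℤˣ} (S : Finset ι) {φ : ι → List α → M}
    (h : ∀ i ∈ S, Koszul ε (φ i)) : Koszul ε fun l => ∑ i ∈ S, φ i l := by
  intro l l' a b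
  rw [Finset.smul_sum]
  exact Finset.sum_congr rfl fun i hi => h i hi l l' a b

/-- Exchanging two univalent vertices of odd degree at arbitrary positions. -/
theorem coeff_swap_hairs_middle (hx : x ∈ hairyGraphs K m n) (hm : Odd m) {u w : ℕ}
    {M : List (ℕ × ℕ)} (hu : val M u = 1) (hw : val M w = 1) (k₁ k₂ : List ℕ) :
    x ⟨w :: (k₁ ++ u :: k₂), M⟩ = -x ⟨u :: (k₁ ++ w :: k₂), M⟩ := by
  have hdu : hdeg m n M u = m := if_pos hu
  have hdw : hdeg m n M w = m := if_pos hw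
  have h1 := coeff_move hx (d := hdeg m n M) (a := u) rfl (fun v _ => rfl) [w] k₂ (l₂ := k₁)
  have h2 := coeff_move hx (d := hdeg m n M) (a := w) rfl (fun v _ => rfl) [u] k₂ (l₂ := k₁)
  simp only [List.cons_append, List.nil_append, hdu, hdw] at h1 h2
  rw [h1, h2, coeff_swap_hairs hx hm hu hw, smul_neg]

/-- The contribution to the sum of the coefficients `recTerm` of a pair of edges at `v`. -/
def vertexTerm (m n : ℤ) (x : LGraph → K) (L : List (ℕ × ℕ)) (vs : List ℕ) (u v : ℕ)
    (e e' : ℕ × ℕ) (R : List (ℕ × ℕ)) : K :=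
  ∑ s, if ((Contr L e ∧ e'.1 ≠ e'.2) ∧ (e.1 = v ∨ e.2 = v)) ∧ att e' s = v then
    recTerm m n x L vs u e e' R s else 0

variable {vs : List ℕ} {L : List (ℕ × ℕ)} {u v : ℕ} {e e' : ℕ × ℕ} {R : List (ℕ × ℕ)}

theorem vertexTerm_ne_zero (h : vertexTerm m n x L vs u v e e' R ≠ 0) :
    (e.1 ≠ e.2 ∧ e'.1 ≠ e'.2) ∧ (e.1 = v ∨ e.2 = v) ∧ (e'.1 = v ∨ e'.2 = v) := by
  obtain ⟨s, -, hs⟩ := Finset.exists_ne_zero_of_sum_ne_zero h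
  have hc := (ne_eq _ _ ▸ (ite_ne_right_iff.1 hs)).1
  refine ⟨⟨hc.1.1.1.1, hc.1.1.2⟩, hc.1.2, ?_⟩
  cases s
  · exact Or.inl hc.2
  · exact Or.inr hc.2

theorem vertexTerm_koszul (hx : x ∈ hairyGraphs K m n) :
    Koszul (edgeSign n) (vertexTerm m n x L vs u v e e') :=
  Koszul.sum _ fun _ _ => Koszul.ite _ ((con_koszul hx _ _ _).cons _) koszul_zero

theorem vertexTerm_swap_left (hx : x ∈ hairyGraphs K m n) (h : IsHairy ⟨vs, L⟩) (hu : u ∉ vs)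
    (p : (e :: e' :: R).Perm L) :
    vertexTerm m n x L vs u v e.swap e' R = n.negOnePow • vertexTerm m n x L vs u v e e' R := by
  rw [vertexTerm, vertexTerm, Finset.smul_sum]
  refine Finset.sum_congr rfl fun s _ => ?_
  by_cases hc : ((Contr L e ∧ e'.1 ≠ e'.2) ∧ (e.1 = v ∨ e.2 = v)) ∧ att e' s = v
  · rw [if_pos hc, if_pos ⟨⟨⟨contr_swap.2 hc.1.1.1, hc.1.1.2⟩, hc.1.2.symm⟩, hc.2⟩]
    refine recTerm_swap_left hx h hu p hc.1.1.1 ?_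
    rw [hc.2]
    exact hc.1.2.imp Eq.symm Eq.symm
  · rw [if_neg hc, if_neg, smul_zero]
    exact fun hc' => hc ⟨⟨⟨contr_swap.1 hc'.1.1.1, hc'.1.1.2⟩, hc'.1.2.symm⟩, hc'.2⟩

theorem vertexTerm_swap_right (hx : x ∈ hairyGraphs K m n) :
    vertexTerm m n x L vs u v e e'.swap R = n.negOnePow • vertexTerm m n x L vs u v e e' R := by
  rw [vertexTerm, vertexTerm, Finset.smul_sum, ← Equiv.sum_comp Equiv.boolNot]
  refine Finset.sum_congr rfl fun s _ => ?_
  rw [smul_ite, smul_zero]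
  refine if_congr ?_ ?_ rfl
  · rw [att_swap]
    simp only [Equiv.boolNot_apply, Bool.not_not, Prod.fst_swap, Prod.snd_swap, ne_comm]
  · rw [recTerm_swap_right hx]
    simp

theorem vertexTerm_swap_head (hx : x ∈ hairyGraphs K m n) {f : ℕ × ℕ} :
    vertexTerm m n x L vs u v e e' (f.swap :: R) =
      n.negOnePow • vertexTerm m n x L vs u v e e' (f :: R) := by
  rw [vertexTerm, vertexTerm, Finset.smul_sum]
  refine Finset.sum_congr rfl fun s _ => ?_
  rw [smul_ite, smul_zero]
  refine if_congr Iff.rfl ?_ rfl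
  exact con_flipEq hx _ _ _ [_] R _

/-- The contribution of the edges `f`, `g` and `h` at a trivalent vertex `v`. -/
def tripleTerm (m n : ℤ) (x : LGraph → K) (L : List (ℕ × ℕ)) (vs : List ℕ) (u v : ℕ)
    (f g h : ℕ × ℕ) (R : List (ℕ × ℕ)) : K :=
  vertexTerm m n x L vs u v f g (h :: R) + edgeSign n • vertexTerm m n x L vs u v f h (g :: R) +
  (edgeSign n • vertexTerm m n x L vs u v g f (h :: R) + vertexTerm m n x L vs u v g h (f :: R)) +
  (vertexTerm m n x L vs u v h f (g :: R) + edgeSign n • vertexTerm m n x L vs u v h g (f :: R))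

variable {f g h : ℕ × ℕ}

theorem tripleTerm_comm_left :
    tripleTerm m n x L vs u v g f h R = edgeSign n • tripleTerm m n x L vs u v f g h R := by
  simp only [tripleTerm, smul_add, units_smul_smul_self]
  abel

theorem tripleTerm_comm_right :
    tripleTerm m n x L vs u v f h g R = edgeSign n • tripleTerm m n x L vs u v f g h R := by
  simp only [tripleTerm, smul_add, units_smul_smul_self]
  abel

theorem tripleTerm_swap (hx : x ∈ hairyGraphs K m n) (hL : IsHairy ⟨vs, L⟩) (hu : u ∉ vs)
    (p : (f :: g :: h :: R).Perm L) :
    tripleTerm m n x L vs u v f.swap g h R = n.negOnePow • tripleTerm m n x L vs u v f g h R := by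
  simp only [tripleTerm, vertexTerm_swap_left hx hL hu p,
    vertexTerm_swap_left hx hL hu (((List.Perm.swap g h R).cons f).trans p),
    vertexTerm_swap_right hx, vertexTerm_swap_head hx, smul_add]
  simp only [smul_comm (edgeSign n)]

/-- With all three edges directed towards `v`, contracting the first and detaching the second leaves
a hair at `q` and an edge joining `r` and `p`. -/
theorem vertexTerm_normal (hu : u ∉ vs) (hv : v ∈ vs) (hLv : val L v ≠ 1) {p q r : ℕ}
    (hpv : p ≠ v) (hqv : q ≠ v) (hrv : r ≠ v) {B : List (ℕ × ℕ)} (hB : val B v = 0) :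
    vertexTerm m n x L vs u v (p, v) (q, v) ((r, v) :: B) = if val L p = 1 then 0 else
      conSign n (extDeg m n L u) (u :: vs) v • x ⟨u :: vs.erase v, (q, u) :: (r, p) :: B⟩ := by
  have huv := (ne_of_mem_of_not_mem hv hu).symm
  rw [vertexTerm, Fintype.sum_bool]
  have h1 : att (q, v) true = v := rfl
  have h2 : ¬ att (q, v) false = v := hqv
  rw [if_neg (c := _ ∧ att (q, v) false = v) fun hc => h2 hc.2, add_zero]
  by_cases h3 : val L p = 1
  · rw [if_pos h3, if_neg]
    exact fun hc => hc.1.1.1.2.1 h3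
  · rw [if_neg h3, if_pos ⟨⟨⟨⟨hpv, h3, hLv⟩, hqv⟩, Or.inr rfl⟩, h1⟩, recTerm, con,
      erase_cons_fresh hu hv, List.map_cons, List.map_cons, mergeE_of_val_eq_zero hB]
    simp only [det, Prod.map_apply, merge_self, merge_of_ne hqv, merge_of_ne hrv,
      merge_of_ne huv]

/-- If no neighbour of `v` is univalent, the six terms cancel in pairs with the same detached edge.
A univalent neighbour removes terms, since its edge is not contractible; the survivors are
disconnected, or cancel by exchanging two hairs. -/
theorem tripleTerm_normal (hx : x ∈ hairyGraphs K m n) (hm : Odd m) (hL : IsHairy ⟨vs, L⟩)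
    (hu : u ∉ vs) (hv : v ∈ vs) (hLv : val L v ≠ 1) {p q r : ℕ}
    (hpv : p ≠ v) (hqv : q ≠ v) (hrv : r ≠ v) {B : List (ℕ × ℕ)} (hB : val B v = 0)
    (hp : ((p, v) :: (q, v) :: (r, v) :: B).Perm L) :
    tripleTerm m n x L vs u v (p, v) (q, v) (r, v) B = 0 := by
  have huv := (ne_of_mem_of_not_mem hv hu).symm
  have hL' := hL.edges_perm hp.symm
  have hmp := (hL'.mem (p, v) (by simp)).1
  have hmq := (hL'.mem (q, v) (by simp)).1
  have hmr := (hL'.mem (r, v) (by simp)).1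
  simp only at hmp hmq hmr
  have hvalL : ∀ w, w ≠ v → val L w = val B w + (if r = w then 1 else 0) +
      (if q = w then 1 else 0) + (if p = w then 1 else 0) := by
    intro w hw
    rw [← val_perm hp, val_cons, val_cons, val_cons]
    simp only [if_neg (Ne.symm hw), add_zero]
  have hBu : val B u = 0 := by
    have := hvalL u huv
    rw [hL.val_of_not_mem hu] at this
    omega
  let Y : ℕ → ℕ → ℕ → K := fun p q r => x ⟨u :: vs.erase v, (q, u) :: (r, p) :: B⟩
  -- Contracting the edge at `r` instead of the one at `p` gives the same graph with the remaining
  -- edge reversed.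
  have hflip : ∀ p q r, Y r q p = n.negOnePow • Y p q r := fun p q r =>
    coeff_flip hx (u :: vs.erase v) [(q, u)] B (r, p)
  -- Detaching the edge of a univalent `q` splits off the component of `q` and `u`.
  have hdisc : ∀ p q r, p ∈ vs → p ≠ v → p ≠ q → r ≠ q → p ≠ u → r ≠ u → val B q = 0 →
      Y p q r = 0 := by
    intro p q r hpm hpv hpq hrq hpu hru hBq
    refine coeff_eq_zero hx fun hh => ?_
    have := hh.mem_of_closed (S := {q, u}) (fun f hf => ?_) (a := u) (by simp) (by simp)
      (b := p) (List.mem_cons_of_mem _ ((List.Nodup.mem_erase_iff hL.nodup).2 ⟨hpv, hpm⟩))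
    · rcases this with h1 | h1
      · exact hpq h1
      · exact hpu h1
    · simp only [List.mem_cons] at hf
      rcases hf with rfl | rfl | hf
      · simp
      · simp [hpq, hrq, hpu, hru]
      · have h1 := val_eq_zero.1 hBq f hf
        have h2 := val_eq_zero.1 hBu f hf
        simp [h1, h2]
  have hsw : ∀ p q r, r ∈ vs → r ≠ v → p ≠ u → q ≠ u → r ≠ u → p ≠ r → q ≠ r → val B r = 0 →
      Y q p r = -(edgeSign n • Y p q r) := by
    intro p q r hrm hrv hpu hqu hru hpr hqr hBr
    have h1 := coeff_relabel hx (Equiv.swap u r) (u :: vs.erase v) ((p, u) :: (r, q) :: B)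
    have hrw : r ∈ vs.erase v := (List.Nodup.mem_erase_iff hL.nodup).2 ⟨hrv, hrm⟩
    have huw : u ∉ vs.erase v := fun hh => hu (List.mem_of_mem_erase hh)
    obtain ⟨k₁, k₂, hk, hk1, hk2⟩ := exists_append_of_mem (hL.nodup.erase v) hrw
    rw [hk] at huw
    simp only [List.mem_append, List.mem_cons, not_or] at huw
    simp only [Y]
    rw [← h1, hk]
    simp only [List.map_cons, List.map_append, Prod.map_apply, Equiv.swap_apply_left,
      Equiv.swap_apply_right, Equiv.swap_apply_of_ne_of_ne hpu hpr,
      Equiv.swap_apply_of_ne_of_ne hqu hqr, mapE_swap_of_val hBu hBr,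
      map_swap_of_not_mem huw.1 hk1, map_swap_of_not_mem huw.2.2 hk2]
    have hvu : val ((q, u) :: (r, p) :: B) u = 1 := by
      simp [val_cons, hBu, hpu, hqu, hru]
    have hvr : val ((q, u) :: (r, p) :: B) r = 1 := by
      simp [val_cons, hBr, hpr, hqr, hru.symm]
    have h3 : x ⟨r :: (k₁ ++ u :: k₂), (r, p) :: (u, q) :: B⟩ =
        n.negOnePow • x ⟨r :: (k₁ ++ u :: k₂), (r, p) :: (q, u) :: B⟩ :=
      coeff_flip hx (r :: (k₁ ++ u :: k₂)) [(r, p)] B (q, u)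
    rw [coeff_flip_head hx, h3, units_smul_smul_self, coeff_swap_head hx _ (q, u) (r, p), coeff_swap_hairs_middle hx hm hvu hvr, smul_neg]
  have hpu := ne_of_mem_of_not_mem hmp hu
  have hqu := ne_of_mem_of_not_mem hmq hu
  have hru := ne_of_mem_of_not_mem hmr hu
  have hPs : val L p = 1 → (q ≠ p ∧ r ≠ p) ∧ val B p = 0 := by
    intro h1
    have h2 := hvalL p hpv
    rw [h1, if_pos rfl] at h2
    refine ⟨⟨fun h3 => ?_, fun h3 => ?_⟩, by omega⟩
    · rw [if_pos h3] at h2; omega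
    · rw [if_pos h3] at h2; omega
  have hQs : val L q = 1 → (p ≠ q ∧ r ≠ q) ∧ val B q = 0 := by
    intro h1
    have h2 := hvalL q hqv
    rw [h1, if_pos (c := q = q) rfl] at h2
    refine ⟨⟨fun h3 => ?_, fun h3 => ?_⟩, by omega⟩
    · rw [if_pos h3] at h2; omega
    · rw [if_pos h3] at h2; omega
  have hRs : val L r = 1 → (p ≠ r ∧ q ≠ r) ∧ val B r = 0 := by
    intro h1
    have h2 := hvalL r hrv
    rw [h1, if_pos (c := r = r) rfl] at h2
    refine ⟨⟨fun h3 => ?_, fun h3 => ?_⟩, by omega⟩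
    · rw [if_pos h3] at h2; omega
    · rw [if_pos h3] at h2; omega
  rw [tripleTerm]
  simp only [vertexTerm_normal hu hv hLv hpv hqv hrv hB, vertexTerm_normal hu hv hLv hpv hrv hqv hB,
    vertexTerm_normal hu hv hLv hqv hpv hrv hB, vertexTerm_normal hu hv hLv hqv hrv hpv hB,
    vertexTerm_normal hu hv hLv hrv hpv hqv hB, vertexTerm_normal hu hv hLv hrv hqv hpv hB]
  change (if val L p = 1 then 0 else _ • Y p q r) +
    edgeSign n • (if val L p = 1 then 0 else _ • Y p r q) +
    (edgeSign n • (if val L q = 1 then 0 else _ • Y q p r) +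
    (if val L q = 1 then 0 else _ • Y q r p)) +
    ((if val L r = 1 then 0 else _ • Y r p q) +
    edgeSign n • (if val L r = 1 then 0 else _ • Y r q p)) = 0
  generalize conSign n (extDeg m n L u) (u :: vs) v = c
  by_cases h1 : val L p = 1 <;> by_cases h2 : val L q = 1 <;> by_cases h3 : val L r = 1
  · simp [h1, h2, h3]
  · obtain ⟨⟨h4, h5⟩, h6⟩ := hPs h1
    obtain ⟨⟨h7, h8⟩, h9⟩ := hQs h2
    simp [h1, h2, h3, hdisc r p q hmr hrv h5 h4 hru hqu h6, hdisc r q p hmr hrv h8 h7 hru hpu h9]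
  · obtain ⟨⟨h4, h5⟩, h6⟩ := hPs h1
    obtain ⟨⟨h7, h8⟩, h9⟩ := hRs h3
    simp [h1, h2, h3, hdisc q p r hmq hqv h4 h5 hqu hru h6, hdisc q r p hmq hqv h8 h7 hqu hpu h9]
  · obtain ⟨⟨h4, h5⟩, h6⟩ := hPs h1
    have h7 := hsw r q p hmp hpv hru hqu hpu h5 h4 h6
    simp [h1, h2, h3, hdisc q p r hmq hqv h4 h5 hqu hru h6,
      hdisc r p q hmr hrv h5 h4 hru hqu h6, h7, smul_neg, smul_comm c]
  · obtain ⟨⟨h4, h5⟩, h6⟩ := hQs h2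
    obtain ⟨⟨h7, h8⟩, h9⟩ := hRs h3
    simp [h1, h2, h3, hdisc p q r hmp hpv h4 h5 hpu hru h6, hdisc p r q hmp hpv h7 h8 hpu hqu h9]
  · obtain ⟨⟨h4, h5⟩, h6⟩ := hQs h2
    have h7 := hsw p r q hmq hqv hpu hru hqu h4 h5 h6
    simp [h1, h2, h3, hdisc p q r hmp hpv h4 h5 hpu hru h6,
      hdisc r q p hmr hrv h5 h4 hru hpu h6, h7, smul_neg, smul_comm c]
  · obtain ⟨⟨h4, h5⟩, h6⟩ := hRs h3
    have h7 := hsw p q r hmr hrv hpu hqu hru h4 h5 h6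
    simp [h1, h2, h3, hdisc p r q hmp hpv h4 h5 hpu hqu h6,
      hdisc q r p hmq hqv h5 h4 hqu hpu h6, h7, smul_neg, smul_comm c, units_smul_smul_self]
  · rw [hflip p q r, hflip p r q, hflip q p r]
    simp only [h1, h2, h3, if_false, smul_comm c, negOnePow_eq_neg_edgeSign n, Units.neg_smul,
      smul_neg, units_smul_smul_self]
    abel

theorem vertexTerm_congr {L' : List (ℕ × ℕ)} (hv : val L = val L') :
    vertexTerm m n x L = vertexTerm m n x L' := by
  have h1 : extDeg m n L = extDeg m n L' := by
    funext u v
    rw [extDeg, extDeg, hdeg_congr (congrFun hv v)]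
  have h2 : recTerm m n x L = recTerm m n x L' := by
    funext vs u e e' R s
    rw [recTerm, recTerm, h1]
  funext vs u v e e' R
  rw [vertexTerm, vertexTerm, h2]
  exact Finset.sum_congr rfl fun s _ => if_congr (by rw [contr_congr hv]) rfl rfl

theorem tripleTerm_congr {L' : List (ℕ × ℕ)} (hv : val L = val L') :
    tripleTerm m n x L = tripleTerm m n x L' := by
  funext vs u v f g h R
  rw [tripleTerm, tripleTerm, vertexTerm_congr hv]

theorem tripleTerm_eq_zero (hx : x ∈ hairyGraphs K m n) (hm : Odd m) (hL : IsHairy ⟨vs, L⟩)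
    (hu : u ∉ vs) (hv : v ∈ vs) (hLv : val L v ≠ 1) {B : List (ℕ × ℕ)} (hB : val B v = 0)
    (hp : (f :: g :: h :: B).Perm L) (hf : f.1 ≠ f.2) (hg : g.1 ≠ g.2) (hh : h.1 ≠ h.2)
    (hfv : f.1 = v ∨ f.2 = v) (hgv : g.1 = v ∨ g.2 = v) (hhv : h.1 = v ∨ h.2 = v) :
    tripleTerm m n x L vs u v f g h B = 0 := by
  -- The ambient edge list is part of `Q`, so that edges can be permuted and reversed until all
  -- three point towards `v`, the case of `tripleTerm_normal`.
  let Q : ℕ × ℕ → ℕ × ℕ → ℕ × ℕ → Prop := fun f g h =>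
    IsHairy ⟨vs, f :: g :: h :: B⟩ → val (f :: g :: h :: B) v ≠ 1 →
      tripleTerm m n x (f :: g :: h :: B) vs u v f g h B = 0
  have q_left : ∀ f g h, Q g f h → Q f g h := by
    intro f g h hQ h1 h2
    have p := List.Perm.swap g f (h :: B)
    rw [tripleTerm_comm_left, tripleTerm_congr (funext (val_perm p)),
      hQ (h1.edges_perm p) (by rwa [← val_perm p]), smul_zero]
  have q_right : ∀ f g h, Q f h g → Q f g h := by
    intro f g h hQ h1 h2
    have p := (List.Perm.swap h g B).cons f
    rw [tripleTerm_comm_right, tripleTerm_congr (funext (val_perm p)),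
      hQ (h1.edges_perm p) (by rwa [← val_perm p]), smul_zero]
  have q_swap : ∀ f g h, Q f.swap g h → Q f g h := by
    intro f g h hQ h1 h2
    have hv : val (f.swap :: g :: h :: B) = val (f :: g :: h :: B) :=
      funext (val_swap [] _ f)
    have h3 := hQ (IsHairy.flip (l := []) h1) (by rwa [hv])
    rw [tripleTerm_congr hv, tripleTerm_swap hx h1 hu (List.Perm.refl _)] at h3
    rw [← units_smul_smul_self n.negOnePow (tripleTerm m n x (f :: g :: h :: B) vs u v f g h B),
      h3, smul_zero]
  have q0 : ∀ f g h : ℕ × ℕ, f.1 ≠ f.2 → g.1 ≠ g.2 → h.1 ≠ h.2 → f.2 = v → g.2 = v → h.2 = v →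
      Q f g h := by
    rintro ⟨p, v'⟩ ⟨q, v''⟩ ⟨r, v'''⟩ hf hg hh h1 h2 h3 h4 h5
    simp only at hf hg hh h1 h2 h3
    subst h1 h2 h3
    exact tripleTerm_normal hx hm h4 hu hv h5 hf hg hh hB (List.Perm.refl _)
  have q1 : ∀ f g h : ℕ × ℕ, f.1 ≠ f.2 → g.1 ≠ g.2 → h.1 ≠ h.2 → (f.1 = v ∨ f.2 = v) → g.2 = v →
      h.2 = v → Q f g h := by
    intro f g h hf hg hh hfv h2 h3
    rcases hfv with h1 | h1
    · exact q_swap _ _ _ (q0 _ _ _ (Ne.symm hf) hg hh h1 h2 h3)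
    · exact q0 _ _ _ hf hg hh h1 h2 h3
  have q2 : ∀ f g h : ℕ × ℕ, f.1 ≠ f.2 → g.1 ≠ g.2 → h.1 ≠ h.2 → (f.1 = v ∨ f.2 = v) →
      (g.1 = v ∨ g.2 = v) → h.2 = v → Q f g h := by
    intro f g h hf hg hh hfv hgv h3
    rcases hgv with h2 | h2
    · exact q_left _ _ _ (q_swap _ _ _ (q_left _ _ _ (q1 _ _ _ hf (Ne.symm hg) hh hfv h2 h3)))
    · exact q1 _ _ _ hf hg hh hfv h2 h3
  have q3 : Q f g h := by
    rcases hhv with h3 | h3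
    · exact q_right _ _ _ (q_left _ _ _ (q_swap _ _ _ (q_left _ _ _ (q_right _ _ _
        (q2 _ _ _ hf hg (Ne.symm hh) hfv hgv h3)))))
    · exact q2 _ _ _ hf hg hh hfv hgv h3
  rw [← tripleTerm_congr (funext (val_perm hp))]
  exact q3 (hL.edges_perm hp.symm) (by rwa [val_perm hp])

/-- A nonzero term yields two edges at `v` that are not tadpoles; by valence three there is exactly
one more edge at `v`, again not a tadpole. Moved to the front, these three carry the whole sum. -/
theorem pickSum_vertexTerm (hx : x ∈ hairyGraphs K m n) (hm : Odd m) (hL : IsHairy ⟨vs, L⟩)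
    (hu : u ∉ vs) (hv : v ∈ vs) (hLv : val L v = 3) :
    pickSum (edgeSign n) (fun e R =>
      pickSum (edgeSign n) (vertexTerm m n x L vs u v e) R) L = 0 := by
  by_contra hne
  obtain ⟨f, R, p, h1⟩ := pickSum_exists hne
  obtain ⟨g, R', p', h2⟩ := pickSum_exists h1
  obtain ⟨⟨hf, hg⟩, hfv, hgv⟩ := vertexTerm_ne_zero h2
  have p2 := (p'.cons f).trans p
  have h3 := val_perm p2 v
  have hval : ∀ e : ℕ × ℕ, e.1 ≠ e.2 → (e.1 = v ∨ e.2 = v) → ∀ M, val (e :: M) v = val M v + 1 := by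
    intro e he hev M
    rw [val_cons]
    rcases hev with hev | hev
    · rw [if_pos hev, if_neg fun h => he (hev.trans h.symm)]
    · rw [if_pos hev, if_neg fun h => he (h.trans hev.symm)]
  rw [hval f hf hfv, hval g hg hgv, hLv] at h3
  obtain ⟨h, hhR, hhv⟩ : ∃ h ∈ R', h.1 = v ∨ h.2 = v := by
    by_contra! h4
    have := val_eq_zero.2 h4
    omega
  have p3 := List.perm_cons_erase hhR
  set B := R'.erase h
  rw [val_perm p3, val_cons] at h3
  have hh : h.1 ≠ h.2 := by
    intro h4
    rcases hhv with h5 | h5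
    · rw [if_pos h5, if_pos (h4 ▸ h5)] at h3; omega
    · rw [if_pos h5, if_pos (h4.trans h5)] at h3; omega
  have hB : val B v = 0 := by
    rcases hhv with h5 | h5 <;> rw [if_pos h5] at h3 <;> omega
  have p4 : (f :: g :: h :: B).Perm L := ((p3.symm.cons g).cons f).trans p2
  refine hne ?_
  refine Koszul.eq_zero_of_perm (Koszul.pickSum fun e => Koszul.pickSum fun e' =>
    vertexTerm_koszul hx) p4.symm ?_
  have hBf : ∀ e M, (e :: M).Perm B → ¬ (e.1 = v ∨ e.2 = v) := by
    intro e M pe h4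
    have := val_eq_zero.1 hB e (pe.mem_iff.1 List.mem_cons_self)
    rcases h4 with h4 | h4
    · exact this.1 h4
    · exact this.2 h4
  have hz1 : ∀ e e' M, ¬ (e.1 = v ∨ e.2 = v) → vertexTerm m n x L vs u v e e' M = 0 := by
    intro e e' M h4
    by_contra h5
    exact h4 (vertexTerm_ne_zero h5).2.1
  have hz2 : ∀ e e' M, ¬ (e'.1 = v ∨ e'.2 = v) → vertexTerm m n x L vs u v e e' M = 0 := by
    intro e e' M h4
    by_contra h5
    exact h4 (vertexTerm_ne_zero h5).2.2
  have hin : ∀ e k k', pickSum (edgeSign n) (vertexTerm m n x L vs u v e) (k :: k' :: B) =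
      vertexTerm m n x L vs u v e k (k' :: B) +
        edgeSign n • vertexTerm m n x L vs u v e k' (k :: B) := by
    intro e k k'
    rw [pickSum, pickSum, pickSum_eq_zero fun e' M pe => hz2 _ _ _ (hBf e' M pe), smul_zero,
      add_zero]
  have hout : ∀ G : ℕ × ℕ → List (ℕ × ℕ) → K, (∀ e M, ¬ (e.1 = v ∨ e.2 = v) → G e M = 0) →
      pickSum (edgeSign n) G (f :: g :: h :: B) = G f (g :: h :: B) +
        edgeSign n • (G g (f :: h :: B) + edgeSign n • G h (f :: g :: B)) := by
    intro G hG
    rw [pickSum, pickSum, pickSum, pickSum_eq_zero fun e M pe => hG _ _ (hBf e M pe), smul_zero,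
      add_zero]
  have h5 := tripleTerm_eq_zero hx hm hL hu hv (by omega) hB p4 hf hg hh hfv hgv hhv
  rw [hout _ fun e M h4 => pickSum_eq_zero fun e' M' _ => hz1 _ _ _ h4, hin, hin, hin, ← h5,
    tripleTerm]
  simp only [smul_add, units_smul_smul_self]
  abel

-- The sum is grouped by the trivalent vertex `v` from which `e'` is detached; only edges `e` at `v`
-- contribute.
open Classical in
theorem pickSum_recTerm_trivalent (hx : x ∈ hairyGraphs K m n) (hm : Odd m)
    (h : IsHairy ⟨vs, L⟩) (hu : u ∉ vs) :
    pickSum (edgeSign n) (fun e R => pickSum (edgeSign n) (fun e' R' => ∑ s,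
      if (Contr L e ∧ e'.1 ≠ e'.2) ∧ val L (att e' s) = 3 then recTerm m n x L vs u e e' R' s
      else 0) R) L = 0 := by
  have h1 : pickSum (edgeSign n) (fun e R => pickSum (edgeSign n) (fun e' R' => ∑ s,
      if (Contr L e ∧ e'.1 ≠ e'.2) ∧ val L (att e' s) = 3 then recTerm m n x L vs u e e' R' s
      else 0) R) L = pickSum (edgeSign n) (fun e R => pickSum (edgeSign n) (fun e' R' =>
        ∑ v ∈ vs.toFinset.filter (fun v => val L v = 3),
          vertexTerm m n x L vs u v e e' R') R) L := by
    refine pickSum_congr fun e R p => pickSum_congr fun e' R' p' => ?_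
    have p2 := (p'.cons e).trans p
    have h' := h.edges_perm p2.symm
    have he := h'.mem e (by simp)
    simp only [vertexTerm]
    rw [Finset.sum_comm]
    refine Finset.sum_congr rfl fun s _ => ?_
    have hatt : att e' s ∈ vs := h'.att_mem (by simp)
    by_cases hc : (Contr L e ∧ e'.1 ≠ e'.2) ∧ val L (att e' s) = 3
    swap
    · rw [if_neg hc, Finset.sum_eq_zero]
      intro v hv
      rw [Finset.mem_filter] at hv
      rw [if_neg]
      exact fun h2 => hc ⟨h2.1.1, h2.2 ▸ hv.2⟩
    rw [if_pos hc, Finset.sum_eq_single (att e' s)]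
    · by_cases h3 : e.1 = att e' s ∨ e.2 = att e' s
      · rw [if_pos ⟨⟨hc.1, h3⟩, rfl⟩]
      · rw [if_neg fun h4 => h3 h4.1.2, recTerm, con, coeff_eq_zero hx, smul_zero]
        rw [not_or] at h3
        intro h4
        -- If `e` does not meet the vertex, detaching `e'` leaves it bivalent and the contraction
        -- does not change that.
        refine h4.no_bivalent (att e' s) ?_ ?_
        · exact (List.Nodup.mem_erase_iff (List.nodup_cons.2 ⟨hu, h.nodup⟩)).2
            ⟨Ne.symm h3.2, List.mem_cons_of_mem _ hatt⟩
        · rw [valence_eq, val_mergeE hc.1.1.1, if_neg (Ne.symm h3.2), if_neg (Ne.symm h3.1)]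
          have h5 := val_det u e' s R' (att e' s)
          rw [if_pos rfl, if_neg (ne_of_mem_of_not_mem hatt hu).symm] at h5
          have h6 := hc.2
          rw [← val_perm p2, val_cons, if_neg h3.1, if_neg h3.2] at h6
          omega
    · intro v _ hv
      rw [if_neg fun h4 => hv h4.2.symm]
    · intro h2
      exact absurd (Finset.mem_filter.2 ⟨List.mem_toFinset.2 hatt, hc.2⟩) h2
  rw [h1]
  simp only [pickSum_sum]
  refine Finset.sum_eq_zero fun v hv => ?_
  rw [Finset.mem_filter, List.mem_toFinset] at hv
  exact pickSum_vertexTerm hx hm h hu hv.1 hv.2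

theorem splitDiff_hairDiff_add (hx : x ∈ hairyGraphs K m n) (hm : Odd m) :
    splitDiff K m n (hairDiff K x) + hairDiff K (splitDiff K m n x) = 0 := by
  classical
  funext Γ
  obtain ⟨vs, L⟩ := Γ
  by_cases h : IsHairy ⟨vs, L⟩
  swap
  · rw [Pi.add_apply, splitDiff_of_not_hairy h, hairDiff_of_not_hairy h, add_zero, Pi.zero_apply]
  obtain ⟨u, hu⟩ : ∃ u, u ∉ vs := ⟨_, fresh_not_mem ⟨vs, L⟩⟩
  have h1 := pickSum_recTerm_parallel hx h hu
  have h2 := pickSum_recTerm_trivalent hx hm h hu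
  let S : (ℕ × ℕ → ℕ × ℕ → Bool → Prop) → K := fun P =>
    pickSum (edgeSign n) (fun e R => pickSum (edgeSign n) (fun e' R' => ∑ s,
      if (Contr L e ∧ e'.1 ≠ e'.2) ∧ P e e' s then recTerm m n x L vs u e e' R' s else 0) R) L
  have key : ∀ (p q : Prop) [Decidable p] {_ : Decidable (p ∧ ¬ q)} {_ : Decidable (p ∧ q)}
      (a : K),
      (if p ∧ ¬ q then a else 0) + (if p ∧ q then a else 0) = if p then a else 0 := by
    intro p q _ _ _ a
    by_cases hp : p <;> by_cases hq : q <;> simp [hp, hq]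
  -- Both sides are the unrestricted sum of the `recTerm`s, split in two ways.
  have h3 : S (fun _ e' s => val L (att e' s) ≠ 3) + S (fun _ e' s => val L (att e' s) = 3) =
      S (fun e e' _ => ¬ Parallel e e') + S (fun e e' _ => Parallel e e') := by
    simp only [S, ← pickSum_add, ← Finset.sum_add_distrib]
    refine pickSum_congr fun e R _ => pickSum_congr fun e' R' _ =>
      Finset.sum_congr rfl fun s _ => ?_
    exact (key _ _ _).trans (key _ _ _).symm
  have h1' : S (fun e e' _ => Parallel e e') = 0 := by
    rw [← h1]
    simp only [S]
    congr!
  have h2' : S (fun _ e' s => val L (att e' s) = 3) = 0 := by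
    rw [← h2]
    simp only [S]
    congr!
  have h4 : splitDiff K m n (hairDiff K x) ⟨vs, L⟩ = -S (fun e e' _ => ¬ Parallel e e') := by
    rw [splitDiff_hairDiff_apply hx hm h hu]
    simp only [S]
    congr!
  have h5 : hairDiff K (splitDiff K m n x) ⟨vs, L⟩ =
      S (fun _ e' s => val L (att e' s) ≠ 3) := by
    rw [hairDiff_splitDiff_apply hx h hu]
    simp only [S]
    congr!
  rw [Pi.add_apply, h4, h5, Pi.zero_apply]
  linear_combination h3 - h2' + h1'

end Trivalent

open LGraph

/-! ### Degrees and loop orders -/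

namespace LGraph

variable {m n : ℤ} {vs : List ℕ} {u : ℕ} {e : ℕ × ℕ} {s : Bool} {R L : List (ℕ × ℕ)}

theorem degree_eq (vs : List ℕ) (L : List (ℕ × ℕ)) :
    degree m n ⟨vs, L⟩ = (vs.map (hdeg m n L)).sum + (1 - n) * L.length - m := rfl

theorem loopOrder_eq (vs : List ℕ) (L : List (ℕ × ℕ)) :
    loopOrder ⟨vs, L⟩ = L.length - vs.length + 1 := rfl

theorem degree_edges_perm (p : R.Perm L) : degree m n ⟨vs, R⟩ = degree m n ⟨vs, L⟩ := by
  rw [degree_eq, degree_eq, hdeg_perm p, p.length_eq]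

theorem loopOrder_edges_perm (p : R.Perm L) : loopOrder ⟨vs, R⟩ = loopOrder ⟨vs, L⟩ := by
  rw [loopOrder_eq, loopOrder_eq, p.length_eq]

theorem IsHairy.degree_contr (h : IsHairy ⟨vs, e :: R⟩) (hc : Contr (e :: R) e) :
    degree m n ⟨vs, e :: R⟩ = degree m n ⟨vs.erase e.2, R.map (mergeE e.1 e.2)⟩ + 1 := by
  have he := (h.mem e List.mem_cons_self).2
  have h1 : (vs.erase e.2).map (hdeg m n (R.map (mergeE e.1 e.2))) =
      (vs.erase e.2).map (hdeg m n (e :: R)) := List.map_congr_left fun v hv =>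
    h.hdeg_contr hc ((List.Nodup.mem_erase_iff h.nodup).1 hv).1
  have h2 := (((List.perm_cons_erase he).map (hdeg m n (e :: R))).sum_eq)
  have h3 : hdeg m n (e :: R) e.2 = n := if_neg hc.2.2
  rw [degree_eq, degree_eq, h1, h2, List.map_cons, List.sum_cons, h3, List.length_map,
    List.length_cons]
  push_cast
  ring

theorem IsHairy.loopOrder_contr (h : IsHairy ⟨vs, e :: R⟩) :
    loopOrder ⟨vs.erase e.2, R.map (mergeE e.1 e.2)⟩ = loopOrder ⟨vs, e :: R⟩ := by
  have he := (h.mem e List.mem_cons_self).2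
  have h1 := List.length_erase_add_one he
  rw [loopOrder_eq, loopOrder_eq, ← h1, List.length_map, List.length_cons]
  push_cast
  ring

/-- The only change is the new univalent vertex; for `m = -1` this makes `Δ` of degree one. -/
theorem IsHairy.degree_det (h : IsHairy ⟨vs, e :: R⟩) (hu : u ∉ vs)
    (h' : IsHairy ⟨u :: vs, det u e s :: R⟩) :
    degree m n ⟨u :: vs, det u e s :: R⟩ = degree m n ⟨vs, e :: R⟩ + m := by
  have h1 : vs.map (hdeg m n (det u e s :: R)) = vs.map (hdeg m n (e :: R)) :=
    List.map_congr_left fun v hv => h.hdeg_det hu h' hv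
  have h2 : hdeg m n (det u e s :: R) u = m := if_pos (h.val_det_fresh hu)
  rw [degree_eq, degree_eq, List.map_cons, List.sum_cons, h1, h2, List.length_cons,
    List.length_cons]
  ring

theorem loopOrder_det :
    loopOrder ⟨vs, e :: R⟩ = loopOrder ⟨u :: vs, det u e s :: R⟩ + 1 := by
  rw [loopOrder_eq, loopOrder_eq, List.length_cons, List.length_cons, List.length_cons]
  push_cast
  ring

/-- Induction by merging the ends of an edge, which costs one edge and at most one vertex. It bounds
the loop order below by zero. -/
theorem length_le_of_conn (hvs : vs.Nodup) (h : ∀ a ∈ vs, ∀ b ∈ vs, Conn L a b) :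
    vs.length ≤ L.length + 1 := by
  induction hl : L.length generalizing vs L with
  | zero =>
    obtain rfl := List.length_eq_zero_iff.1 hl
    match vs, hvs, h with
    | [], _, _ => simp
    | [_], _, _ => simp
    | a :: b :: vs, hvs, h =>
      have := (Conn.mem_iff (S := {a}) (by simp) (h a (by simp) b (by simp))).1 rfl
      simp [Set.mem_singleton_iff.1 this] at hvs
  | succ l ih =>
    match L, hl with
    | e :: R, hl =>
    have h1 := ih (vs := vs.erase e.2) (L := R.map (mergeE e.1 e.2)) (hvs.erase _)
      (fun a ha b hb => by
        rw [hvs.mem_erase_iff] at ha hb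
        have := Conn.map (L' := R.map (mergeE e.1 e.2)) (g := merge e.1 e.2) (fun f hf => ?_)
          (h a ha.2 b hb.2)
        · rwa [merge_of_ne ha.1, merge_of_ne hb.1] at this
        · rcases List.mem_cons.1 hf with rfl | hf
          · have : merge f.1 f.2 f.1 = merge f.1 f.2 f.2 := by simp [merge]
            rw [this]
            exact Conn.refl _
          · exact Conn.of_mem (e := mergeE e.1 e.2 f) (List.mem_map_of_mem hf))
      (by simpa using hl)
    have h2 := List.length_erase_of_mem (a := e.2) (l := vs)
    by_cases he : e.2 ∈ vs
    · have := h2 he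
      omega
    · rw [List.erase_of_not_mem he] at h1
      omega

theorem IsHairy.loopOrder_nonneg {Γ : LGraph} (h : Γ.IsHairy) : 0 ≤ Γ.loopOrder := by
  have := length_le_of_conn h.nodup h.connected
  rw [loopOrder]
  omega

end LGraph

/-! ### Gradings, completeness and closed images for the hairy graph complex -/

section Gradings

variable {K : Type*} [Field K] {m n : ℤ} {x : LGraph → K}

theorem exists_of_splitDiff_ne_zero {Γ : LGraph} (h : splitDiff K m n x Γ ≠ 0) :
    ∃ Γ', x Γ' ≠ 0 ∧ Γ.degree m n = Γ'.degree m n + 1 ∧ Γ'.loopOrder = Γ.loopOrder := by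
  classical
  obtain ⟨vs, L⟩ := Γ
  by_cases hΓ : IsHairy ⟨vs, L⟩
  swap
  · exact absurd (splitDiff_of_not_hairy hΓ) h
  rw [splitDiff_apply x hΓ] at h
  obtain ⟨e, R, p, h1⟩ := pickSum_exists h
  have hc : Contr L e := by
    by_contra hc
    exact h1 (if_neg hc)
  rw [if_pos hc] at h1
  have hc' : Contr (e :: R) e := by
    simpa only [Contr, val_perm p] using hc
  have h' := hΓ.edges_perm p.symm
  refine ⟨⟨vs.erase e.2, R.map (mergeE e.1 e.2)⟩, fun h0 => h1 ?_, ?_, ?_⟩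
  · rw [con, h0, smul_zero]
  · rw [← h'.degree_contr hc', degree_edges_perm p]
  · rw [h'.loopOrder_contr, loopOrder_edges_perm p]

theorem exists_of_hairDiff_ne_zero (hx : x ∈ hairyGraphs K m n) {Γ : LGraph}
    (h : hairDiff K x Γ ≠ 0) :
    ∃ Γ', x Γ' ≠ 0 ∧ Γ'.degree m n = Γ.degree m n + m ∧ Γ.loopOrder = Γ'.loopOrder + 1 := by
  classical
  obtain ⟨vs, L⟩ := Γ
  by_cases hΓ : IsHairy ⟨vs, L⟩
  swap
  · exact absurd (hairDiff_of_not_hairy hΓ) h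
  obtain ⟨u, hu⟩ : ∃ u, u ∉ vs := ⟨_, fresh_not_mem ⟨vs, L⟩⟩
  rw [hairDiff_apply_det hx hΓ hu] at h
  obtain ⟨e, R, p, h1⟩ := pickSum_exists h
  have h2 : ∃ s, x ⟨u :: vs, det u e s :: R⟩ ≠ 0 := by
    by_contra! h2
    exact h1 (by simp [h2])
  obtain ⟨s, h2⟩ := h2
  have h' := hΓ.edges_perm p.symm
  have hd : IsHairy ⟨u :: vs, det u e s :: R⟩ := by
    by_contra hd
    exact h2 (coeff_eq_zero hx hd)
  refine ⟨_, h2, ?_, ?_⟩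
  · rw [h'.degree_det hu hd, degree_edges_perm p]
  · rw [← loopOrder_det, loopOrder_edges_perm p]

theorem mem_supportedOn {P : LGraph → Prop} : x ∈ supportedOn K P ↔ ∀ Γ, x Γ ≠ 0 → P Γ :=
  forall_congr' fun _ => not_imp_comm

theorem splitDiff_mem_HGC {k : ℤ} (hx : x ∈ HGC K m n k) : splitDiff K m n x ∈ HGC K m n (k + 1) :=
  ⟨splitDiff_mem hx.1, mem_supportedOn.2 fun Γ h => by
    obtain ⟨Γ', h1, h2, -⟩ := exists_of_splitDiff_ne_zero h
    rw [h2, mem_supportedOn.1 hx.2 Γ' h1]⟩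

theorem hairDiff_mem_HGC {k : ℤ} (hx : x ∈ HGC K (-1) n k) : hairDiff K x ∈ HGC K (-1) n (k + 1) :=
  ⟨hairDiff_mem hx.1, mem_supportedOn.2 fun Γ h => by
    obtain ⟨Γ', h1, h2, -⟩ := exists_of_hairDiff_ne_zero hx.1 h
    have := mem_supportedOn.1 hx.2 Γ' h1
    omega⟩

theorem splitDiff_mem_HGCLoop {p k : ℤ} (hx : x ∈ HGCLoop K m n p k) :
    splitDiff K m n x ∈ HGCLoop K m n p (k + 1) :=
  ⟨splitDiff_mem_HGC hx.1, mem_supportedOn.2 fun Γ h => by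
    obtain ⟨Γ', h1, -, h2⟩ := exists_of_splitDiff_ne_zero h
    rw [← h2, mem_supportedOn.1 hx.2 Γ' h1]⟩

theorem hairDiff_mem_HGCLoop {p k : ℤ} (hx : x ∈ HGCLoop K (-1) n p k) :
    hairDiff K x ∈ HGCLoop K (-1) n (p + 1) (k + 1) :=
  ⟨hairDiff_mem_HGC hx.1, mem_supportedOn.2 fun Γ h => by
    obtain ⟨Γ', h1, -, h2⟩ := exists_of_hairDiff_ne_zero hx.1.1 h
    rw [h2, mem_supportedOn.1 hx.2 Γ' h1]⟩

theorem splitDiff_mem_loopFiltration {p : ℤ} (hx : x ∈ loopFiltration K p) :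
    splitDiff K m n x ∈ loopFiltration K p :=
  mem_supportedOn.2 fun Γ h => by
    obtain ⟨Γ', h1, -, h2⟩ := exists_of_splitDiff_ne_zero h
    exact h2 ▸ mem_supportedOn.1 hx Γ' h1

theorem hairDiff_mem_loopFiltration (hx : x ∈ hairyGraphs K m n) {p : ℤ}
    (hx' : x ∈ loopFiltration K p) : hairDiff K x ∈ loopFiltration K (p + 1) :=
  mem_supportedOn.2 fun Γ h => by
    obtain ⟨Γ', h1, -, h2⟩ := exists_of_hairDiff_ne_zero hx h
    have := mem_supportedOn.1 hx' Γ' h1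
    omega

theorem loopFiltration_antitone : Antitone (loopFiltration K) := fun _ _ h _ hx =>
  mem_supportedOn.2 fun Γ hΓ => h.trans (mem_supportedOn.1 hx Γ hΓ)

theorem HGC_le_loopFiltration_zero (k : ℤ) : HGC K m n k ≤ loopFiltration K 0 := fun _ hx =>
  mem_supportedOn.2 fun _ hΓ => IsHairy.loopOrder_nonneg (not_not.1 (mt (coeff_eq_zero hx.1) hΓ))

theorem eq_zero_of_forall_mem_loopFiltration (hx : ∀ p, x ∈ loopFiltration K p) : x = 0 := by
  funext Γ
  by_contra h
  have := mem_supportedOn.1 (hx (Γ.loopOrder + 1)) Γ h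
  omega

/-- An element may be assembled from its parts of given loop orders. -/
theorem diagonal_mem_HGC {k : ℤ} {x : ℤ → LGraph → K} (hx : ∀ p, x p ∈ HGC K m n k) :
    (fun Γ => x Γ.loopOrder Γ) ∈ HGC K m n k := by
  refine ⟨⟨fun Γ h => (hx _).1.1 Γ h, fun σ Γ => ?_, fun l l' a b es => ?_,
    fun vs l l' e e' => ?_, fun vs l l' a b => ?_⟩, fun Γ h => (hx _).2 Γ h⟩
  · have h : (Γ.relabel σ).loopOrder = Γ.loopOrder := by simp [loopOrder, relabel]
    dsimp only
    rw [h]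
    exact (hx _).1.2.1 σ Γ
  · have h : loopOrder ⟨l ++ b :: a :: l', es⟩ = loopOrder ⟨l ++ a :: b :: l', es⟩ := by
      simp [loopOrder]
    dsimp only
    rw [h]
    exact (hx _).1.2.2.1 l l' a b es
  · have h : loopOrder ⟨vs, l ++ e' :: e :: l'⟩ = loopOrder ⟨vs, l ++ e :: e' :: l'⟩ := by
      simp [loopOrder]
    dsimp only
    rw [h]
    exact (hx _).1.2.2.2.1 vs l l' e e'
  · have h : loopOrder ⟨vs, l ++ (b, a) :: l'⟩ = loopOrder ⟨vs, l ++ (a, b) :: l'⟩ := by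
      simp [loopOrder]
    dsimp only
    rw [h]
    exact (hx _).1.2.2.2.2 vs l l' a b

theorem exists_HGCLoop_sub_mem {p k : ℤ} (hx : x ∈ HGC K m n k) (hp : x ∈ loopFiltration K p) :
    ∃ y ∈ HGCLoop K m n p k, x - y ∈ loopFiltration K (p + 1) := by
  refine ⟨_, ⟨diagonal_mem_HGC (x := fun q => if q = p then x else 0) fun q => ?_, ?_⟩, ?_⟩
  · split_ifs
    · exact hx
    · exact zero_mem _
  · intro Γ h
    simp [h]
  · refine mem_supportedOn.2 fun Γ h => ?_
    by_cases hΓ : Γ.loopOrder = p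
    · simp [hΓ] at h
    · have h1 : x Γ ≠ 0 := by simpa [hΓ] using h
      have := mem_supportedOn.1 hp Γ h1
      omega

/-- The coefficient of `Γ` in `x q` is constant for `q` greater than the loop order of `Γ`, which is
why the limit takes it at loop order plus one. -/
theorem exists_limit_HGC {k : ℤ} {x : ℤ → LGraph → K} (hx : ∀ p, x p ∈ HGC K m n k)
    (h : ∀ p, x (p + 1) - x p ∈ loopFiltration K p) :
    ∃ y ∈ HGC K m n k, ∀ p, y - x p ∈ loopFiltration K p := by
  refine ⟨_, diagonal_mem_HGC (x := fun p => x (p + 1)) fun p => hx _, fun p Γ hΓ => ?_⟩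
  rw [not_le] at hΓ
  have key : ∀ q, Γ.loopOrder + 1 ≤ q → x q Γ = x (Γ.loopOrder + 1) Γ := by
    intro q hq
    induction q, hq using Int.leInduction with
    | base => rfl
    | succ q hq ih =>
      rw [← ih]
      exact sub_eq_zero.1 (h q Γ (by omega))
  simp [key p hΓ]

open Finsupp

/-- Each coefficient of the image involves finitely many unknowns, as linear compactness requires.
-/
theorem exists_finsupp_splitDiff (m n : ℤ) (Γ : LGraph) :
    ∃ f : LGraph →₀ K, ∀ x, linearCombination K x f = splitDiff K m n x Γ := by
  classical
  by_cases h : Γ.IsHairy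
  · refine ⟨∑ i : Fin Γ.edges.length, if Γ.Contractible i then
      Γ.contractSign m n i • single (Γ.contract i) 1 else 0, fun x => ?_⟩
    change _ = if Γ.IsHairy then _ else _
    rw [if_pos h, map_sum]
    refine Finset.sum_congr rfl fun i _ => ?_
    split_ifs
    · rw [Units.smul_def, map_zsmul, linearCombination_single, one_smul]
      rfl
    · exact map_zero _
  · exact ⟨0, fun x => by rw [map_zero, splitDiff_of_not_hairy h]⟩

theorem exists_finsupp_hairDiff (Γ : LGraph) :
    ∃ f : LGraph →₀ K, ∀ x, linearCombination K x f = hairDiff K x Γ := by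
  classical
  by_cases h : Γ.IsHairy
  · refine ⟨∑ i : Fin Γ.edges.length, if (Γ.edges.get i).1 ≠ (Γ.edges.get i).2 then
      single (Γ.detachSnd i) 1 + single (Γ.detachFst i) 1 else 0, fun x => ?_⟩
    change _ = if Γ.IsHairy then _ else _
    rw [if_pos h, map_sum]
    refine Finset.sum_congr rfl fun i _ => ?_
    split_ifs
    · rw [map_add, linearCombination_single, linearCombination_single, one_smul, one_smul]
    · exact map_zero _
  · exact ⟨0, fun x => by rw [map_zero, hairDiff_of_not_hairy h]⟩

/-- The filtered pieces of the hairy graph complex are cut out by finitely supported functionals. -/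
theorem mem_HGC_of_functionals {k q : ℤ} {w : LGraph → K}
    (h : ∀ f : LGraph →₀ K,
      (∀ w' ∈ HGC K m n k ⊓ loopFiltration K q, linearCombination K w' f = 0) →
        linearCombination K w f = 0) : w ∈ HGC K m n k ⊓ loopFiltration K q := by
  -- Every defining condition involves at most two coefficients: it is a vanishing (`key1`) or an
  -- equality up to sign (`key2`).
  have key1 : ∀ Γ, (∀ w' ∈ HGC K m n k ⊓ loopFiltration K q, w' Γ = 0) → w Γ = 0 := by
    intro Γ hΓ
    simpa using h (single Γ 1) fun w' hw' => by simpa using hΓ w' hw'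
  have key2 : ∀ Γ Γ' (u : ℤˣ), (∀ w' ∈ HGC K m n k ⊓ loopFiltration K q, w' Γ = u • w' Γ') →
      w Γ = u • w Γ' := by
    intro Γ Γ' u hΓ
    have h1 : ∀ w' : LGraph → K, linearCombination K w' (single Γ 1 - (u : ℤ) • single Γ' 1) =
        w' Γ - u • w' Γ' := by
      intro w'
      rw [map_sub, map_zsmul, linearCombination_single, linearCombination_single, one_smul,
        one_smul, Units.smul_def]
    have h2 := h (single Γ 1 - (u : ℤ) • single Γ' 1) fun w' hw' => by
      rw [h1, hΓ w' hw', sub_self]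
    rw [h1] at h2
    exact sub_eq_zero.1 h2
  refine ⟨⟨⟨fun Γ hΓ => key1 Γ fun w' hw' => hw'.1.1.1 Γ hΓ, fun σ Γ => ?_,
    fun l l' a b es => key2 _ _ _ fun w' hw' => hw'.1.1.2.2.1 l l' a b es,
    fun vs l l' e e' => key2 _ _ _ fun w' hw' => hw'.1.1.2.2.2.1 vs l l' e e',
    fun vs l l' a b => key2 _ _ _ fun w' hw' => hw'.1.1.2.2.2.2 vs l l' a b⟩,
    fun Γ hΓ => key1 Γ fun w' hw' => hw'.1.2 Γ hΓ⟩,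
    fun Γ hΓ => key1 Γ fun w' hw' => hw'.2 Γ hΓ⟩
  have := key2 (Γ.relabel σ) Γ 1 fun w' hw' => by rw [one_smul]; exact hw'.1.1.2.1 σ Γ
  rwa [one_smul] at this

/-- Finitely many equations concern graphs of bounded loop order, so an approximate solution beyond
that bound solves them exactly. -/
theorem exists_preimage_HGC {k q : ℤ} {x : LGraph → K}
    (h : ∀ p, ∃ w ∈ HGC K m n k, w ∈ loopFiltration K q ∧
      x - (splitDiff K m n + hairDiff K) w ∈ loopFiltration K p) :
    ∃ w ∈ HGC K m n k, w ∈ loopFiltration K q ∧ (splitDiff K m n + hairDiff K) w = x := by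
  choose f hf using exists_finsupp_splitDiff (K := K) m n
  choose g hg using exists_finsupp_hairDiff (K := K)
  have hfg : ∀ w Γ, linearCombination K w (f Γ + g Γ) = (splitDiff K m n + hairDiff K) w Γ := by
    intro w Γ
    rw [map_add, hf, hg]
    rfl
  obtain ⟨w, hw, hx⟩ := exists_solution_of_finite (HGC K m n k ⊓ loopFiltration K q)
    (fun w hw => mem_HGC_of_functionals hw) (fun Γ => f Γ + g Γ) x fun T => by
      obtain ⟨p, hp⟩ := (T.image loopOrder).exists_le
      obtain ⟨w, hw, hwq, h1⟩ := h (p + 1)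
      refine ⟨w, ⟨hw, hwq⟩, fun Γ hΓ => ?_⟩
      have h2 := hp _ (Finset.mem_image_of_mem _ hΓ)
      rw [hfg]
      exact (sub_eq_zero.1 (h1 Γ (by omega))).symm
  exact ⟨w, hw.1, hw.2, funext fun Γ => by rw [← hx Γ, hfg]⟩

/-- The hairy graph complex `(HGC, δ + Δ)`, filtered by loop order. -/
noncomputable def hairyComplex (K : Type*) [Field K] (n : ℤ) : FilteredComplex K (LGraph → K) where
  C := HGC K (-1) n
  d := splitDiff K (-1) n + hairDiff K
  F := loopFiltration K
  d_mem _ _ hx := add_mem (splitDiff_mem_HGC hx) (hairDiff_mem_HGC hx)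
  d_sq k x hx := by
    have hm : Odd (-1 : ℤ) := by decide
    have h := splitDiff_hairDiff_add hx.1 hm
    simp only [LinearMap.add_apply, map_add, splitDiff_splitDiff hx.1, hairDiff_hairDiff hx.1 hm,
      zero_add, add_zero]
    rwa [add_comm] at h
  F_anti := loopFiltration_antitone
  d_F p k x hx hp := add_mem (splitDiff_mem_loopFiltration hp)
    (loopFiltration_antitone (by omega) (hairDiff_mem_loopFiltration hx.1 hp))

end Gradings

/-! ### The spectral sequence of the hairy graph complex -/

theorem mainTheorem4 {K : Type*} [Field K] [CharZero K] (n : ℤ) :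
    -- `(HGC, δ)` is a complex, graded by the loop order; `Δ` has degree one, raises the loop order
    -- by one, squares to zero and anticommutes with `δ`
    (∀ p k, ∀ x ∈ HGCLoop K (-1) n p k, splitDiff K (-1) n x ∈ HGCLoop K (-1) n p (k + 1)) ∧
    (∀ p k, ∀ x ∈ HGCLoop K (-1) n p k, hairDiff K x ∈ HGCLoop K (-1) n (p + 1) (k + 1)) ∧
    (∀ k, ∀ x ∈ HGC K (-1) n k,
      splitDiff K (-1) n (splitDiff K (-1) n x) = 0 ∧
      hairDiff K (hairDiff K x) = 0 ∧
      splitDiff K (-1) n (hairDiff K x) + hairDiff K (splitDiff K (-1) n x) = 0) ∧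
    -- `(HGC, δ + Δ)` is a complex, filtered by loop order
    ∃ X : FilteredComplex K (LGraph → K),
      X.C = HGC K (-1) n ∧
      X.d = splitDiff K (-1) n + hairDiff K ∧
      X.F = loopFiltration K ∧
      -- the associated graded page of its spectral sequence is `(HGC, δ)`
      (∃ e : (p k : ℤ) → (HGCLoop K (-1) n p k ≃ₗ[K] X.E 0 p k),
        (∀ p k (x : HGCLoop K (-1) n p k), ∃ z : X.Z ((0 : ℕ) : ℤ) p k,
          (z : LGraph → K) = x ∧ e p k x = SubQuot.mk _ z) ∧
        (∀ p k (x : HGCLoop K (-1) n p k) (y : HGCLoop K (-1) n p (k + 1)),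
          (y : LGraph → K) = splitDiff K (-1) n x →
            X.dE 0 (p := p) (q := p) (by simp) k (e p k x) = e p (k + 1) y)) ∧
      -- hence the page `E_1` is the cohomology of `(HGC, δ)`
      (∃ e : (p k : ℤ) →
          (Cohomology (HGCLoop K (-1) n p) (splitDiff K (-1) n) k ≃ₗ[K] X.E 1 p k),
        ∀ p k (x : cocycles (HGCLoop K (-1) n p) (splitDiff K (-1) n) k),
          ∃ z : X.Z ((1 : ℕ) : ℤ) p k,
            (z : LGraph → K) = x ∧ e p k (SubQuot.mk _ x) = SubQuot.mk _ z) ∧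
      -- the spectral sequence converges to the cohomology of `(HGC, δ + Δ)`
      X.ConvergesTo X.H X.FH ∧
      -- it vanishes in the limit in each degree in which this cohomology vanishes
      (∀ k, Subsingleton (X.H k) → ∀ p, Subsingleton (X.EInf p k)) ∧
      -- if the cohomology is zero, then it converges to zero
      ((∀ k, Subsingleton (X.H k)) → X.ConvergesToZero) := by
  have hm : Odd (-1 : ℤ) := by decide
  have hG : ∀ p k, ∀ x ∈ HGCLoop K (-1) n p k, x ∈ HGC K (-1) n k ∧ x ∈ loopFiltration K p :=
    fun p k x hx => ⟨hx.1, mem_supportedOn.2 fun Γ h => (mem_supportedOn.1 hx.2 Γ h).ge⟩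
  have hG0 : ∀ p k, ∀ x ∈ HGCLoop K (-1) n p k, x ∈ loopFiltration K (p + 1) → x = 0 := by
    intro p k x hx hF
    funext Γ
    by_contra h
    have h1 := mem_supportedOn.1 hx.2 Γ h
    have h2 := mem_supportedOn.1 hF Γ h
    omega
  have hd : ∀ p k, ∀ x ∈ HGCLoop K (-1) n p k,
      (splitDiff K (-1) n + hairDiff K) x - splitDiff K (-1) n x ∈ loopFiltration K (p + 1) := by
    intro p k x hx
    rw [LinearMap.add_apply, add_sub_cancel_left]
    exact hairDiff_mem_loopFiltration hx.1.1 (hG p k x hx).2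
  have hconv : (hairyComplex K n).ConvergesTo (hairyComplex K n).H (hairyComplex K n).FH :=
    (hairyComplex K n).convergesTo_cohomology HGC_le_loopFiltration_zero
      (fun x => eq_zero_of_forall_mem_loopFiltration) (fun k x hx h => exists_limit_HGC hx h)
      (fun k q x h => exists_preimage_HGC h)
  refine ⟨fun p k x hx => splitDiff_mem_HGCLoop hx, fun p k x hx => hairDiff_mem_HGCLoop hx,
    fun k x hx => ⟨splitDiff_splitDiff hx.1, hairDiff_hairDiff hx.1 hm,
      splitDiff_hairDiff_add hx.1 hm⟩, hairyComplex K n, rfl, rfl, rfl,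
    ⟨(hairyComplex K n).pageZeroEquiv (HGCLoop K (-1) n) hG hG0
      (fun p k x => exists_HGCLoop_sub_mem), fun p k x => ⟨_, ?_, rfl⟩, fun p k x y hy => ?_⟩,
    ⟨(hairyComplex K n).pageOneEquiv (HGCLoop K (-1) n) (splitDiff K (-1) n) hG hG0
      (fun p k x => exists_HGCLoop_sub_mem) (fun p k x => splitDiff_mem_HGCLoop) hd,
      fun p k x => ⟨_, ?_, rfl⟩⟩, hconv,
    fun k hk => (hairyComplex K n).subsingleton_EInf hconv k hk,
    (hairyComplex K n).convergesToZero hconv⟩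
  · rfl
  · refine sub_eq_zero.1 ?_
    refine (SubQuot.mk_eq_zero (_ - _)).2 (Submodule.mem_sup_left ?_)
    -- The discrepancy between `d` and `δ` is `Δ x`, of loop order `p + 1`, hence in the summand
    -- `Z_(-1)^(p+1)` of the denominator.
    have h1 : (splitDiff K (-1) n + hairDiff K) (x : LGraph → K) - y = hairDiff K x := by
      rw [hy, LinearMap.add_apply, add_sub_cancel_left]
    have h2 := hairDiff_mem_HGCLoop x.2
    change (splitDiff K (-1) n + hairDiff K) (x : LGraph → K) - y ∈ _
    rw [h1]
    refine ⟨hG _ _ _ h2, ?_⟩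
    have h3 := (hairyComplex K n).d_F _ _ _ (hG _ _ _ h2).1 (hG _ _ _ h2).2
    exact loopFiltration_antitone (by simp) h3
  · rfl
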